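/- Let $F$ be a $p$-adic field with residue field of cardinality $q$, $W_F$ its Weil group, $I_F\subset W_F$ the inertia group, and $|w|_F=q^n$ if $w\in W_F$ acts on the residue field of $\overline F$ as $x\mapsto x^{q^n}$ $(n\in\mathbb Z)$. Let $\widehat G$ be a connected reductive complex algebraic group with Lie algebra $\widehat{\mathfrak g}$, on which $\mathrm{Gal}(\overline F/F)$ acts by automorphisms of algebraic groups, trivially on an open subgroup, and let ${}^LG=\widehat G\rtimes W_F$ (for example, the $L$-group of a connected reductive algebraic group $G$ over $F$). Let $\mathrm{Ad}$ be the adjoint representation of ${}^LG$ on $\widehat{\mathfrak g}$. A Langlands parameter is a continuous homomorphism $\phi:W_F\times \mathrm{SL}_2(\mathbb C)\to{}^LG$, compatible with the projections to $W_F$, algebraic on $\mathrm{SL}_2(\mathbb C)$, and such that $\phi(w,1)$ is semisimple for Frobenius elements $w$ (here an element of ${}^LG$ is called semisimple if its image in $\widehat G\rtimes\mathrm{Gal}(E/F)$ is, for any finite Galois extension $E/F$ through which the action on $\widehat G$ factors). For such $\phi$ put $$\lambda(w)=\phi\bigl(w,\mathrm{diag}(|w|_F^{1/2},|w|_F^{-1/2})\bigr),\qquad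 N=d\phi\begin{pmatrix}0&1\\0&0\end{pmatrix}\in\widehat{\mathfrak g},$$ $$V_\lambda=\{x\in\widehat{\mathfrak g}: \mathrm{Ad}(\lambda(w))x=|w|_F\,x\ \ \forall w\in W_F\},\qquad H_\lambda=\{g\in\widehat G: g\lambda(w)g^{-1}=\lambda(w)\ \ \forall w\in W_F\}.$$ Then $N\in V_\lambda$, and $\phi$ is called open if the orbit of $N$ under the adjoint action of $H_\lambda$ is Zariski open in $V_\lambda$. Let $\widehat{\mathfrak g}_N^{I_F}$ be the space of those $y\in\widehat{\mathfrak g}$ with $[N,y]=0$ which are fixed by $\mathrm{Ad}(\lambda(I_F))$, let $\mathrm{Fr}\in W_F$ be a geometric Frobenius element (so $|\mathrm{Fr}|_F=q^{-1}$), and let $$L(s,\phi,\mathrm{Ad})=\det\bigl(1-q^{-s}\mathrm{Ad}(\lambda(\mathrm{Fr}))\,\big|\,\widehat{\mathfrak g}_N^{I_F}\bigr)^{-1}.$$ Proposition. For every Langlands parameter $\phi$, the function $L(s,\phi,\mathrm{Ad})$ is regular at $s=1$ if and only if $\phi$ is open. -/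

import Mathlib

open ValuativeRel

noncomputable section

namespace Langlands

/-! ## The Weil group of a non-archimedean local field -/

section WeilGroup

variable (F : Type*) [Field F] [ValuativeRel F] [TopologicalSpace F]
  [IsNonarchimedeanLocalField F]

/-- The absolute Galois group of `F`, with its Krull topology. -/
abbrev GalF := Gal(AlgebraicClosure F/F)

/-- The integral closure of the ring of integers of `F` in the algebraic closure of `F`. -/
abbrev IntBar := integralClosure 𝒪[F] (AlgebraicClosure F)

/-- The number `q` of elements of the residue field of `F`. -/
def residueCard : ℕ := Nat.card 𝓀[F]

variable {F} in
/-- The action of a Galois automorphism on the integers of the algebraic closure. -/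
def intAct (σ : GalF F) : IntBar F ≃ₐ[𝒪[F]] IntBar F :=
  AlgEquiv.mapIntegralClosure (σ.restrictScalars 𝒪[F])

variable {F} in
/-- `σ` acts as `x ↦ x ^ (q ^ n)`, `n ∈ ℤ`, on the residue field of the algebraic closure: writing
`n = a - b`, this says `σ(x) ^ (q ^ b) ≡ x ^ (q ^ a)` modulo the maximal ideal of the
integers of the algebraic closure. (That ring is local, because `F` is henselian, so its
maximal ideal is its Jacobson radical.) -/
def HasFrobDegree (σ : GalF F) (n : ℤ) : Prop :=
  ∃ a b : ℕ, n = a - b ∧ ∀ x : IntBar F,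
    (intAct σ x) ^ (residueCard F ^ b) - x ^ (residueCard F ^ a) ∈ Ring.jacobson (IntBar F)

lemma one_lt_residueCard : 1 < residueCard F := Finite.one_lt_card

variable {F}

lemma frob_aux {a b c d : ℕ} {x y z : IntBar F} {q : ℕ}
    (h₁ : z ^ (q ^ b) - y ^ (q ^ a) ∈ Ring.jacobson (IntBar F))
    (h₂ : y ^ (q ^ d) - x ^ (q ^ c) ∈ Ring.jacobson (IntBar F)) :
    z ^ (q ^ (b + d)) - x ^ (q ^ (a + c)) ∈ Ring.jacobson (IntBar F) := by
  rw [← Ideal.Quotient.eq] at *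
  simp only [map_pow] at *
  rw [pow_add, pow_mul, h₁, ← pow_mul, mul_comm, pow_mul, h₂, ← pow_mul, ← pow_add, add_comm]

lemma HasFrobDegree.one : HasFrobDegree (1 : GalF F) 0 :=
  ⟨0, 0, by simp, fun x => by
    have : intAct (1 : GalF F) x = x := rfl
    simp [this]⟩

lemma HasFrobDegree.mul {σ τ : GalF F} {m n : ℤ} (hσ : HasFrobDegree σ m)
    (hτ : HasFrobDegree τ n) : HasFrobDegree (σ * τ) (m + n) := by
  obtain ⟨a, b, rfl, h₁⟩ := hσ
  obtain ⟨c, d, rfl, h₂⟩ := hτ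
  refine ⟨a + c, b + d, by push_cast; ring, fun x => ?_⟩
  exact frob_aux (h₁ (intAct τ x)) (h₂ x)

lemma HasFrobDegree.inv {σ : GalF F} {m : ℤ} (hσ : HasFrobDegree σ m) :
    HasFrobDegree σ⁻¹ (-m) := by
  obtain ⟨a, b, rfl, h₁⟩ := hσ
  refine ⟨b, a, by ring, fun x => ?_⟩
  have h := h₁ (intAct σ⁻¹ x)
  have e : intAct σ (intAct σ⁻¹ x) = x := Subtype.ext (σ.apply_symm_apply _)
  rw [e] at h
  rw [← neg_sub]
  exact neg_mem h

lemma isAlgClosed_residue (M : Ideal (IntBar F)) [M.IsMaximal] :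
    let _ := Ideal.Quotient.field M
    IsAlgClosed (IntBar F ⧸ M) := by
  let _ := Ideal.Quotient.field M
  refine IsAlgClosed.of_exists_root _ fun p hp hirr => ?_
  have hl : p ∈ Polynomial.lifts (Ideal.Quotient.mk M) := by
    rw [Polynomial.mem_lifts]
    exact Polynomial.map_surjective _ Ideal.Quotient.mk_surjective p
  obtain ⟨P, rfl, hdeg, hP⟩ := Polynomial.lifts_and_natDegree_eq_and_monic hl hp
  have hd : 0 < P.natDegree := hdeg ▸ hirr.natDegree_pos
  have hP' : (P.map (algebraMap (IntBar F) (AlgebraicClosure F))).Monic := hP.map _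
  obtain ⟨r, hr⟩ := IsAlgClosed.exists_root
    (P.map (algebraMap (IntBar F) (AlgebraicClosure F))) (by
      rw [Polynomial.degree_map_eq_of_injective Subtype.val_injective]
      exact (Polynomial.natDegree_pos_iff_degree_pos.1 hd).ne')
  have hri : IsIntegral (IntBar F) r := ⟨P, hP, by rwa [Polynomial.IsRoot, Polynomial.eval_map] at hr⟩
  have hri' : IsIntegral 𝒪[F] r := isIntegral_trans r hri
  refine ⟨Ideal.Quotient.mk M ⟨r, hri'⟩, ?_⟩
  have : P.eval (⟨r, hri'⟩ : IntBar F) = 0 := by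
    apply Subtype.val_injective
    rw [Polynomial.IsRoot, Polynomial.eval_map] at hr
    change algebraMap (IntBar F) (AlgebraicClosure F) _ = _
    rw [← Polynomial.eval₂_at_apply]
    exact hr
  rw [Polynomial.eval_map, Polynomial.eval₂_at_apply, this, map_zero]

/-- The power of Frobenius through which an automorphism acts is unique. -/
lemma HasFrobDegree.unique {σ : GalF F} {m n : ℤ} (hm : HasFrobDegree σ m)
    (hn : HasFrobDegree σ n) : m = n := by
  have h := hm.inv.mul hn
  rw [inv_mul_cancel] at h
  obtain ⟨a, b, hab, h⟩ := h
  obtain ⟨M, hM⟩ := Ideal.exists_maximal (IntBar F)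
  let _ := Ideal.Quotient.field M
  have := isAlgClosed_residue M
  by_contra hne
  have hab' : b ≠ a := by rintro rfl; simp at hab; omega
  have hq := one_lt_residueCard F
  have hpow : residueCard F ^ b ≠ residueCard F ^ a :=
    fun e => hab' (Nat.pow_right_injective hq e)
  set p : Polynomial (IntBar F ⧸ M) :=
    Polynomial.X ^ (residueCard F ^ b) - Polynomial.X ^ (residueCard F ^ a) with hp
  have hp0 : p = 0 := by
    apply Polynomial.funext
    intro y
    obtain ⟨x, rfl⟩ := Ideal.Quotient.mk_surjective y
    have hx := h x
    have e : intAct (1 : GalF F) x = x := rfl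
    rw [e] at hx
    have hle : Ring.jacobson (IntBar F) ≤ M := by
      rw [← Ideal.jacobson_bot]
      exact sInf_le ⟨bot_le, hM⟩
    have := Ideal.Quotient.eq_zero_iff_mem.2 (hle hx)
    simpa [hp] using this
  have hc := congrArg (fun r => Polynomial.coeff r (residueCard F ^ b)) hp0
  simp [hp, Polynomial.coeff_X_pow, hpow] at hc

variable (F)

/-- The Weil group as an abstract subgroup of the absolute Galois group: the automorphisms which
act on the residue field of the algebraic closure as an integral power of the Frobenius. -/
def weilSubgroup : Subgroup (GalF F) where
  carrier := {σ | ∃ n : ℤ, HasFrobDegree σ n}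
  one_mem' := ⟨0, HasFrobDegree.one⟩
  mul_mem' := fun ⟨m, hm⟩ ⟨n, hn⟩ => ⟨m + n, hm.mul hn⟩
  inv_mem' := fun ⟨m, hm⟩ => ⟨-m, hm.inv⟩

/-- The Weil group `W_F`. It is a type of its own because its topology is not the one
induced from the Galois group. -/
def WeilGroup : Type _ := weilSubgroup F

instance : Group (WeilGroup F) := inferInstanceAs (Group (weilSubgroup F))

/-- The inclusion of the Weil group in the absolute Galois group. -/
def weilIncl : WeilGroup F →* GalF F := (weilSubgroup F).subtype

/-- `weilDeg w = n` if `w` acts as `x ↦ x ^ (q ^ n)` on the residue field of the algebraic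
closure. -/
def weilDeg : WeilGroup F →* Multiplicative ℤ where
  toFun w := Multiplicative.ofAdd (Classical.choose w.2)
  map_one' := congrArg Multiplicative.ofAdd
    ((Classical.choose_spec (1 : weilSubgroup F).2).unique HasFrobDegree.one)
  map_mul' v w := congrArg Multiplicative.ofAdd
    ((Classical.choose_spec ((v : weilSubgroup F) * (w : weilSubgroup F)).2).unique
      ((Classical.choose_spec v.2).mul (Classical.choose_spec w.2)))

/-- The topology of the Weil group: the inertia group (the kernel of `weilDeg`) is open and
carries the topology induced from the Galois group. -/
instance : TopologicalSpace (WeilGroup F) :=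
  TopologicalSpace.induced (weilIncl F) inferInstance ⊓ TopologicalSpace.induced (weilDeg F) ⊥

/-- The inertia group `I_F`. -/
def inertia : Subgroup (WeilGroup F) := (weilDeg F).ker

variable {F}

/-- The norm `|w|_F`, equal to `q ^ n` if `w` acts as `x ↦ x ^ (q ^ n)` on the residue field of the
algebraic closure. -/
def weilNorm (w : WeilGroup F) : ℝ := (residueCard F : ℝ) ^ (Multiplicative.toAdd (weilDeg F w))

/-- `w` is a geometric Frobenius element: its inverse acts as `x ↦ x ^ q` on the residue field of
the algebraic closure. Equivalently `|w|_F = q⁻¹`. -/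
def IsGeometricFrobenius (w : WeilGroup F) : Prop :=
  Multiplicative.toAdd (weilDeg F w) = -1

lemma weilNorm_pos (w : WeilGroup F) : 0 < weilNorm w :=
  zpow_pos (by exact_mod_cast (one_lt_residueCard F).le) _

lemma weilNorm_mul (v w : WeilGroup F) : weilNorm (v * w) = weilNorm v * weilNorm w := by
  have : (residueCard F : ℝ) ≠ 0 := by exact_mod_cast (one_lt_residueCard F).ne_bot
  simp [weilNorm, zpow_add₀ this]

lemma inertia_conj_mem (w v : WeilGroup F) (hv : v ∈ inertia F) : w⁻¹ * v * w ∈ inertia F := by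
  rw [inertia, MonoidHom.mem_ker] at hv ⊢
  rw [map_mul, map_mul, hv, mul_one, ← map_mul, inv_mul_cancel, map_one]

lemma weilNorm_one : weilNorm (1 : WeilGroup F) = 1 := by simp [weilNorm]

end WeilGroup

/-! ## Complex linear algebraic groups -/

section AlgebraicGroups

variable {n : ℕ}

/-- Zariski closed subsets of `GL_n(ℂ)`. -/
def IsZariskiClosed (Z : Set (GL (Fin n) ℂ)) : Prop :=
  ∃ S : Set (MvPolynomial (Fin n × Fin n) ℂ),
    Z = {g : GL (Fin n) ℂ |
      ∀ f ∈ S, MvPolynomial.eval (fun p => (g : Matrix (Fin n) (Fin n) ℂ) p.1 p.2) f = 0}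

/-- Connectedness of a subset of `GL_n(ℂ)` for the Zariski topology. -/
def IsZariskiConnected (Z : Set (GL (Fin n) ℂ)) : Prop :=
  Z.Nonempty ∧ ∀ A B : Set (GL (Fin n) ℂ), IsZariskiClosed A → IsZariskiClosed B →
    Z ⊆ A ∪ B → Z ∩ A ∩ B = ∅ → Z ⊆ A ∨ Z ⊆ B

/-- `G` is a connected reductive linear algebraic group: a Zariski closed connected subgroup of
`GL_n(ℂ)` whose unipotent radical is trivial. -/
structure IsConnectedReductive (G : Subgroup (GL (Fin n) ℂ)) : Prop where
  closed : IsZariskiClosed (G : Set (GL (Fin n) ℂ))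
  connected : IsZariskiConnected (G : Set (GL (Fin n) ℂ))
  unipotentRadical_trivial : ∀ U : Subgroup (GL (Fin n) ℂ), U ≤ G →
    IsZariskiClosed (U : Set (GL (Fin n) ℂ)) → IsZariskiConnected (U : Set (GL (Fin n) ℂ)) →
    (∀ g ∈ G, ∀ u ∈ U, g * u * g⁻¹ ∈ U) →
    (∀ u ∈ U, IsNilpotent ((u : Matrix (Fin n) (Fin n) ℂ) - 1)) → U = ⊥

/-- The function `g ↦ g_{ij}` on `G ⊆ GL_n(ℂ)`. -/
def entry (G : Subgroup (GL (Fin n) ℂ)) (i j : Fin n) : G → ℂ :=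
  fun g => ((g : GL (Fin n) ℂ) : Matrix (Fin n) (Fin n) ℂ) i j

/-- The function `g ↦ (g⁻¹)_{ij}` on `G ⊆ GL_n(ℂ)`. -/
def invEntry (G : Subgroup (GL (Fin n) ℂ)) (i j : Fin n) : G → ℂ :=
  fun g => entry G i j g⁻¹

/-- The coordinate ring of `G ⊆ GL_n(ℂ)`: the functions on `G` which are polynomials in the entries
of `g` and of `g⁻¹`. -/
def coordRing (G : Subgroup (GL (Fin n) ℂ)) : Subalgebra ℂ (G → ℂ) :=
  Algebra.adjoin ℂ (Set.range (fun p : Fin n × Fin n => entry G p.1 p.2) ∪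
    Set.range (fun p : Fin n × Fin n => invEntry G p.1 p.2))

/-- The coordinate ring of `SL_2`: the functions which are polynomials in the entries. -/
def sl2CoordRing : Subalgebra ℂ (Matrix.SpecialLinearGroup (Fin 2) ℂ → ℂ) :=
  Algebra.adjoin ℂ
    (Set.range (fun (p : Fin 2 × Fin 2) (g : Matrix.SpecialLinearGroup (Fin 2) ℂ) => g p.1 p.2))

variable {G : Subgroup (GL (Fin n) ℂ)}

lemma entry_mem (i j : Fin n) : entry G i j ∈ coordRing G :=
  Algebra.subset_adjoin (Or.inl ⟨(i, j), rfl⟩)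

lemma invEntry_mem (i j : Fin n) : invEntry G i j ∈ coordRing G :=
  Algebra.subset_adjoin (Or.inr ⟨(i, j), rfl⟩)

lemma entry_mul (i j : Fin n) (x y : G) :
    entry G i j (x * y) = ∑ k, entry G i k x * entry G k j y := by
  simp [entry, Matrix.mul_apply]

lemma invEntry_mul (i j : Fin n) (x y : G) :
    invEntry G i j (x * y) = ∑ k, invEntry G k j x * invEntry G i k y := by
  rw [invEntry, mul_inv_rev, entry_mul]
  exact Finset.sum_congr rfl fun k _ => mul_comm _ _

/-- Composition with `u`, as a homomorphism of algebras of functions. -/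
def compHom {α β : Type*} (u : β → α) : (α → ℂ) →ₐ[ℂ] (β → ℂ) where
  toFun f x := f (u x)
  map_one' := rfl
  map_mul' _ _ := rfl
  map_zero' := rfl
  map_add' _ _ := rfl
  commutes' _ := rfl

lemma compHom_apply {α β : Type*} (u : β → α) (f : α → ℂ) (x : β) : compHom u f x = f (u x) := rfl

lemma comp_conj_mem (g : G) {f : G → ℂ} (hf : f ∈ coordRing G) :
    (fun x => f (g * x * g⁻¹)) ∈ coordRing G := by
  suffices h : coordRing G ≤ (coordRing G).comap (compHom fun x => g * x * g⁻¹) from h hf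
  refine Algebra.adjoin_le ?_
  rintro _ (⟨⟨i, j⟩, rfl⟩ | ⟨⟨i, j⟩, rfl⟩)
  · have : compHom (fun x => g * x * g⁻¹) (entry G i j) =
        ∑ l, ∑ k, (entry G i k g * entry G l j g⁻¹) • entry G k l := by
      funext x
      simp only [compHom_apply, entry_mul, Finset.sum_apply, Pi.smul_apply, smul_eq_mul,
        Finset.sum_mul]
      exact Finset.sum_congr rfl fun l _ => Finset.sum_congr rfl fun k _ => by ring
    change compHom _ (entry G i j) ∈ coordRing G
    rw [this]
    exact sum_mem fun l _ => sum_mem fun k _ => Subalgebra.smul_mem _ (entry_mem k l) _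
  · have : compHom (fun x => g * x * g⁻¹) (invEntry G i j) =
        ∑ l, ∑ k, (invEntry G k j g * invEntry G i l g⁻¹) • invEntry G l k := by
      funext x
      simp only [compHom_apply, invEntry_mul, Finset.sum_apply, Pi.smul_apply, smul_eq_mul,
        Finset.sum_mul]
      exact Finset.sum_congr rfl fun l _ => Finset.sum_congr rfl fun k _ => by ring
    change compHom _ (invEntry G i j) ∈ coordRing G
    rw [this]
    exact sum_mem fun l _ => sum_mem fun k _ => Subalgebra.smul_mem _ (invEntry_mem l k) _

variable (G) in
/-- The group of automorphisms of the algebraic group `G`: the group automorphisms which, together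
with their inverses, pull regular functions back to regular functions. -/
def algAut : Subgroup (MulAut G) where
  carrier := {σ | ∀ f ∈ coordRing G, (fun x => f (σ x)) ∈ coordRing G ∧
    (fun x => f (σ⁻¹ x)) ∈ coordRing G}
  one_mem' := fun f hf => ⟨hf, hf⟩
  mul_mem' := fun {σ τ} hσ hτ f hf =>
    ⟨(hτ _ (hσ f hf).1).1, by
      simp only [mul_inv_rev]
      exact (hσ _ (hτ f hf).2).2⟩
  inv_mem' := fun {σ} hσ f hf => ⟨(hσ f hf).2, by simpa using (hσ f hf).1⟩

lemma conj_mem_algAut (g : G) : MulAut.conj g ∈ algAut G := fun f hf =>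
  ⟨comp_conj_mem g hf, by
    have := comp_conj_mem g⁻¹ hf
    rw [← map_inv]
    exact this⟩

/-- Pull-back of regular functions along an automorphism of `G`. -/
def pullback (σ : algAut G) : coordRing G →ₗ[ℂ] coordRing G where
  toFun f := ⟨fun x => f.1 (σ.1 x), (σ.2 f.1 f.2).1⟩
  map_add' _ _ := rfl
  map_smul' _ _ := rfl

variable (G) in
/-- The point derivations at `1` of the coordinate ring of `G`, as a space of linear functionals on
the coordinate ring. -/
def pointDerivations : Submodule ℂ (Module.Dual ℂ (coordRing G)) where
  carrier := {D | ∀ f g : coordRing G, D (f * g) = f.1 1 * D g + g.1 1 * D f}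
  zero_mem' := by simp
  add_mem' := fun {D E} hD hE f g => by
    simp only [LinearMap.add_apply, hD f g, hE f g]; ring
  smul_mem' := fun c D hD f g => by
    simp only [LinearMap.smul_apply, hD f g, smul_eq_mul]; ring

variable (G) in
/-- The Lie algebra of `G`, i.e. the tangent space at the identity: the point derivations at `1` of
the coordinate ring. -/
def LieAlg : Type := pointDerivations G

instance : AddCommGroup (LieAlg G) := inferInstanceAs (AddCommGroup (pointDerivations G))

instance : Module ℂ (LieAlg G) := inferInstanceAs (Module ℂ (pointDerivations G))

/-- A point derivation as an element of the Lie algebra. -/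
def LieAlg.mk (D : Module.Dual ℂ (coordRing G)) (hD : D ∈ pointDerivations G) : LieAlg G := ⟨D, hD⟩

lemma LieAlg.ext {D E : LieAlg G} (h : ∀ f, D.1 f = E.1 f) : D = E :=
  Subtype.ext (LinearMap.ext h)

variable (G) in
/-- The differential at the identity, as a representation of the group of automorphisms of `G` on
the Lie algebra of `G`: `(dσ)(D) (f) = D (f ∘ σ)`. -/
def differential : Representation ℂ (algAut G) (LieAlg G) where
  toFun σ :=
    { toFun := fun D => LieAlg.mk (D.1 ∘ₗ pullback σ) fun f g => by
        have h := D.2 (pullback σ f) (pullback σ g)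
        have e : pullback σ (f * g) = pullback σ f * pullback σ g := rfl
        have e1 : ∀ f : coordRing G, (pullback σ f).1 1 = f.1 1 := fun f =>
          congrArg f.1 (map_one σ.1)
        simpa only [LinearMap.comp_apply, e, e1] using h
      map_add' := fun _ _ => rfl
      map_smul' := fun _ _ => rfl }
  map_one' := rfl
  map_mul' _ _ := rfl

/-! ### The Lie bracket -/

variable (G) in
/-- The algebra map sending `a ⊗ b` to the function `(x, y) ↦ a x * b y`. -/
def tensorToFun : TensorProduct ℂ (coordRing G) (coordRing G) →ₐ[ℂ] (G × G → ℂ) :=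
  Algebra.TensorProduct.productMap ((compHom Prod.fst).comp (coordRing G).val)
    ((compHom Prod.snd).comp (coordRing G).val)

lemma tensorToFun_tmul (a b : coordRing G) (p : G × G) :
    tensorToFun G (a ⊗ₜ[ℂ] b) p = a.1 p.1 * b.1 p.2 := rfl

/-- Multiplication `G × G → G` is a morphism of varieties. -/
lemma exists_comul (f : coordRing G) :
    ∃ t, ∀ x y, tensorToFun G t (x, y) = f.1 (x * y) := by
  suffices h : coordRing G ≤ (tensorToFun G).range.comap (compHom fun p => p.1 * p.2) by
    obtain ⟨t, ht⟩ := h f.2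
    exact ⟨t, fun x y => congrFun ht (x, y)⟩
  refine Algebra.adjoin_le ?_
  rintro _ (⟨⟨i, j⟩, rfl⟩ | ⟨⟨i, j⟩, rfl⟩)
  · refine ⟨∑ k, (⟨_, entry_mem i k⟩ : coordRing G) ⊗ₜ[ℂ] (⟨_, entry_mem k j⟩ : coordRing G), ?_⟩
    change tensorToFun G _ = compHom _ (entry G i j)
    funext z
    rw [map_sum, Finset.sum_apply, compHom_apply, entry_mul]
    rfl
  · refine ⟨∑ k, (⟨_, invEntry_mem k j⟩ : coordRing G) ⊗ₜ[ℂ]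
      (⟨_, invEntry_mem i k⟩ : coordRing G), ?_⟩
    change tensorToFun G _ = compHom _ (invEntry G i j)
    funext z
    rw [map_sum, Finset.sum_apply, compHom_apply, invEntry_mul]
    rfl

/-- The left translate `y ↦ f (x * y)` of a regular function. -/
def translate (f : coordRing G) (x : G) : coordRing G :=
  ⟨fun y => f.1 (x * y), by
    obtain ⟨t, ht⟩ := exists_comul f
    have : ∀ t, (fun y => tensorToFun G t (x, y)) ∈ coordRing G := fun t => by
      induction t using TensorProduct.induction_on with
      | zero => exact zero_mem _
      | tmul a b => exact Subalgebra.smul_mem _ b.2 (a.1 x)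
      | add s t hs ht =>
        rw [map_add]
        exact add_mem hs ht
    simpa only [ht] using this t⟩

/-- For a functional `E` on the coordinate ring, the regular function `x ↦ E (y ↦ f (x * y))`. -/
def contract (E : Module.Dual ℂ (coordRing G)) : coordRing G →ₗ[ℂ] coordRing G where
  toFun f := ⟨fun x => E (translate f x), by
    obtain ⟨t, ht⟩ := exists_comul f
    suffices h : ∃ g : coordRing G, ∀ x, ∀ c : coordRing G,
        (∀ y, c.1 y = tensorToFun G t (x, y)) → g.1 x = E c by
      obtain ⟨g, hg⟩ := h
      have : (fun x => E (translate f x)) = g.1 :=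
        funext fun x => (hg x (translate f x) fun y => (ht x y).symm).symm
      rw [this]
      exact g.2
    clear ht
    induction t using TensorProduct.induction_on with
    | zero =>
      refine ⟨0, fun x c hc => ?_⟩
      have : c = 0 := Subtype.ext (funext fun y => by simpa using hc y)
      simp [this]
    | tmul a b =>
      refine ⟨E b • a, fun x c hc => ?_⟩
      have : c = a.1 x • b := Subtype.ext (funext fun y => by
        rw [hc y]; rfl)
      rw [this, map_smul]
      exact mul_comm _ _
    | add s t hs ht =>
      obtain ⟨g, hg⟩ := hs
      obtain ⟨h, hh⟩ := ht
      have key : ∀ t, ∀ x, (fun y => tensorToFun G t (x, y)) ∈ coordRing G := fun t x => by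
        induction t using TensorProduct.induction_on with
        | zero => exact zero_mem _
        | tmul a b => exact Subalgebra.smul_mem _ b.2 (a.1 x)
        | add s t hs ht =>
          rw [map_add]
          exact add_mem hs ht
      refine ⟨g + h, fun x c hc => ?_⟩
      have : c = ⟨_, key s x⟩ + ⟨_, key t x⟩ := Subtype.ext (funext fun y => by
        rw [hc y, map_add]; rfl)
      rw [this, map_add, ← hg x _ fun y => rfl, ← hh x _ fun y => rfl]
      rfl⟩
  map_add' f g := Subtype.ext (funext fun x => E.map_add (translate f x) (translate g x))
  map_smul' c f := Subtype.ext (funext fun x => E.map_smul c (translate f x))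

/-- The convolution product of two functionals: `(D * E)(f) = D (x ↦ E (y ↦ f (x * y)))`. -/
def conv (D E : Module.Dual ℂ (coordRing G)) : Module.Dual ℂ (coordRing G) := D ∘ₗ contract E

lemma contract_mul (E : LieAlg G) (f g : coordRing G) :
    contract E.1 (f * g) = f * contract E.1 g + g * contract E.1 f := by
  refine Subtype.ext (funext fun x => ?_)
  have h := E.2 (translate f x) (translate g x)
  have e : ∀ f : coordRing G, (translate f x).1 1 = f.1 x := fun f => congrArg f.1 (mul_one x)
  rw [e, e] at h
  exact h

lemma contract_one (E : Module.Dual ℂ (coordRing G)) (f : coordRing G) :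
    (contract E f).1 1 = E f :=
  congrArg E (Subtype.ext (funext fun y => congrArg f.1 (one_mul y)))

lemma conv_mul (D E : LieAlg G) (f g : coordRing G) :
    conv D.1 E.1 (f * g) = f.1 1 * conv D.1 E.1 g + g.1 1 * conv D.1 E.1 f +
      (D.1 f * E.1 g + D.1 g * E.1 f) := by
  simp only [conv, LinearMap.comp_apply, contract_mul, map_add, D.2 f, D.2 g, contract_one]
  ring

/-- The Lie bracket `[D, E] = D * E - E * D` of `Lie(G)`, as a linear map in `E`;
that is, `adjoint D = ad D`. -/
def adjoint (D : LieAlg G) : LieAlg G →ₗ[ℂ] LieAlg G where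
  toFun E := LieAlg.mk (conv D.1 E.1 - conv E.1 D.1) fun f g => by
    simp only [LinearMap.sub_apply, conv_mul]
    ring
  map_add' E E' := by
    refine LieAlg.ext fun f => ?_
    change D.1 (contract E.1 f + contract E'.1 f) -
      (E.1 (contract D.1 f) + E'.1 (contract D.1 f)) =
      (D.1 (contract E.1 f) - E.1 (contract D.1 f)) +
        (D.1 (contract E'.1 f) - E'.1 (contract D.1 f))
    rw [map_add]
    ring
  map_smul' c E := by
    refine LieAlg.ext fun f => ?_
    change D.1 (c • contract E.1 f) - c * E.1 (contract D.1 f) =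
      c * (D.1 (contract E.1 f) - E.1 (contract D.1 f))
    rw [map_smul, smul_eq_mul]
    ring

lemma adjoint_smul (c : ℂ) (D E : LieAlg G) : adjoint (c • D) E = c • adjoint D E := by
  refine LieAlg.ext fun f => ?_
  change c * D.1 (contract E.1 f) - E.1 (c • contract D.1 f) =
    c * (D.1 (contract E.1 f) - E.1 (contract D.1 f))
  rw [map_smul, smul_eq_mul]
  ring

/-- Automorphisms of `G` act on the Lie algebra by automorphisms of Lie algebras. -/
lemma differential_adjoint (σ : algAut G) (D E : LieAlg G) :
    differential G σ (adjoint D E) = adjoint (differential G σ D) (differential G σ E) := by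
  have key : ∀ (E : LieAlg G) (f : coordRing G),
      contract E.1 (pullback σ f) = pullback σ (contract (differential G σ E).1 f) :=
    fun E f => Subtype.ext (funext fun x => congrArg E.1 (Subtype.ext (funext fun y =>
      congrArg f.1 (map_mul σ.1 x y))))
  refine LieAlg.ext fun f => ?_
  change D.1 (contract E.1 (pullback σ f)) - E.1 (contract D.1 (pullback σ f)) = _
  rw [key, key]
  rfl

/-- A morphism of algebraic groups from `SL_2` to `G`. -/
def IsAlgebraicHom (ψ : Matrix.SpecialLinearGroup (Fin 2) ℂ →* G) : Prop :=
  ∀ f ∈ coordRing G, (fun x => f (ψ x)) ∈ sl2CoordRing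

/-- The upper triangular unipotent matrix `(1, t; 0, 1) = exp (t • (0, 1; 0, 0))`. -/
def upper (t : ℂ) : Matrix.SpecialLinearGroup (Fin 2) ℂ :=
  ⟨!![1, t; 0, 1], by simp [Matrix.det_fin_two]⟩

lemma differentiable_upper {f : Matrix.SpecialLinearGroup (Fin 2) ℂ → ℂ} (hf : f ∈ sl2CoordRing) :
    Differentiable ℂ fun t => f (upper t) := by
  induction hf using Algebra.adjoin_induction with
  | mem f hf =>
    obtain ⟨⟨i, j⟩, rfl⟩ := hf
    fin_cases i <;> fin_cases j <;> simp [upper]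
  | algebraMap r => exact differentiable_const r
  | add f g _ _ hf hg => exact hf.add hg
  | mul f g _ _ hf hg => exact hf.mul hg

/-- The nilpotent element `dψ (0, 1; 0, 0)` of `Lie(G)` attached to a morphism `ψ : SL_2 → G`: the
tangent vector at `t = 0` of the curve `t ↦ ψ (1, t; 0, 1)`. -/
def nilpotentOf (ψ : Matrix.SpecialLinearGroup (Fin 2) ℂ →* G) (hψ : IsAlgebraicHom ψ) :
    LieAlg G :=
  LieAlg.mk
   { toFun := fun f => deriv (fun t : ℂ => f.1 (ψ (upper t))) 0
     map_add' := fun f g => deriv_add (differentiable_upper (hψ f.1 f.2) 0)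
        (differentiable_upper (hψ g.1 g.2) 0)
     map_smul' := fun c f => deriv_const_mul c (differentiable_upper (hψ f.1 f.2) 0) }
   fun f g => by
    have h0 : ψ (upper 0) = 1 := by
      rw [← map_one ψ]
      congr 1
      ext i j
      fin_cases i <;> fin_cases j <;> simp [upper]
    have h := deriv_mul (differentiable_upper (hψ f.1 f.2) 0) (differentiable_upper (hψ g.1 g.2) 0)
    rw [h0] at h
    refine Eq.trans h ?_
    rw [add_comm, mul_comm (deriv _ _)]
    rfl

/-- A semisimple (i.e. diagonalizable) element of `GL_n(ℂ)`. -/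
def IsSemisimpleElt (g : GL (Fin n) ℂ) : Prop :=
  Module.End.IsSemisimple (Matrix.toLin' (g : Matrix (Fin n) (Fin n) ℂ))

end AlgebraicGroups

/-! ## Zariski open subsets of a finite-dimensional complex vector space -/

/-- `U` is Zariski open in the finite-dimensional complex vector space `V`: it is the complement of
the set of common zeros of a set of polynomial functions, i.e. of functions in the
algebra generated by the linear forms. -/
def IsZariskiOpen {V : Type*} [AddCommGroup V] [Module ℂ V] (U : Set V) : Prop :=
  ∃ S : Set (V → ℂ),
    S ⊆ (Algebra.adjoin ℂ (Set.range fun (l : Module.Dual ℂ V) (v : V) => l v) : Set (V → ℂ)) ∧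
    U = {v | ∃ f ∈ S, f v ≠ 0}

/-! ## L-groups and Langlands parameters -/

section Parameters

variable (F : Type*) [Field F] [ValuativeRel F] [TopologicalSpace F]
  [IsNonarchimedeanLocalField F]

/-- The data from which an L-group over `F` is formed: a complex connected reductive algebraic group
`dual`, realised as a closed subgroup of some `GL_n(ℂ)`, and an action of the absolute Galois
group of `F` on it by automorphisms of algebraic groups, which is trivial on an open
subgroup. -/
structure LGroupData where
  n : ℕ
  dual : Subgroup (GL (Fin n) ℂ)
  reductive : IsConnectedReductive dual
  act : GalF F →* MulAut dual
  act_algebraic : ∀ γ, act γ ∈ algAut dual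
  act_open : IsOpen (act.ker : Set (GalF F))

variable {F}

/-- The L-group, in its Weil form `dual ⋊ W_F`. -/
abbrev LGroup (D : LGroupData F) := D.dual ⋊[D.act.comp (weilIncl F)] WeilGroup F

/-- The L-group has the product topology. -/
instance (D : LGroupData F) : TopologicalSpace (LGroup D) :=
  TopologicalSpace.induced (fun l : LGroup D => (l.left, l.right)) inferInstance

/-- An element `l` of the L-group is semisimple: for some `m ≥ 1` such that the Weil
component of `l ^ m` acts trivially on the dual group, the component of `l ^ m` in the dual group
is semisimple. (Equivalently, the image of `l` in the complex algebraic group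
`dual ⋊ Gal(E/F)` is semisimple, `E/F` being any finite Galois extension such that the
action factors through `Gal(E/F)`.) -/
def IsSemisimpleL {D : LGroupData F} (l : LGroup D) : Prop :=
  ∃ m : ℕ, 0 < m ∧ D.act (weilIncl F (l ^ m).right) = 1 ∧ IsSemisimpleElt (l ^ m).left.1

/-- The action of the L-group on the dual group by conjugation, `(g, w) ↦ Int(g) ∘ w`. -/
def conjAction (D : LGroupData F) : LGroup D →* algAut D.dual :=
  (SemidirectProduct.lift MulAut.conj (D.act.comp (weilIncl F)) (fun w => by
    ext x : 2
    simp)).codRestrict (algAut D.dual) fun l =>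
      mul_mem (conj_mem_algAut l.left) (D.act_algebraic _)

/-- The adjoint representation of the L-group on the Lie algebra of the dual group. -/
def Ad (D : LGroupData F) : Representation ℂ (LGroup D) (LieAlg D.dual) :=
  (differential D.dual).comp (conjAction D)

/-- A Langlands parameter: a continuous homomorphism from `W_F × SL_2(ℂ)` to the L-group,
compatible with the projections to `W_F`, algebraic on `SL_2(ℂ)`, and which sends Frobenius elements
to semisimple elements. -/
structure LParameter (D : LGroupData F) where
  toHom : WeilGroup F × Matrix.SpecialLinearGroup (Fin 2) ℂ →* LGroup D
  continuous_toHom : Continuous toHom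
  right_toHom : ∀ p, (toHom p).right = p.1
  /-- the restriction to `SL_2(ℂ)`, with values in the dual group -/
  sl2 : Matrix.SpecialLinearGroup (Fin 2) ℂ →* D.dual
  inl_sl2 : ∀ x, SemidirectProduct.inl (sl2 x) = toHom (1, x)
  algebraic_sl2 : IsAlgebraicHom sl2
  semisimple_frob : ∀ w, IsGeometricFrobenius w → IsSemisimpleL (toHom (w, 1))

/-- The diagonal matrix `diag(a, a⁻¹)`. -/
def diagSL (a : ℂ) (ha : a ≠ 0) : Matrix.SpecialLinearGroup (Fin 2) ℂ :=
  ⟨!![a, 0; 0, a⁻¹], by simp [Matrix.det_fin_two, ha]⟩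

lemma diagSL_mul (a b : ℂ) (ha : a ≠ 0) (hb : b ≠ 0) :
    diagSL (a * b) (mul_ne_zero ha hb) = diagSL a ha * diagSL b hb := by
  refine Subtype.ext ?_
  change (!![a * b, 0; 0, (a * b)⁻¹] : Matrix (Fin 2) (Fin 2) ℂ) =
    !![a, 0; 0, a⁻¹] * !![b, 0; 0, b⁻¹]
  simp [mul_comm]

lemma diagSL_mul_upper (a t : ℂ) (ha : a ≠ 0) :
    diagSL a ha * upper t = upper (a * a * t) * diagSL a ha := by
  refine Subtype.ext ?_
  change (!![a, 0; 0, a⁻¹] : Matrix (Fin 2) (Fin 2) ℂ) * !![1, t; 0, 1] =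
    !![1, a * a * t; 0, 1] * !![a, 0; 0, a⁻¹]
  have h : a * a * t * a⁻¹ = a * t := by field_simp
  simp [h]

/-- The complex number `|w| ^ (1/2)`. -/
def sqrtNorm (w : WeilGroup F) : ℂ := ((Real.sqrt (weilNorm w) : ℝ) : ℂ)

lemma sqrtNorm_ne_zero (w : WeilGroup F) : sqrtNorm w ≠ 0 :=
  Complex.ofReal_ne_zero.2 (Real.sqrt_pos.2 (weilNorm_pos w)).ne'

lemma sqrtNorm_mul_self (w : WeilGroup F) : sqrtNorm w * sqrtNorm w = (weilNorm w : ℂ) := by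
  rw [sqrtNorm, ← Complex.ofReal_mul, Real.mul_self_sqrt (weilNorm_pos w).le]

lemma sqrtNorm_mul (v w : WeilGroup F) : sqrtNorm (v * w) = sqrtNorm v * sqrtNorm w := by
  rw [sqrtNorm, weilNorm_mul, Real.sqrt_mul (weilNorm_pos v).le, Complex.ofReal_mul]
  rfl

/-- `w ↦ diag(|w| ^ (1/2), |w| ^ (-1/2))`. -/
def diagNorm : WeilGroup F →* Matrix.SpecialLinearGroup (Fin 2) ℂ :=
  MonoidHom.mk' (fun w => diagSL (sqrtNorm w) (sqrtNorm_ne_zero w)) fun v w => by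
    rw [← diagSL_mul]
    congr 1
    exact sqrtNorm_mul v w

variable {D : LGroupData F}

lemma Ad_mul (l m : LGroup D) (x : LieAlg D.dual) : Ad D (l * m) x = Ad D l (Ad D m x) := by
  rw [map_mul]
  rfl

/-- The Vogan variety `V_λ = {x | Ad(λ(w)) x = |w| x for all w}`. -/
def voganVariety (lam : WeilGroup F →* LGroup D) : Submodule ℂ (LieAlg D.dual) where
  carrier := {x | ∀ w, Ad D (lam w) x = (weilNorm w : ℂ) • x}
  zero_mem' := by simp
  add_mem' := fun {x y} hx hy w => by rw [map_add, hx w, hy w, smul_add]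
  smul_mem' := fun c x hx w => by rw [map_smul, hx w, smul_comm]

/-- The centralizer `H_λ` of `λ` in the dual group. -/
def centralizer (lam : WeilGroup F →* LGroup D) : Subgroup D.dual where
  carrier := {g | ∀ w, (SemidirectProduct.inl g : LGroup D) * lam w *
    (SemidirectProduct.inl g)⁻¹ = lam w}
  one_mem' := by simp
  mul_mem' := fun {g h} hg hh w => by
    rw [map_mul, mul_inv_rev]
    calc _ = (SemidirectProduct.inl g : LGroup D) * (SemidirectProduct.inl h * lam w *
          (SemidirectProduct.inl h)⁻¹) * (SemidirectProduct.inl g)⁻¹ := by group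
      _ = _ := by rw [hh w, hg w]
  inv_mem' := fun {g} hg w => by
    conv_lhs => rw [← hg w]
    rw [map_inv]
    group

namespace LParameter

variable (φ : LParameter D)

/-- The infinitesimal parameter `λ_φ(w) = φ(w, diag(|w| ^ (1/2), |w| ^ (-1/2)))`. -/
def infinitesimal : WeilGroup F →* LGroup D :=
  φ.toHom.comp ((MonoidHom.id _).prod diagNorm)

/-- The nilpotent element `x_φ = N = dφ (0, 1; 0, 0)`. -/
def nilp : LieAlg D.dual := nilpotentOf φ.sl2 φ.algebraic_sl2

lemma ad_infinitesimal_nilp (w : WeilGroup F) :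
    Ad D (φ.infinitesimal w) φ.nilp = (weilNorm w : ℂ) • φ.nilp := by
  have hconj : ∀ t : ℂ, diagNorm w * upper t = upper ((weilNorm w : ℂ) * t) * diagNorm w := by
    intro t
    rw [← sqrtNorm_mul_self]
    exact diagSL_mul_upper _ t (sqrtNorm_ne_zero w)
  have hact : ∀ t : ℂ, (conjAction D (φ.infinitesimal w)).1 (φ.sl2 (upper t)) =
      φ.sl2 (upper ((weilNorm w : ℂ) * t)) := by
    intro t
    apply SemidirectProduct.inl_injective (φ := D.act.comp (weilIncl F))
    have e : ∀ (l : LGroup D) (g : D.dual),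
        (SemidirectProduct.inl ((conjAction D l).1 g) : LGroup D) =
          l * SemidirectProduct.inl g * l⁻¹ := by
      intro l g
      have h1 : (conjAction D l).1 g = l.left * D.act (weilIncl F l.right) g * l.left⁻¹ := rfl
      rw [h1]
      ext1
      · simp [SemidirectProduct.mul_left, SemidirectProduct.inv_left]
      · simp
    rw [e, φ.inl_sl2, φ.inl_sl2, infinitesimal, MonoidHom.comp_apply, ← map_mul, ← map_inv,
      ← map_mul]
    congr 1
    ext1
    · simp
    · simp [hconj]
  refine LieAlg.ext fun f => ?_
  change deriv (fun t : ℂ => f.1 ((conjAction D (φ.infinitesimal w)).1 (φ.sl2 (upper t)))) 0 =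
    (weilNorm w : ℂ) * deriv (fun t : ℂ => f.1 (φ.sl2 (upper t))) 0
  simp only [hact]
  have := deriv_comp_mul_left (weilNorm w : ℂ) (fun t : ℂ => f.1 (φ.sl2 (upper t))) 0
  simpa using this

/-- The point `x_φ` of the Vogan variety of the infinitesimal parameter of `φ`. -/
def point : voganVariety φ.infinitesimal := ⟨φ.nilp, φ.ad_infinitesimal_nilp⟩

/-- The orbit `C_φ` of `x_φ` in the Vogan variety under the group `H_λ`. -/
def orbit : Set (voganVariety φ.infinitesimal) :=
  {x | ∃ h ∈ centralizer φ.infinitesimal,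
    x.1 = Ad D (SemidirectProduct.inl h) φ.point.1}

/-- `φ` is open: the orbit of `x_φ` is (Zariski) open in the Vogan variety. -/
def IsOpenParameter : Prop := IsZariskiOpen φ.orbit

/-- The subspace of the Lie algebra of the dual group on which `N` (acting by `ad N`) is zero and
the inertia group (acting through `Ad ∘ λ_φ`) is trivial. -/
def kerInvariants : Submodule ℂ (LieAlg D.dual) where
  carrier := {x | adjoint φ.nilp x = 0 ∧ ∀ w ∈ inertia F, Ad D (φ.infinitesimal w) x = x}
  zero_mem' := by simp
  add_mem' := fun {x y} hx hy =>
    ⟨by rw [map_add, hx.1, hy.1, add_zero], fun w hw => by rw [map_add, hx.2 w hw, hy.2 w hw]⟩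
  smul_mem' := fun c x hx =>
    ⟨by rw [map_smul, hx.1, smul_zero], fun w hw => by rw [map_smul, hx.2 w hw]⟩

lemma ad_mul (v w : WeilGroup F) (x : LieAlg D.dual) :
    Ad D (φ.infinitesimal (v * w)) x = Ad D (φ.infinitesimal v) (Ad D (φ.infinitesimal w) x) :=
  (congrArg (fun l => Ad D l x) (map_mul φ.infinitesimal v w)).trans (Ad_mul _ _ x)

lemma ad_mem_kerInvariants (w : WeilGroup F) (x : LieAlg D.dual) (hx : x ∈ φ.kerInvariants) :
    Ad D (φ.infinitesimal w) x ∈ φ.kerInvariants := by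
  refine ⟨?_, fun v hv => ?_⟩
  · have h : Ad D (φ.infinitesimal w) (adjoint φ.nilp x) =
        adjoint (Ad D (φ.infinitesimal w) φ.nilp) (Ad D (φ.infinitesimal w) x) :=
      differential_adjoint _ _ _
    rw [hx.1, map_zero, ad_infinitesimal_nilp, adjoint_smul] at h
    exact (smul_eq_zero_iff_right (Complex.ofReal_ne_zero.2 (weilNorm_pos w).ne')).1 h.symm
  · have h := hx.2 _ (inertia_conj_mem w v hv)
    have e : v * w = w * (w⁻¹ * v * w) := by rw [← mul_assoc, ← mul_assoc, mul_inv_cancel, one_mul]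
    exact (φ.ad_mul v w x).symm.trans ((congrArg (fun u => Ad D (φ.infinitesimal u) x) e).trans
      ((φ.ad_mul w _ x).trans (congrArg (Ad D (φ.infinitesimal w)) h)))

/-- The operator `Ad(λ_φ(w))` on the subspace `kerInvariants`. -/
def frobOperator (w : WeilGroup F) : Module.End ℂ φ.kerInvariants :=
  (Ad D (φ.infinitesimal w)).restrict (φ.ad_mem_kerInvariants w)

/-- The adjoint L-factor `L(s, φ, Ad) = det (1 - q ^ (-s) Ad(λ_φ(Fr)))⁻¹`, the determinant being
taken on the inertia invariants in the kernel of `N`; `Fr` is a geometric Frobenius element. (At the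
poles the inverse has the conventional value `0`; the function is not continuous there.) -/
def adjointLFactor (Fr : WeilGroup F) (s : ℂ) : ℂ :=
  (LinearMap.det ((1 : Module.End ℂ φ.kerInvariants) -
    ((residueCard F : ℂ) ^ (-s)) • φ.frobOperator Fr))⁻¹

end LParameter

end Parameters

end Langlands

end

/-! Let `𝔤_k` be the space on which the Weil group acts through `Ad ∘ λ` by `|w| ^ k`. Then `V_λ =
𝔤_1`, the group `H_λ` has Lie algebra `𝔤_0`, and `N ∈ 𝔤_1`. Since `|Fr|⁻¹ = q`, a singularity of the
L-factor at `s = 1` means that `Ad (λ (Fr))` has eigenvalue `q` on the inertia invariants killed by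
`ad N`, that is, `ad N : 𝔤_{-1} → 𝔤_0` is not injective (`analyticAt_adjointLFactor_iff`). Up to
sign, the orbit map of `N` has differential `ad N : 𝔤_0 → 𝔤_1` at the identity, so openness means
that this map is surjective (`isOpenParameter_iff`). The two conditions are dual to each other
(`adjoint_surjective_iff`).

Duality. Summing the trace form over the finite set of Galois automorphisms gives an invariant form
on `𝔤`. As in Cartan's criterion, Chevalley's replicas (`exists_replica`) show that its radical
consists of nilpotent matrices. If the radical were nonzero, it would have nonzero centre by Engel,
and the exponentials of the centre would generate a nontrivial connected normal unipotent subgroup;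
reductivity excludes this (`eq_zero_of_traceForm_eq_zero`). Inertia acts through a finite quotient
and Frobenius acts semisimply, so the form pairs `𝔤_{-k}` and `𝔤_k` perfectly
(`eq_zero_of_forall_weightSpace`), and `ad N` is skew for it.

Surjective implies open. Exponentials of `𝔤_0` lie in `H_λ`, so by the open mapping form of the
inverse function theorem the orbit of any `z` with `ad z` surjective contains a neighbourhood of `z`
on each line. The set of such `z` is Zariski open and meets the complex line through any two of its
points in a connected set, so it is a single orbit (`isZariskiOpen_orbit_weightSpace`).

Open implies surjective. If the orbit is open, the coordinates of the orbit map are algebraically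
independent on `H_λ`. In characteristic zero, generic smoothness
(`exists_point_of_algebraicIndependent`) provides a point of `H_λ` where their differentials are
independent, and translation brings the tangent vectors back to the identity, into `𝔤_0`
(`adjoint_surjective_of_isZariskiOpen`). -/

noncomputable section

namespace Langlands

/-! ## The Lie algebra as a Lie algebra of matrices -/

section LieMatrix

variable {n : ℕ} {G : Subgroup (GL (Fin n) ℂ)}

variable (G) in
/-- The matrix entry as an element of the coordinate ring. -/
def entryFun (i j : Fin n) : coordRing G := ⟨entry G i j, entry_mem i j⟩

variable (G) in
/-- The entry of the inverse as an element of the coordinate ring. -/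
def invEntryFun (i j : Fin n) : coordRing G := ⟨invEntry G i j, invEntry_mem i j⟩

lemma entryFun_one (i j : Fin n) :
    (entryFun G i j).1 1 = (1 : Matrix (Fin n) (Fin n) ℂ) i j := rfl

lemma invEntryFun_one (i j : Fin n) :
    (invEntryFun G i j).1 1 = (1 : Matrix (Fin n) (Fin n) ℂ) i j := by
  simp [invEntryFun, invEntry, entry]

lemma entry_mul_invEntry (i j : Fin n) :
    ∑ k, entryFun G i k * invEntryFun G k j =
      algebraMap ℂ (coordRing G) ((1 : Matrix (Fin n) (Fin n) ℂ) i j) := by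
  refine Subtype.ext (funext fun x => ?_)
  have h := entry_mul i j x x⁻¹
  rw [mul_inv_cancel] at h
  rw [AddSubmonoidClass.coe_finsetSum, Finset.sum_apply]
  exact h.symm

/-- Induction principle for regular functions. -/
lemma coordRing_induction {p : coordRing G → Prop} (he : ∀ i j, p (entryFun G i j))
    (hi : ∀ i j, p (invEntryFun G i j)) (hc : ∀ c, p (algebraMap ℂ _ c))
    (hadd : ∀ f g, p f → p g → p (f + g)) (hmul : ∀ f g, p f → p g → p (f * g)) (f : coordRing G) :
    p f := by
  obtain ⟨f, hf⟩ := f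
  induction hf using Algebra.adjoin_induction with
  | mem f hf =>
    rcases hf with ⟨⟨i, j⟩, rfl⟩ | ⟨⟨i, j⟩, rfl⟩
    · exact he i j
    · exact hi i j
  | algebraMap r => exact hc r
  | add f g hf hg h₁ h₂ => exact hadd ⟨f, hf⟩ ⟨g, hg⟩ h₁ h₂
  | mul f g hf hg h₁ h₂ => exact hmul ⟨f, hf⟩ ⟨g, hg⟩ h₁ h₂

lemma LieAlg.apply_mul (E : LieAlg G) (f g : coordRing G) :
    E.1 (f * g) = f.1 1 * E.1 g + g.1 1 * E.1 f := E.2 f g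

lemma LieAlg.apply_algebraMap (E : LieAlg G) (c : ℂ) : E.1 (algebraMap ℂ _ c) = 0 := by
  have h := E.2 1 1
  have h1 : ((1 : coordRing G)).1 1 = 1 := rfl
  rw [mul_one, h1] at h
  have h0 : E.1 1 = 0 := by linear_combination -h
  rw [Algebra.algebraMap_eq_smul_one, map_smul, h0, smul_zero]

variable (G) in
/-- The Lie algebra of `G` as a space of matrices: the values of a derivation on the entries. -/
def toMat : LieAlg G →ₗ[ℂ] Matrix (Fin n) (Fin n) ℂ where
  toFun E := Matrix.of fun i j => E.1 (entryFun G i j)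
  map_add' _ _ := rfl
  map_smul' _ _ := rfl

lemma toMat_apply (E : LieAlg G) (i j : Fin n) : toMat G E i j = E.1 (entryFun G i j) := rfl

/-- Differentiate `g * g⁻¹ = 1` at the identity. -/
lemma LieAlg.apply_invEntry (E : LieAlg G) (i j : Fin n) :
    E.1 (invEntryFun G i j) = -toMat G E i j := by
  have h := congrArg E.1 (entry_mul_invEntry (G := G) i j)
  rw [E.apply_algebraMap, map_sum] at h
  simp only [E.apply_mul, entryFun_one, invEntryFun_one, Finset.sum_add_distrib,
    Matrix.one_apply, ite_mul, one_mul, zero_mul, Finset.sum_ite_eq, Finset.sum_ite_eq',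
    Finset.mem_univ, if_true] at h
  rw [toMat_apply]
  linear_combination h

/-- A point derivation is determined by its values on generators of the coordinate ring, and those
on the entries of the inverse follow from those on the entries. Finite-dimensionality of the Lie
algebra is a consequence. -/
lemma toMat_injective : Function.Injective (toMat G) := by
  rw [← LinearMap.ker_eq_bot, LinearMap.ker_eq_bot']
  intro E hE
  refine LieAlg.ext fun f => ?_
  change E.1 f = 0
  induction f using coordRing_induction with
  | he i j => exact congrFun (congrFun hE i) j
  | hi i j => rw [E.apply_invEntry, hE]; simp
  | hc c => exact E.apply_algebraMap c
  | hadd f g hf hg => rw [map_add, hf, hg, add_zero]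
  | hmul f g hf hg => rw [E.apply_mul, hf, hg, mul_zero, mul_zero, add_zero]

instance : Module.Finite ℂ (LieAlg G) := Module.Finite.of_injective (toMat G) toMat_injective

lemma contract_apply (E : Module.Dual ℂ (coordRing G)) (f : coordRing G) (x : G) :
    (contract E f).1 x = E (translate f x) := rfl

lemma translate_entryFun (i j : Fin n) (x : G) :
    translate (entryFun G i j) x = ∑ k, entry G i k x • entryFun G k j := by
  refine Subtype.ext (funext fun y => ?_)
  rw [AddSubmonoidClass.coe_finsetSum, Finset.sum_apply]
  exact entry_mul i j x y

lemma translate_invEntryFun (i j : Fin n) (x : G) :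
    translate (invEntryFun G i j) x = ∑ k, invEntry G k j x • invEntryFun G i k := by
  refine Subtype.ext (funext fun y => ?_)
  rw [AddSubmonoidClass.coe_finsetSum, Finset.sum_apply]
  exact invEntry_mul i j x y

/-- In matrix terms, with `X = toMat G E`, the left invariant field of `E` is `g ↦ g * X`; on
inverses it reads `g⁻¹ ↦ -X * g⁻¹`. -/
lemma contract_entryFun (E : LieAlg G) (i j : Fin n) :
    contract E.1 (entryFun G i j) = ∑ k, toMat G E k j • entryFun G i k := by
  refine Subtype.ext (funext fun x => ?_)
  rw [contract_apply, translate_entryFun, map_sum, AddSubmonoidClass.coe_finsetSum,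
    Finset.sum_apply]
  refine Finset.sum_congr rfl fun k _ => ?_
  rw [map_smul]
  exact mul_comm _ _

lemma contract_invEntryFun (E : LieAlg G) (i j : Fin n) :
    contract E.1 (invEntryFun G i j) = ∑ k, (-toMat G E i k) • invEntryFun G k j := by
  refine Subtype.ext (funext fun x => ?_)
  rw [contract_apply, translate_invEntryFun, map_sum, AddSubmonoidClass.coe_finsetSum,
    Finset.sum_apply]
  refine Finset.sum_congr rfl fun k _ => ?_
  rw [map_smul, E.apply_invEntry]
  exact mul_comm _ _

/-- On the entries, convolution of functionals is the matrix product. -/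
lemma toMat_adjoint (D E : LieAlg G) :
    toMat G (adjoint D E) = toMat G D * toMat G E - toMat G E * toMat G D := by
  ext i j
  change D.1 (contract E.1 (entryFun G i j)) - E.1 (contract D.1 (entryFun G i j)) = _
  rw [contract_entryFun, contract_entryFun, map_sum, map_sum, Matrix.sub_apply,
    Matrix.mul_apply, Matrix.mul_apply]
  congr 1 <;> refine Finset.sum_congr rfl fun k _ => ?_ <;> rw [map_smul, smul_eq_mul, mul_comm] <;>
    rfl

lemma adjoint_comm (D E : LieAlg G) : adjoint D E = -adjoint E D := by
  apply toMat_injective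
  rw [map_neg, toMat_adjoint, toMat_adjoint, neg_sub]

lemma differential_apply (σ : algAut G) (E : LieAlg G) (f : coordRing G) :
    (differential G σ E).1 f = E.1 (pullback σ f) := rfl

/-- Conjugation by `g`, as an automorphism of the algebraic group `G`. -/
def conjAut (g : G) : algAut G := ⟨MulAut.conj g, conj_mem_algAut g⟩

lemma pullback_conj_entryFun (g : G) (i j : Fin n) :
    pullback (conjAut g) (entryFun G i j) =
      ∑ l, ∑ k, (entry G i k g * entry G l j g⁻¹) • entryFun G k l := by
  refine Subtype.ext (funext fun x => ?_)
  rw [AddSubmonoidClass.coe_finsetSum, Finset.sum_apply]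
  simp only [AddSubmonoidClass.coe_finsetSum, Finset.sum_apply]
  change entry G i j (g * x * g⁻¹) = _
  rw [entry_mul]
  refine Finset.sum_congr rfl fun l _ => ?_
  rw [entry_mul, Finset.sum_mul]
  refine Finset.sum_congr rfl fun k _ => ?_
  change _ = entry G i k g * entry G l j g⁻¹ * entry G k l x
  ring

lemma toMat_differential_conj (g : G) (E : LieAlg G) :
    toMat G (differential G (conjAut g) E) =
      (g.1 : Matrix (Fin n) (Fin n) ℂ) * toMat G E * ((g.1⁻¹ : GL (Fin n) ℂ) :
        Matrix (Fin n) (Fin n) ℂ) := by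
  ext i j
  rw [toMat_apply, differential_apply, pullback_conj_entryFun, map_sum, Matrix.mul_apply]
  refine Finset.sum_congr rfl fun l _ => ?_
  rw [map_sum, Matrix.mul_apply, Finset.sum_mul]
  refine Finset.sum_congr rfl fun k _ => ?_
  rw [map_smul, smul_eq_mul, ← toMat_apply]
  change entry G i k g * entry G l j g⁻¹ * _ = entry G i k g * _ * entry G l j g⁻¹
  ring

end LieMatrix

/-! ## The exponential map -/

section Exponential

open scoped Matrix.Norms.Operator

/-- If the functions `Φ f` satisfy `(Φ f)' = Φ (δ f)`, then `Φ f` is determined by the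
values at `0` of the functions `Φ (δ ^ k f)`. -/
lemma eq_of_iterate_eq_at_zero {α : Type*} (Φ : α → ℂ → ℂ) (δ : α → α)
    (h : ∀ f t, HasDerivAt (Φ f) (Φ (δ f) t) t) {f g : α}
    (hfg : ∀ k, Φ (δ^[k] f) 0 = Φ (δ^[k] g) 0) : Φ f = Φ g := by
  have hd : ∀ k f, iteratedDeriv k (Φ f) = Φ (δ^[k] f) := by
    intro k
    induction k with
    | zero => intro f; simp
    | succ k ih =>
      intro f
      have : deriv (Φ f) = Φ (δ f) := funext fun t => (h f t).deriv
      rw [iteratedDeriv_succ', this, ih, Function.iterate_succ_apply]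
  have hdiff : ∀ f, Differentiable ℂ (Φ f) := fun f t => (h f t).differentiableAt
  funext t
  -- Both functions are entire, hence equal to their Taylor series at `0`, and `hd` identifies the
  -- coefficients.
  rw [← Complex.taylorSeries_eq_of_entire' 0 t (hdiff f),
    ← Complex.taylorSeries_eq_of_entire' 0 t (hdiff g)]
  simp only [hd, hfg]

variable {n : ℕ}

/-- The exponential of a matrix, as an invertible matrix. -/
def expGL (X : Matrix (Fin n) (Fin n) ℂ) : GL (Fin n) ℂ where
  val := NormedSpace.exp X
  inv := NormedSpace.exp (-X)
  val_inv := by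
    rw [← Matrix.exp_add_of_commute _ _ (Commute.refl X).neg_right, add_neg_cancel,
      NormedSpace.exp_zero]
  inv_val := by
    rw [← Matrix.exp_add_of_commute _ _ (Commute.refl X).neg_left, neg_add_cancel,
      NormedSpace.exp_zero]

lemma coe_expGL (X : Matrix (Fin n) (Fin n) ℂ) :
    (expGL X : Matrix (Fin n) (Fin n) ℂ) = NormedSpace.exp X := rfl

lemma hasDerivAt_expGL_entry (X : Matrix (Fin n) (Fin n) ℂ) (i j : Fin n) (t : ℂ) :
    HasDerivAt (fun t : ℂ => (expGL (t • X) : Matrix (Fin n) (Fin n) ℂ) i j)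
      (∑ k, X k j * (expGL (t • X) : Matrix (Fin n) (Fin n) ℂ) i k) t := by
  have h := hasDerivAt_pi.1 (hasDerivAt_pi.1 (hasDerivAt_exp_smul_const X t) i) j
  simp only [Matrix.mul_apply] at h
  refine HasDerivAt.congr_deriv h (Finset.sum_congr rfl fun k _ => ?_)
  rw [mul_comm]
  rfl

/-- The derivation of the algebra of polynomial functions on matrices given by the left invariant
vector field with value `X` at `1`. -/
def polyDer (X : Matrix (Fin n) (Fin n) ℂ) : Derivation ℂ (MvPolynomial (Fin n × Fin n) ℂ)
    (MvPolynomial (Fin n × Fin n) ℂ) :=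
  MvPolynomial.mkDerivation ℂ fun p => ∑ k, X k p.2 • MvPolynomial.X (p.1, k)

/-- The value of a polynomial function at an invertible matrix. -/
def polyEval (g : GL (Fin n) ℂ) : MvPolynomial (Fin n × Fin n) ℂ →+* ℂ :=
  MvPolynomial.eval fun p => (g : Matrix (Fin n) (Fin n) ℂ) p.1 p.2

lemma hasDerivAt_polyEval_exp (X : Matrix (Fin n) (Fin n) ℂ)
    (f : MvPolynomial (Fin n × Fin n) ℂ) (t : ℂ) :
    HasDerivAt (fun t : ℂ => polyEval (expGL (t • X)) f)
      (polyEval (expGL (t • X)) (polyDer X f)) t := by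
  induction f using MvPolynomial.induction_on with
  | C a =>
    have : polyDer X (MvPolynomial.C a) = 0 := (polyDer X).map_algebraMap a
    rw [this, map_zero]
    simpa [polyEval] using hasDerivAt_const t a
  | add f g hf hg =>
    simp only [map_add]
    exact hf.add hg
  | mul_X f p hf =>
    have h := hf.mul (hasDerivAt_expGL_entry X p.1 p.2 t)
    have e1 : ∀ g : GL (Fin n) ℂ, polyEval g (f * MvPolynomial.X p) =
        polyEval g f * (g : Matrix (Fin n) (Fin n) ℂ) p.1 p.2 := fun g => by
      simp [polyEval]
    simp only [e1]
    refine h.congr_deriv ?_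
    rw [Derivation.leibniz, map_add, smul_eq_mul, smul_eq_mul, map_mul, map_mul, polyDer,
      MvPolynomial.mkDerivation_X, map_sum]
    have e2 : ∀ g : GL (Fin n) ℂ, ∀ k, polyEval g (X k p.2 • MvPolynomial.X (p.1, k)) =
        X k p.2 * (g : Matrix (Fin n) (Fin n) ℂ) p.1 k := fun g k => by
      simp [polyEval]
    have e3 : ∀ g : GL (Fin n) ℂ, polyEval g (MvPolynomial.X p) =
        (g : Matrix (Fin n) (Fin n) ℂ) p.1 p.2 := fun g => by
      simp [polyEval]
    simp only [e2, e3]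
    ring

variable {G : Subgroup (GL (Fin n) ℂ)}

variable (G) in
/-- Restriction of polynomial functions on matrices to `G`. -/
def polyRestrict : MvPolynomial (Fin n × Fin n) ℂ →ₐ[ℂ] coordRing G :=
  MvPolynomial.aeval fun p => entryFun G p.1 p.2

lemma polyRestrict_apply (f : MvPolynomial (Fin n × Fin n) ℂ) (g : G) :
    (polyRestrict G f).1 g = polyEval g.1 f := by
  induction f using MvPolynomial.induction_on with
  | C a => simp [polyRestrict, polyEval]
  | add f g hf hg => rw [map_add, map_add, ← hf, ← hg]; rfl
  | mul_X f p hf =>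
    rw [map_mul, map_mul, ← hf, polyRestrict, MvPolynomial.aeval_X, polyEval, MvPolynomial.eval_X]
    rfl

lemma contract_algebraMap (E : LieAlg G) (c : ℂ) :
    contract E.1 (algebraMap ℂ _ c) = 0 :=
  Subtype.ext (funext fun _ => E.apply_algebraMap c)

/-- Both sides obey the Leibniz rule and agree on the variables. The point is that `polyDer (toMat G
E)` preserves the ideal of polynomials vanishing on `G`. -/
lemma polyRestrict_polyDer (E : LieAlg G) (f : MvPolynomial (Fin n × Fin n) ℂ) :
    polyRestrict G (polyDer (toMat G E) f) = contract E.1 (polyRestrict G f) := by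
  induction f using MvPolynomial.induction_on with
  | C a =>
    have : polyDer (toMat G E) (MvPolynomial.C a) = 0 := (polyDer _).map_algebraMap a
    rw [this, map_zero, ← MvPolynomial.algebraMap_eq, AlgHom.commutes, contract_algebraMap]
  | add f g hf hg => simp only [map_add, hf, hg]
  | mul_X f p hf =>
    rw [Derivation.leibniz, map_add, smul_eq_mul, smul_eq_mul, map_mul, map_mul, map_mul,
      contract_mul, hf, polyDer, MvPolynomial.mkDerivation_X, map_sum]
    have : polyRestrict G (MvPolynomial.X p) = entryFun G p.1 p.2 := by simp [polyRestrict]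
    rw [this, contract_entryFun]
    congr 2
    refine Finset.sum_congr rfl fun k _ => ?_
    rw [map_smul, polyRestrict, MvPolynomial.aeval_X]

lemma mem_of_forall_polyEval_eq_zero (hG : IsZariskiClosed (G : Set (GL (Fin n) ℂ)))
    {g : GL (Fin n) ℂ} (hg : ∀ f, polyRestrict G f = 0 → polyEval g f = 0) : g ∈ G := by
  obtain ⟨S, hS⟩ := hG
  have : g ∈ (G : Set (GL (Fin n) ℂ)) := by
    rw [hS]
    intro f hf
    refine hg f (Subtype.ext (funext fun x => ?_))
    rw [polyRestrict_apply]
    have hx : x.1 ∈ (G : Set (GL (Fin n) ℂ)) := x.2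
    rw [hS] at hx
    exact hx f hf
  exact this

lemma polyEval_one (f : MvPolynomial (Fin n × Fin n) ℂ) :
    polyEval 1 f = (polyRestrict G f).1 1 := (polyRestrict_apply f 1).symm

lemma expGL_zero : expGL (0 : Matrix (Fin n) (Fin n) ℂ) = 1 :=
  Units.ext NormedSpace.exp_zero

/-- The exponential of an element of the Lie algebra of a Zariski closed group lies in the group. -/
lemma expGL_smul_mem (hG : IsZariskiClosed (G : Set (GL (Fin n) ℂ))) (E : LieAlg G) (t : ℂ) :
    expGL (t • toMat G E) ∈ G := by
  refine mem_of_forall_polyEval_eq_zero hG fun f hf => ?_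
  -- All iterates of the derivation on `f` stay in the ideal of `G`, so they vanish at `1 ∈ G`.
  -- These values are the derivatives at `0` of `f` along `t ↦ exp (t X)`.
  have hk : ∀ k, polyRestrict G ((polyDer (toMat G E))^[k] f) = 0 := by
    intro k
    induction k with
    | zero => exact hf
    | succ k ih => rw [Function.iterate_succ_apply', polyRestrict_polyDer, ih, map_zero]
  have h := eq_of_iterate_eq_at_zero (fun f t => polyEval (expGL (t • toMat G E)) f)
    (polyDer (toMat G E)) (fun f t => hasDerivAt_polyEval_exp _ f t) (f := f) (g := 0)
    (fun k => by
      rw [Function.iterate_fixed (map_zero _)]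
      simp only [zero_smul, expGL_zero, polyEval_one (G := G), hk, map_zero])
  have := congrFun h t
  simpa using this

variable (hG : IsZariskiClosed (G : Set (GL (Fin n) ℂ)))

/-- The exponential map of `G`. -/
def expG (hG : IsZariskiClosed (G : Set (GL (Fin n) ℂ))) (E : LieAlg G) : G :=
  ⟨expGL (toMat G E), by simpa using expGL_smul_mem hG E 1⟩

lemma hasDerivAt_expG (E : LieAlg G) (f : coordRing G) (t : ℂ) :
    HasDerivAt (fun t : ℂ => f.1 (expG hG (t • E))) ((contract E.1 f).1 (expG hG (t • E))) t := by
  have hsum : ∀ (s : Fin n → coordRing G) (x : G), (∑ k, s k).1 x = ∑ k, (s k).1 x := fun s x => by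
    rw [AddSubmonoidClass.coe_finsetSum, Finset.sum_apply]
  induction f using coordRing_induction with
  | he i j =>
    rw [contract_entryFun, hsum]
    have h := hasDerivAt_expGL_entry (toMat G E) i j t
    simp only [← map_smul] at h
    exact h
  | hi i j =>
    rw [contract_invEntryFun, hsum]
    have h := hasDerivAt_pi.1 (hasDerivAt_pi.1 (hasDerivAt_exp_smul_const' (-toMat G E) t) i) j
    have e1 : ∀ t : ℂ, (invEntryFun G i j).1 (expG hG (t • E)) =
        NormedSpace.exp (t • -toMat G E) i j := fun t => by
      change NormedSpace.exp (-toMat G (t • E)) i j = _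
      rw [map_smul, smul_neg]
    simp only [e1]
    rw [Matrix.mul_apply] at h
    refine h.congr_deriv ?_
    refine Finset.sum_congr rfl fun k _ => ?_
    change _ = -toMat G E i k * NormedSpace.exp (-toMat G (t • E)) k j
    rw [map_smul, smul_neg]
    rfl
  | hc c =>
    rw [contract_algebraMap]
    exact hasDerivAt_const t c
  | hadd f g hf hg =>
    rw [map_add]
    exact hf.add hg
  | hmul f g hf hg =>
    have h := hf.mul hg
    rw [contract_mul]
    refine h.congr_deriv ?_
    change _ = f.1 _ * (contract E.1 g).1 _ + g.1 _ * (contract E.1 f).1 _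
    ring

/-- A group automorphism carries left translations to left translations, hence left invariant fields
to left invariant fields. -/
lemma contract_pullback (σ : algAut G) (E : LieAlg G) (f : coordRing G) :
    contract E.1 (pullback σ f) = pullback σ (contract (differential G σ E).1 f) :=
  Subtype.ext (funext fun x => congrArg E.1 (Subtype.ext (funext fun y =>
      congrArg f.1 (map_mul σ.1 x y))))

lemma coordRing_separates {x y : G} (h : ∀ f : coordRing G, f.1 x = f.1 y) : x = y :=
  Subtype.ext (Units.ext (Matrix.ext fun i j => h (entryFun G i j)))

/-- An automorphism whose differential fixes `E` fixes `exp E`. -/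
lemma map_expG_of_differential_eq (σ : algAut G) {E : LieAlg G} (h : differential G σ E = E) :
    σ.1 (expG hG E) = expG hG E := by
  refine coordRing_separates fun f => ?_
  -- As `dσ` fixes `E`, the field of `E` commutes with pull-back by `σ`. Since `σ 1 = 1`, the
  -- functions `f` and `f ∘ σ` have the same Taylor coefficients along `t ↦ exp (t E)`.
  have hk : ∀ k, (contract E.1)^[k] (pullback σ f) = pullback σ ((contract E.1)^[k] f) := by
    intro k
    induction k with
    | zero => rfl
    | succ k ih =>
      rw [Function.iterate_succ_apply', ih, contract_pullback, h, Function.iterate_succ_apply']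
  have h0 : expG hG ((0 : ℂ) • E) = 1 := by
    apply Subtype.ext
    change expGL (toMat G ((0 : ℂ) • E)) = 1
    rw [zero_smul, map_zero, expGL_zero]
  have := eq_of_iterate_eq_at_zero (fun (f : coordRing G) t => f.1 (expG hG (t • E)))
    (contract E.1) (fun f t => hasDerivAt_expG hG E f t) (f := pullback σ f) (g := f)
    (fun k => by
      simp only [hk, h0]
      exact congrArg ((contract E.1)^[k] f).1 (map_one σ.1))
  have h1 := congrFun this 1
  simp only [one_smul] at h1
  exact h1

end Exponential

/-! ## Replicas of an element of the Lie algebra -/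

section LinearAlgebra

open Module.End

/-- A linear map which intertwines two endomorphisms maps generalized eigenspaces to generalized
eigenspaces. -/
lemma maxGenEigenspace_map_of_comm {V W : Type*} [AddCommGroup V] [Module ℂ V] [AddCommGroup W]
    [Module ℂ W] {f : Module.End ℂ V} {g : Module.End ℂ W} (R : V →ₗ[ℂ] W)
    (h : ∀ v, g (R v) = R (f v)) {μ : ℂ} {v : V} (hv : v ∈ f.maxGenEigenspace μ) :
    R v ∈ g.maxGenEigenspace μ := by
  rw [mem_maxGenEigenspace] at hv ⊢
  obtain ⟨k, hk⟩ := hv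
  refine ⟨k, ?_⟩
  have : ∀ k v, ((g - μ • (1 : Module.End ℂ W)) ^ k) (R v) =
      R (((f - μ • (1 : Module.End ℂ V)) ^ k) v) := by
    intro k
    induction k with
    | zero => intro v; rfl
    | succ k ih =>
      intro v
      rw [pow_succ, pow_succ, Module.End.mul_apply, Module.End.mul_apply, ← ih]
      congr 1
      simp [h]
  rw [this, hk, map_zero]

/-- A family of linear maps on the summands of an internal direct sum glues. -/
lemma exists_linearMap_of_iSupIndep {ι V W : Type*} [DecidableEq ι] [AddCommGroup V] [Module ℂ V]
    [AddCommGroup W] [Module ℂ W] {p : ι → Submodule ℂ V} (hi : iSupIndep p) (ht : iSup p = ⊤)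
    (φ : ι → V →ₗ[ℂ] W) : ∃ L : V →ₗ[ℂ] W, ∀ i, ∀ x ∈ p i, L x = φ i x := by
  have hp : DirectSum.IsInternal p :=
    DirectSum.isInternal_submodule_of_iSupIndep_of_iSup_eq_top hi ht
  let e := LinearEquiv.ofBijective (DirectSum.coeLinearMap p) hp
  refine ⟨(DirectSum.toModule ℂ ι W fun i => φ i ∘ₗ (p i).subtype) ∘ₗ e.symm.toLinearMap,
    fun i x hx => ?_⟩
  have : e.symm x = DirectSum.lof ℂ ι (fun i => p i) i ⟨x, hx⟩ := by
    rw [LinearEquiv.symm_apply_eq]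
    exact (DirectSum.coeLinearMap_lof p i ⟨x, hx⟩).symm
  rw [LinearMap.comp_apply, LinearEquiv.coe_coe, this, DirectSum.toModule_lof]
  rfl

/-- The trace of `X * Y` if `Y` acts on each generalized eigenspace of `X` by a scalar. -/
lemma trace_mul_of_maxGenEigenspace {V : Type*} [AddCommGroup V] [Module ℂ V]
    [FiniteDimensional ℂ V] (X : Module.End ℂ V) :
    ∃ (s : Finset ℂ) (d : ℂ → ℕ), (∀ μ ∈ s, 0 < d μ) ∧ (∀ μ, X.HasEigenvalue μ → μ ∈ s) ∧
      ∀ (Y : Module.End ℂ V) (c : ℂ → ℂ), (∀ μ, ∀ v ∈ X.maxGenEigenspace μ, Y v = c μ • v) →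
        LinearMap.trace ℂ V (Y ∘ₗ X) = ∑ μ ∈ s, d μ * (μ * c μ) := by
  have hds := DirectSum.isInternal_submodule_of_iSupIndep_of_iSup_eq_top
      X.independent_maxGenEigenspace (iSup_maxGenEigenspace_eq_top X)
  have h_fin : {μ | X.maxGenEigenspace μ ≠ ⊥}.Finite :=
      WellFoundedGT.finite_ne_bot_of_iSupIndep X.independent_maxGenEigenspace
  refine ⟨h_fin.toFinset, fun μ => Module.finrank ℂ (X.maxGenEigenspace μ), fun μ hμ => ?_,
    fun μ hμ => ?_, fun Y c hY => ?_⟩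
  · rw [Set.Finite.mem_toFinset, Set.mem_ofPred_eq] at hμ
    rwa [Nat.pos_iff_ne_zero, ne_eq, Submodule.finrank_eq_zero]
  · rw [Set.Finite.mem_toFinset, Set.mem_ofPred_eq]
    exact fun h => hμ (le_bot_iff.1 (h ▸ X.eigenspace_le_maxGenEigenspace))
  · have hX : ∀ μ, Set.MapsTo X (X.maxGenEigenspace μ) (X.maxGenEigenspace μ) := fun μ =>
      mapsTo_maxGenEigenspace_of_comm rfl μ
    have hYm : ∀ μ, Set.MapsTo Y (X.maxGenEigenspace μ) (X.maxGenEigenspace μ) := fun μ v hv => by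
      rw [hY μ v hv]; exact Submodule.smul_mem _ _ hv
    have hXY : ∀ μ, Set.MapsTo (Y ∘ₗ X) (X.maxGenEigenspace μ) (X.maxGenEigenspace μ) :=
      fun μ => (hYm μ).comp (hX μ)
    rw [LinearMap.trace_eq_sum_trace_restrict' hds h_fin hXY]
    refine Finset.sum_congr rfl fun μ _ => ?_
    -- On this summand `Y` is the scalar `c μ` and `X` is `μ` plus a nilpotent operator, which does
    -- not contribute to the trace.
    have hYr : Y.restrict (hYm μ) = c μ • LinearMap.id := by
      ext v
      exact hY μ v.1 v.2
    have hcomm : Commute (Y.restrict (hYm μ)) (X.restrict (hX μ)) := by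
      rw [hYr]; exact (Commute.one_left _).smul_left _
    rw [LinearMap.restrict_comp (hX μ) (hYm μ),
      LinearMap.trace_comp_eq_mul_of_commute_of_isNilpotent μ hcomm
        (X.isNilpotent_restrict_maxGenEigenspace_sub_algebraMap μ), hYr, map_smul,
      LinearMap.trace_id, smul_eq_mul]
    ring

end LinearAlgebra

/-! ### Left invariant vector fields and Chevalley's replicas. -/

section Replica

variable {n : ℕ} {G : Subgroup (GL (Fin n) ℂ)}

/-- The left invariant vector field attached to `E`, as an endomorphism of the coordinate ring. -/
abbrev vectorField (E : LieAlg G) : Module.End ℂ (coordRing G) := contract E.1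

/-- If `T` is the field, then `T - (μ + ν)` applied to `f * g` is `(T - μ) f * g + f * (T - ν) g`.
By induction, exponents `a` for `f` and `b` for `g` give the exponent `a + b` for the product. -/
lemma vectorField_mul_mem (E : LieAlg G) {μ ν : ℂ} {f g : coordRing G}
    (hf : f ∈ (vectorField E).maxGenEigenspace μ) (hg : g ∈ (vectorField E).maxGenEigenspace ν) :
    f * g ∈ (vectorField E).maxGenEigenspace (μ + ν) := by
  rw [Module.End.mem_maxGenEigenspace] at *
  obtain ⟨a, ha⟩ := hf
  obtain ⟨b, hb⟩ := hg
  suffices h : ∀ k a b, a + b = k → ∀ f g : coordRing G,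
      ((vectorField E - μ • (1 : Module.End ℂ (coordRing G))) ^ a) f = 0 →
      ((vectorField E - ν • (1 : Module.End ℂ (coordRing G))) ^ b) g = 0 →
      ((vectorField E - (μ + ν) • (1 : Module.End ℂ (coordRing G))) ^ k) (f * g) = 0 from
    ⟨a + b, h (a + b) a b rfl f g ha hb⟩
  intro k
  induction k with
  | zero =>
    intro a b hab f g hf hg
    obtain rfl : a = 0 := by omega
    have hf0 : f = 0 := hf
    simp [hf0]
  | succ k ih =>
    intro a b hab f g hf hg
    rcases a with _ | a
    · have hf0 : f = 0 := hf
      simp [hf0]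
    rcases b with _ | b
    · have hg0 : g = 0 := hg
      simp [hg0]
    have e : (vectorField E - (μ + ν) • (1 : Module.End ℂ (coordRing G))) (f * g) =
        (vectorField E - μ • (1 : Module.End ℂ (coordRing G))) f * g +
          f * (vectorField E - ν • (1 : Module.End ℂ (coordRing G))) g := by
      simp only [LinearMap.sub_apply, LinearMap.smul_apply, Module.End.one_apply, contract_mul,
        add_smul, LinearMap.add_apply, sub_mul, mul_sub, smul_mul_assoc, mul_smul_comm]
      ring
    rw [pow_succ, Module.End.mul_apply, e, map_add, ih a (b + 1) (by omega), ih (a + 1) b (by omega),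
      add_zero]
    · exact hf
    · rw [← Module.End.mul_apply, ← pow_succ]; exact hg
    · rw [← Module.End.mul_apply, ← pow_succ]; exact hf
    · exact hg

variable (G) in
/-- Linear combinations of the entries in the `i`-th row. -/
def rowMap (i : Fin n) : (Fin n → ℂ) →ₗ[ℂ] coordRing G :=
  Fintype.linearCombination ℂ fun j => entryFun G i j

variable (G) in
/-- Linear combinations of the entries in the `j`-th column of the inverse. -/
def invColMap (j : Fin n) : (Fin n → ℂ) →ₗ[ℂ] coordRing G :=
  Fintype.linearCombination ℂ fun i => invEntryFun G i j

lemma rowMap_single (i j : Fin n) : rowMap G i (Pi.single j 1) = entryFun G i j := by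
  simp [rowMap, Fintype.linearCombination_apply_single]

lemma invColMap_single (i j : Fin n) : invColMap G j (Pi.single i 1) = invEntryFun G i j := by
  simp [invColMap, Fintype.linearCombination_apply_single]

/-- Each row of entries is an equivariant image of the given representation; each column of the
inverse is likewise an image of the dual one. This makes the field locally finite on generators. -/
lemma vectorField_rowMap (E : LieAlg G) (i : Fin n) (v : Fin n → ℂ) :
    vectorField E (rowMap G i v) = rowMap G i (Matrix.toLin' (toMat G E) v) := by
  simp only [rowMap, Fintype.linearCombination_apply, map_sum, map_smul, contract_entryFun,
    Finset.smul_sum, Matrix.toLin'_apply, Matrix.mulVec, dotProduct, Finset.sum_smul]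
  rw [Finset.sum_comm]
  refine Finset.sum_congr rfl fun k _ => Finset.sum_congr rfl fun l _ => ?_
  rw [smul_smul, mul_comm]

lemma vectorField_invColMap (E : LieAlg G) (j : Fin n) (v : Fin n → ℂ) :
    vectorField E (invColMap G j v) =
      invColMap G j (Matrix.toLin' (-(toMat G E).transpose) v) := by
  simp only [invColMap, Fintype.linearCombination_apply, map_sum, map_smul, contract_invEntryFun,
    Finset.smul_sum, Matrix.toLin'_apply, Matrix.mulVec, dotProduct, Finset.sum_smul]
  rw [Finset.sum_comm]
  refine Finset.sum_congr rfl fun k _ => Finset.sum_congr rfl fun l _ => ?_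
  rw [smul_smul, mul_comm]
  rfl

/-- The coordinate ring is the sum of the generalized eigenspaces of a left invariant vector
field. -/
lemma iSup_maxGenEigenspace_vectorField (E : LieAlg G) :
    ⨆ μ, (vectorField E).maxGenEigenspace μ = ⊤ := by
  -- A finite-dimensional space is the sum of its generalized eigenspaces over `ℂ`, and an
  -- intertwiner preserves this. So the generators lie in the sum; products stay in it by
  -- `vectorField_mul_mem`.
  have hmap : ∀ (X : Module.End ℂ (Fin n → ℂ)) (R : (Fin n → ℂ) →ₗ[ℂ] coordRing G),
      (∀ v, vectorField E (R v) = R (X v)) →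
        ∀ v, R v ∈ ⨆ μ, (vectorField E).maxGenEigenspace μ := by
    intro X R hR v
    have hv : v ∈ ⨆ μ, X.maxGenEigenspace μ := by
      rw [Module.End.iSup_maxGenEigenspace_eq_top]; trivial
    refine Submodule.iSup_induction _ (motive := fun v => R v ∈ _) hv (fun μ v hv => ?_) ?_
      fun v w hv hw => ?_
    · exact Submodule.mem_iSup_of_mem μ (maxGenEigenspace_map_of_comm R hR hv)
    · rw [map_zero]; exact zero_mem _
    · rw [map_add]; exact add_mem hv hw
  rw [eq_top_iff]
  rintro f -
  induction f using coordRing_induction with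
  | he i j =>
    rw [← rowMap_single]
    exact hmap _ _ (vectorField_rowMap E i) _
  | hi i j =>
    rw [← invColMap_single]
    exact hmap _ _ (vectorField_invColMap E j) _
  | hc c =>
    refine Submodule.mem_iSup_of_mem 0 ?_
    rw [Module.End.mem_maxGenEigenspace]
    exact ⟨1, by simp [contract_algebraMap]⟩
  | hadd f g hf hg => exact add_mem hf hg
  | hmul f g hf hg =>
    refine Submodule.iSup_induction _ (motive := fun f => f * g ∈ _) hf (fun μ f hf => ?_) ?_
      fun f f' hf hf' => ?_
    · refine Submodule.iSup_induction _ (motive := fun g => f * g ∈ _) hg (fun ν g hg => ?_) ?_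
        fun g g' hg hg' => ?_
      · exact Submodule.mem_iSup_of_mem (μ + ν) (vectorField_mul_mem E hf hg)
      · rw [mul_zero]; exact zero_mem _
      · rw [mul_add]; exact add_mem hg hg'
    · rw [zero_mul]; exact zero_mem _
    · rw [add_mul]; exact add_mem hf hf'

/-- For an additive map `ψ : ℂ → ℂ`, the replica of `E` by `ψ`: an element of the Lie algebra which
acts by `ψ μ` on the generalized eigenspace of `E` for `μ`, in every rational representation
obtained from the given one by an automorphism of `G`. -/
lemma exists_replica (E : LieAlg G) (ψ : ℂ →+ ℂ) :
    ∃ E' : LieAlg G, ∀ (σ : algAut G) (μ : ℂ) (v : Fin n → ℂ),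
      v ∈ Module.End.maxGenEigenspace (Matrix.toLin' (toMat G (differential G σ E))) μ →
        Matrix.toLin' (toMat G (differential G σ E')) v = ψ μ • v := by
  let ev : coordRing G →ₗ[ℂ] ℂ :=
    { toFun := fun f => f.1 1, map_add' := fun _ _ => rfl, map_smul' := fun _ _ => rfl }
  -- The replica is evaluation at `1` rescaled by `ψ μ` on the generalized eigenspace for `μ`.
  -- Eigenvalues add under products and `ψ` is additive, so `L` is a point derivation.
  obtain ⟨L, hL⟩ := exists_linearMap_of_iSupIndep
    (vectorField E).independent_maxGenEigenspace (iSup_maxGenEigenspace_vectorField E)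
    (fun μ => ψ μ • ev)
  have hL' : ∀ μ, ∀ f ∈ (vectorField E).maxGenEigenspace μ, L f = ψ μ * f.1 1 :=
    fun μ f hf => hL μ f hf
  have hder : ∀ f g : coordRing G, L (f * g) = f.1 1 * L g + g.1 1 * L f := by
    intro f g
    have hf : f ∈ ⨆ μ, (vectorField E).maxGenEigenspace μ := by
      rw [iSup_maxGenEigenspace_vectorField]; trivial
    have hg : g ∈ ⨆ μ, (vectorField E).maxGenEigenspace μ := by
      rw [iSup_maxGenEigenspace_vectorField]; trivial
    refine Submodule.iSup_induction _
      (motive := fun f => L (f * g) = f.1 1 * L g + g.1 1 * L f) hf (fun μ f hf => ?_) ?_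
      fun f f' hf hf' => ?_
    · refine Submodule.iSup_induction _
        (motive := fun g => L (f * g) = f.1 1 * L g + g.1 1 * L f) hg (fun ν g hg => ?_) ?_
        fun g g' hg hg' => ?_
      · rw [hL' _ _ hf, hL' _ _ hg, hL' _ _ (vectorField_mul_mem E hf hg), map_add]
        change (ψ μ + ψ ν) * (f.1 1 * g.1 1) = _
        ring
      · change L (f * 0) = f.1 1 * L 0 + 0 * L f
        simp
      · change L (f * (g + g')) = f.1 1 * L (g + g') + (g.1 1 + g'.1 1) * L f
        rw [mul_add, map_add, map_add, hg, hg']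
        ring
    · change L (0 * g) = 0 * L g + g.1 1 * L 0
      simp
    · change L ((f + f') * g) = (f.1 1 + f'.1 1) * L g + g.1 1 * L (f + f')
      rw [add_mul, map_add, map_add, hf, hf']
      ring
  refine ⟨LieAlg.mk L hder, fun σ μ v hv => funext fun i => ?_⟩
  -- After pull-back by `σ`, the row map intertwines the matrix of `dσ E` with the field of `E`.
  -- This is why one replica serves all twists `σ` at once.
  have h1 : pullback σ (rowMap G i v) ∈ (vectorField E).maxGenEigenspace μ :=
    maxGenEigenspace_map_of_comm (pullback σ ∘ₗ rowMap G i)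
      (fun v => by
        rw [LinearMap.comp_apply, LinearMap.comp_apply, ← vectorField_rowMap, contract_pullback])
      hv
  have h2 : L (pullback σ (rowMap G i v)) =
      Matrix.toLin' (toMat G (differential G σ (LieAlg.mk L hder))) v i := by
    simp only [rowMap, Fintype.linearCombination_apply, map_sum, map_smul, Matrix.toLin'_apply,
      Matrix.mulVec, dotProduct]
    exact Finset.sum_congr rfl fun j _ => mul_comm _ _
  have h3 : (pullback σ (rowMap G i v)).1 1 = v i := by
    have : (pullback σ (rowMap G i v)).1 1 = (rowMap G i v).1 1 :=
      congrArg (rowMap G i v).1 (map_one σ.1)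
    rw [this, rowMap, Fintype.linearCombination_apply, AddSubmonoidClass.coe_finsetSum,
      Finset.sum_apply]
    change ∑ j, v j * (entryFun G i j).1 1 = v i
    simp [entryFun_one, Matrix.one_apply]
  rw [← h2, hL' μ _ h1, h3]
  rfl

end Replica

/-! ## Invariant forms on the Lie algebra of a reductive group -/

section NilpotentMatrices

variable {n : ℕ}

/-- The characteristic polynomial is `X ^ n`. An exponent independent of the matrix makes unipotence
a Zariski closed condition. -/
lemma pow_eq_zero_of_isNilpotent_matrix {A : Matrix (Fin n) (Fin n) ℂ} (h : IsNilpotent A) :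
    A ^ n = 0 := by
  have h1 : (A.charpoly - Polynomial.X ^ n) = 0 := by
    have := Matrix.isNilpotent_charpoly_sub_pow_of_isNilpotent h
    rw [Fintype.card_fin] at this
    exact this.eq_zero
  have h2 := A.aeval_self_charpoly
  rw [sub_eq_zero.1 h1] at h2
  simpa using h2

/-- By Engel's theorem, a nonzero Lie algebra of nilpotent matrices has a nonzero center. -/
lemma exists_central_of_isNilpotent (L : Submodule ℂ (Matrix (Fin n) (Fin n) ℂ))
    (hlie : ∀ X ∈ L, ∀ Y ∈ L, X * Y - Y * X ∈ L) (hnil : ∀ X ∈ L, IsNilpotent X) (hne : L ≠ ⊥) :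
    ∃ Z ∈ L, Z ≠ 0 ∧ ∀ X ∈ L, X * Z = Z * X := by
  let _ : LieRing (Matrix (Fin n) (Fin n) ℂ) := LieRing.ofAssociativeRing
  let K : LieSubalgebra ℂ (Matrix (Fin n) (Fin n) ℂ) :=
    { L with lie_mem' := fun {X Y} hX hY => hlie X hX Y hY }
  have hK : LieRing.IsNilpotent K := by
    rw [LieAlgebra.isNilpotent_iff_forall (R := ℂ)]
    exact fun x => LieAlgebra.isNilpotent_ad_of_isNilpotent (hnil x.1 x.2)
  have : Nontrivial K := by
    obtain ⟨X, hX, hX0⟩ := L.ne_bot_iff.1 hne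
    exact ⟨⟨⟨X, hX⟩, 0, fun h => hX0 (congrArg Subtype.val h)⟩⟩
  have := LieModule.nontrivial_max_triv_of_isNilpotent ℂ K K
  obtain ⟨⟨Z, hZ⟩, hZ0⟩ := exists_ne (0 : LieModule.maxTrivSubmodule ℂ K K)
  rw [LieModule.mem_maxTrivSubmodule] at hZ
  refine ⟨Z.1, Z.2, fun h => hZ0 (Subtype.ext (Subtype.ext h)), fun X hX => ?_⟩
  have := congrArg Subtype.val (hZ ⟨X, hX⟩)
  exact sub_eq_zero.1 this

/-- The generalized eigenspaces for nonzero numbers vanish, so the one for `0` is the whole space.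
-/
lemma isNilpotent_of_forall_hasEigenvalue {V : Type*} [AddCommGroup V] [Module ℂ V]
    [FiniteDimensional ℂ V] (X : Module.End ℂ V) (h : ∀ μ, X.HasEigenvalue μ → μ = 0) :
    IsNilpotent X := by
  have hb : ∀ μ, μ ≠ 0 → X.maxGenEigenspace μ = ⊥ := by
    intro μ hμ
    rw [Module.End.maxGenEigenspace_eq_genEigenspace_finrank]
    by_contra hne
    exact hμ (h μ (Module.End.hasEigenvalue_of_hasGenEigenvalue (k := Module.finrank ℂ V) hne))
  have ht : X.maxGenEigenspace 0 = ⊤ := by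
    rw [eq_top_iff, ← Module.End.iSup_maxGenEigenspace_eq_top X]
    refine iSup_le fun μ => ?_
    by_cases hμ : μ = 0
    · rw [hμ]
    · rw [hb μ hμ]; exact bot_le
  refine ⟨Module.finrank ℂ V, LinearMap.ext fun v => ?_⟩
  have hv : v ∈ X.maxGenEigenspace 0 := ht ▸ Submodule.mem_top
  rw [Module.End.maxGenEigenspace_eq_genEigenspace_finrank, Module.End.mem_genEigenspace_nat] at hv
  simpa using hv

end NilpotentMatrices

/-! ### Trace forms summed over automorphisms; nilpotency of their radical. -/

section TraceForm

variable {n : ℕ} {G : Subgroup (GL (Fin n) ℂ)}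

/-- The sum of the trace forms of the representations of `G` obtained from the given one by the
automorphisms in `Q`. -/
def traceForm (Q : Finset (algAut G)) : LinearMap.BilinForm ℂ (LieAlg G) :=
  LinearMap.mk₂ ℂ (fun x y => ∑ σ ∈ Q, Matrix.trace
      (toMat G (differential G σ x) * toMat G (differential G σ y)))
    (fun x x' y => by simp only [map_add, add_mul, Matrix.trace_add, Finset.sum_add_distrib])
    (fun c x y => by simp only [map_smul, smul_mul_assoc, Matrix.trace_smul, Finset.smul_sum])
    (fun x y y' => by simp only [map_add, mul_add, Matrix.trace_add, Finset.sum_add_distrib])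
    (fun c x y => by simp only [map_smul, mul_smul_comm, Matrix.trace_smul, Finset.smul_sum])

variable (Q : Finset (algAut G))

lemma traceForm_apply (x y : LieAlg G) : traceForm Q x y = ∑ σ ∈ Q, Matrix.trace
      (toMat G (differential G σ x) * toMat G (differential G σ y)) := rfl

lemma traceForm_comm (x y : LieAlg G) : traceForm Q x y = traceForm Q y x := by
  simp only [traceForm_apply]
  exact Finset.sum_congr rfl fun σ _ => Matrix.trace_mul_comm _ _

lemma traceForm_adjoint (x y z : LieAlg G) :
    traceForm Q (adjoint x y) z = -traceForm Q y (adjoint x z) := by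
  simp only [traceForm_apply, ← Finset.sum_neg_distrib]
  refine Finset.sum_congr rfl fun σ _ => ?_
  rw [differential_adjoint, differential_adjoint, toMat_adjoint, toMat_adjoint, sub_mul, mul_sub,
    Matrix.trace_sub, Matrix.trace_sub, Matrix.mul_assoc, Matrix.trace_mul_comm, Matrix.mul_assoc,
    neg_sub, Matrix.mul_assoc]

lemma mul_conjAut (σ : algAut G) (g : G) : σ * conjAut g = conjAut (σ.1 g) * σ := by
  refine Subtype.ext (MulEquiv.ext fun x => ?_)
  change σ.1 (g * x * g⁻¹) = σ.1 g * σ.1 x * (σ.1 g)⁻¹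
  rw [map_mul, map_mul, map_inv]

/-- Moving the conjugation by `g` past `σ` turns it into conjugation by `σ g`, which leaves traces
unchanged. -/
lemma traceForm_conj (g : G) (x y : LieAlg G) :
    traceForm Q (differential G (conjAut g) x) (differential G (conjAut g) y) =
      traceForm Q x y := by
  simp only [traceForm_apply]
  refine Finset.sum_congr rfl fun σ _ => ?_
  have h : ∀ x, differential G σ (differential G (conjAut g) x) =
      differential G (conjAut (σ.1 g)) (differential G σ x) := fun x => by
    rw [← Module.End.mul_apply, ← Module.End.mul_apply, ← map_mul, ← map_mul, mul_conjAut]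
  rw [h, h, toMat_differential_conj, toMat_differential_conj]
  set a := (σ.1 g).1
  have : (a⁻¹ : GL (Fin n) ℂ).1 * a.1 = 1 := a.inv_val
  calc _ = Matrix.trace (a.1 * (toMat G (differential G σ x) * ((a⁻¹ : GL (Fin n) ℂ).1 * a.1) *
        toMat G (differential G σ y)) * (a⁻¹ : GL (Fin n) ℂ).1) := by
        simp only [Matrix.mul_assoc]
    _ = _ := by
      rw [this, Matrix.mul_one, Matrix.trace_mul_cycle, this, Matrix.one_mul]

/-- Right translation by `τ` permutes the summands. -/
lemma traceForm_of_mul_mem (τ : algAut G) (hτ : ∀ σ, σ ∈ Q ↔ σ * τ ∈ Q) (x y : LieAlg G) :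
    traceForm Q (differential G τ x) (differential G τ y) = traceForm Q x y := by
  simp only [traceForm_apply]
  refine Finset.sum_bij (fun σ _ => σ * τ) (fun σ h => (hτ σ).1 h) (fun σ _ σ' _ h =>
    mul_right_cancel h) (fun σ h => ⟨σ * τ⁻¹, (hτ _).2 (by simpa using h), by simp⟩) fun σ _ => ?_
  rw [map_mul]
  rfl

/-- An element of the radical of the trace form is nilpotent. -/
lemma isNilpotent_of_traceForm_eq_zero (h1 : 1 ∈ Q) {x : LieAlg G}
    (hx : ∀ y, traceForm Q x y = 0) : IsNilpotent (toMat G x) := by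
  rw [← Matrix.isNilpotent_toLin'_iff]
  refine isNilpotent_of_forall_hasEigenvalue _ fun μ hμ => ?_
  -- As in Cartan's criterion, it suffices that every `ℚ`-linear form on `ℂ` kills the eigenvalue.
  rw [← Module.forall_dual_apply_eq_zero_iff ℚ μ]
  intro ψ
  let ψ' : ℂ →+ ℂ := (Rat.castHom ℂ).toAddMonoidHom.comp ψ.toAddMonoidHom
  obtain ⟨y, hy⟩ := exists_replica x ψ'
  choose s d hd hs htr using fun σ : algAut G =>
    trace_mul_of_maxGenEigenspace (Matrix.toLin' (toMat G (differential G σ x)))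
  -- Pair `x` with its replica by `ψ`.
  have key : ∑ σ ∈ Q, ∑ μ ∈ s σ, (d σ μ : ℂ) * (μ * ψ' μ) = 0 := by
    rw [← hx y, traceForm_apply]
    refine Finset.sum_congr rfl fun σ _ => ?_
    rw [← htr σ (Matrix.toLin' (toMat G (differential G σ y))) ψ' (hy σ), ← Matrix.toLin'_mul,
      Matrix.trace_toLin'_eq, Matrix.trace_mul_comm]
  -- Applying `ψ` once more gives a sum of squares with positive weights `d σ μ`. All terms vanish,
  -- among them the one of the eigenvalue `μ` for `σ = 1`.
  have key' : ∑ σ ∈ Q, ∑ μ ∈ s σ, (d σ μ : ℚ) * (ψ μ * ψ μ) = 0 := by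
    have h := congrArg ψ key
    rw [map_zero, map_sum] at h
    rw [← h]
    refine Finset.sum_congr rfl fun σ _ => ?_
    rw [map_sum]
    refine Finset.sum_congr rfl fun ν _ => ?_
    have : (d σ ν : ℂ) * (ν * ψ' ν) = ((d σ ν : ℚ) * ψ ν) • ν := by
      rw [Algebra.smul_def]
      change (d σ ν : ℂ) * (ν * (ψ ν : ℂ)) = (((d σ ν : ℚ) * ψ ν : ℚ) : ℂ) * ν
      push_cast
      ring
    rw [this, map_smul, smul_eq_mul]
    ring
  have hnn : ∀ σ ∈ Q, ∀ ν ∈ s σ, 0 ≤ (d σ ν : ℚ) * (ψ ν * ψ ν) := fun σ _ ν _ =>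
    mul_nonneg (Nat.cast_nonneg _) (mul_self_nonneg _)
  have h2 := (Finset.sum_eq_zero_iff_of_nonneg fun σ hσ => Finset.sum_nonneg (hnn σ hσ)).1 key' 1 h1
  have h3 := (Finset.sum_eq_zero_iff_of_nonneg (hnn 1 h1)).1 h2 μ (hs 1 μ (by
    rw [map_one]; exact hμ))
  have h4 : (d 1 μ : ℚ) ≠ 0 := Nat.cast_ne_zero.2 (hd 1 μ (hs 1 μ (by
    rw [map_one]; exact hμ))).ne'
  exact mul_self_eq_zero.1 ((mul_eq_zero.1 h3).resolve_left h4)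

end TraceForm

/-! ### Zariski closures of unipotent groups. -/

section ZariskiClosure

variable {n : ℕ}

/-- The Zariski closure of a subset of `GL_n(ℂ)`. -/
def zariskiClosure (Z : Set (GL (Fin n) ℂ)) : Set (GL (Fin n) ℂ) :=
  {g | ∀ f, (∀ z ∈ Z, polyEval z f = 0) → polyEval g f = 0}

lemma isZariskiClosed_zariskiClosure (Z : Set (GL (Fin n) ℂ)) :
    IsZariskiClosed (zariskiClosure Z) :=
  ⟨{f | ∀ z ∈ Z, polyEval z f = 0}, rfl⟩

lemma subset_zariskiClosure (Z : Set (GL (Fin n) ℂ)) : Z ⊆ zariskiClosure Z :=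
  fun z hz _ hf => hf z hz

lemma zariskiClosure_subset {Z A : Set (GL (Fin n) ℂ)} (hA : IsZariskiClosed A) (h : Z ⊆ A) :
    zariskiClosure Z ⊆ A := by
  obtain ⟨S, rfl⟩ := hA
  exact fun g hg f hf => hg f fun z hz => h hz f hf

/-- A map which is given by polynomials on the Zariski closure of `Z` is continuous there. -/
lemma zariskiClosure_mapsTo {Z Z' : Set (GL (Fin n) ℂ)}
    (M : Matrix (Fin n) (Fin n) (MvPolynomial (Fin n × Fin n) ℂ)) (s : GL (Fin n) ℂ → GL (Fin n) ℂ)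
    (hs : ∀ g ∈ zariskiClosure Z, (s g : Matrix (Fin n) (Fin n) ℂ) = M.map (polyEval g))
    (hZ : ∀ z ∈ Z, s z ∈ zariskiClosure Z') : ∀ g ∈ zariskiClosure Z, s g ∈ zariskiClosure Z' := by
  have key : ∀ g ∈ zariskiClosure Z, ∀ f, polyEval (s g) f =
      polyEval g (MvPolynomial.bind₁ (fun p => M p.1 p.2) f) := by
    intro g hg f
    induction f using MvPolynomial.induction_on with
    | C a => simp [polyEval]
    | add f f' hf hf' => rw [map_add, map_add, map_add, hf, hf']
    | mul_X f p hf =>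
      rw [map_mul, map_mul, map_mul, hf, MvPolynomial.bind₁_X_right]
      congr 1
      rw [polyEval, MvPolynomial.eval_X, hs g hg]
      rfl
  intro g hg f hf
  rw [key g hg]
  refine hg _ fun z hz => ?_
  rw [← key z (subset_zariskiClosure Z hz)]
  exact hZ z hz f hf

variable (n) in
/-- The generic matrix. -/
abbrev genericMatrix : Matrix (Fin n) (Fin n) (MvPolynomial (Fin n × Fin n) ℂ) :=
  Matrix.mvPolynomialX (Fin n) (Fin n) ℂ

lemma genericMatrix_map (g : GL (Fin n) ℂ) : (genericMatrix n).map (polyEval g) = g.1 := by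
  ext i j
  simp [polyEval]

lemma constMatrix_map (g : GL (Fin n) ℂ) (A : Matrix (Fin n) (Fin n) ℂ) :
    (A.map MvPolynomial.C).map (polyEval g) = A := by
  ext i j
  simp [polyEval]

/-- Only translations in one variable are used: first the left factor is kept in `Z`, then the right
factor is fixed in the closure. -/
lemma zariskiClosure_mul {Z : Set (GL (Fin n) ℂ)} (hZ : ∀ a ∈ Z, ∀ b ∈ Z, a * b ∈ Z) :
    ∀ a ∈ zariskiClosure Z, ∀ b ∈ zariskiClosure Z, a * b ∈ zariskiClosure Z := by
  have h1 : ∀ a ∈ Z, ∀ b ∈ zariskiClosure Z, a * b ∈ zariskiClosure Z := fun a ha =>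
    zariskiClosure_mapsTo (a.1.map MvPolynomial.C * genericMatrix n) (fun b => a * b)
      (fun b _ => by rw [Matrix.map_mul, genericMatrix_map, constMatrix_map]; rfl)
      fun b hb => subset_zariskiClosure Z (hZ a ha b hb)
  intro a ha b hb
  exact zariskiClosure_mapsTo (genericMatrix n * b.1.map MvPolynomial.C) (fun a => a * b)
      (fun a _ => by rw [Matrix.map_mul, genericMatrix_map, constMatrix_map]; rfl)
      (fun a ha => h1 a ha b hb) a ha

lemma zariskiClosure_conj {Z : Set (GL (Fin n) ℂ)} (g : GL (Fin n) ℂ)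
    (hZ : ∀ a ∈ Z, g * a * g⁻¹ ∈ Z) :
    ∀ a ∈ zariskiClosure Z, g * a * g⁻¹ ∈ zariskiClosure Z :=
  zariskiClosure_mapsTo (g.1.map MvPolynomial.C * genericMatrix n *
    (g⁻¹ : GL (Fin n) ℂ).1.map MvPolynomial.C) (fun a => g * a * g⁻¹)
    (fun b _ => by
      rw [Matrix.map_mul, Matrix.map_mul, genericMatrix_map, constMatrix_map, constMatrix_map]; rfl)
    fun a ha => subset_zariskiClosure Z (hZ a ha)

lemma zariskiClosure_unipotent {Z : Set (GL (Fin n) ℂ)} (hZ : ∀ a ∈ Z, (a.1 - 1) ^ n = 0) :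
    ∀ a ∈ zariskiClosure Z, (a.1 - 1) ^ n = 0 := by
  intro a ha
  have e : ∀ g : GL (Fin n) ℂ, ((genericMatrix n - 1) ^ n).map (polyEval g) = (g.1 - 1) ^ n := by
    intro g
    rw [Matrix.map_pow, Matrix.map_sub _ (map_sub _), genericMatrix_map,
      Matrix.map_one _ (map_zero _) (map_one _)]
  ext i j
  rw [← e]
  refine ha _ fun z hz => ?_
  have : polyEval z (((genericMatrix n - 1) ^ n) i j) = ((z.1 - 1) ^ n) i j := by
    rw [← e]; rfl
  rw [this, hZ z hz]
  rfl

/-- Where `(a - 1) ^ n = 0`, inversion is polynomial: it is the finite geometric series in `1 - a`.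
The same equation holds on the closure, so `zariskiClosure_mapsTo` applies. -/
lemma zariskiClosure_inv {Z : Set (GL (Fin n) ℂ)} (hu : ∀ a ∈ Z, (a.1 - 1) ^ n = 0)
    (hZ : ∀ a ∈ Z, a⁻¹ ∈ Z) : ∀ a ∈ zariskiClosure Z, a⁻¹ ∈ zariskiClosure Z := by
  refine zariskiClosure_mapsTo (∑ k ∈ Finset.range n, (1 - genericMatrix n) ^ k) (fun a => a⁻¹)
    (fun a ha => ?_) fun a ha => subset_zariskiClosure Z (hZ a ha)
  have h0 : (1 - a.1) ^ n = 0 := by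
    rw [← neg_sub, neg_pow, zariskiClosure_unipotent hu a ha, mul_zero]
  have h1 : a.1 * ∑ k ∈ Finset.range n, (1 - a.1) ^ k = 1 := by
    have := mul_neg_geom_sum (1 - a.1) n
    rwa [sub_sub_cancel, h0, sub_zero] at this
  have h2 : (∑ k ∈ Finset.range n, (1 - genericMatrix n) ^ k).map (polyEval a) =
      ∑ k ∈ Finset.range n, (1 - a.1) ^ k := by
    have := map_sum (polyEval a).mapMatrix (fun k => (1 - genericMatrix n) ^ k) (Finset.range n)
    refine this.trans (Finset.sum_congr rfl fun k _ => ?_)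
    rw [map_pow, map_sub, map_one]
    congr 2
    exact genericMatrix_map a
  rw [h2]
  calc (a⁻¹).1 = (a⁻¹).1 * (a.1 * ∑ k ∈ Finset.range n, (1 - a.1) ^ k) := by rw [h1, mul_one]
    _ = _ := by
      rw [← mul_assoc]
      have : (a⁻¹).1 * a.1 = 1 := a.inv_val
      rw [this, one_mul]

lemma IsZariskiClosed.isClosed {Z : Set (GL (Fin n) ℂ)} (hZ : IsZariskiClosed Z) : IsClosed Z := by
  obtain ⟨S, rfl⟩ := hZ
  have : {g : GL (Fin n) ℂ | ∀ f ∈ S, MvPolynomial.eval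
      (fun p => (g : Matrix (Fin n) (Fin n) ℂ) p.1 p.2) f = 0} = ⋂ f ∈ S, {g : GL (Fin n) ℂ | MvPolynomial.eval
      (fun p => (g : Matrix (Fin n) (Fin n) ℂ) p.1 p.2) f = 0} := by
    ext g; simp
  rw [this]
  refine isClosed_biInter fun f _ => isClosed_eq ?_ continuous_const
  refine (MvPolynomial.continuous_eval f).comp (continuous_pi fun p => ?_)
  have h : Continuous fun g : GL (Fin n) ℂ => (g : Matrix (Fin n) (Fin n) ℂ) :=
    Units.continuous_val
  exact h.matrix_elem p.1 p.2

/-- The Zariski closure of a set which is connected in the classical topology is connected in the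
Zariski topology. -/
lemma isZariskiConnected_zariskiClosure {Z : Set (GL (Fin n) ℂ)} (hZ : IsPreconnected Z)
    (hne : Z.Nonempty) : IsZariskiConnected (zariskiClosure Z) := by
  refine ⟨hne.mono (subset_zariskiClosure Z), fun A B hA hB hAB hdis => ?_⟩
  have hsub := subset_zariskiClosure Z
  by_contra hcon
  push Not at hcon
  have hA' : ¬ Z ⊆ A := fun h => hcon.1 (zariskiClosure_subset hA h)
  have hB' : ¬ Z ⊆ B := fun h => hcon.2 (zariskiClosure_subset hB h)
  obtain ⟨a, haZ, haA⟩ := Set.not_subset.1 hA'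
  obtain ⟨b, hbZ, hbB⟩ := Set.not_subset.1 hB'
  obtain ⟨c, hcZ, hcA, hcB⟩ := isPreconnected_closed_iff.1 hZ A B hA.isClosed hB.isClosed
    (hsub.trans hAB) ⟨b, hbZ, (hAB (hsub hbZ)).resolve_right hbB⟩
    ⟨a, haZ, (hAB (hsub haZ)).resolve_left haA⟩
  have : c ∈ zariskiClosure Z ∩ A ∩ B := ⟨⟨hsub hcZ, hcA⟩, hcB⟩
  rw [hdis] at this
  exact this

end ZariskiClosure

/-! ### Reductivity and nondegeneracy of the trace form. -/

section Nondegenerate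

open scoped Matrix.Norms.Operator

variable {n : ℕ} {G : Subgroup (GL (Fin n) ℂ)}

lemma continuous_expGL : Continuous (expGL : Matrix (Fin n) (Fin n) ℂ → GL (Fin n) ℂ) := by
  have h : Continuous (NormedSpace.exp : Matrix (Fin n) (Fin n) ℂ → _) :=
    NormedSpace.exp_continuous
  exact Units.continuous_iff.2 ⟨h, h.comp continuous_neg⟩

lemma expGL_add_of_commute {X Y : Matrix (Fin n) (Fin n) ℂ} (h : Commute X Y) :
    expGL (X + Y) = expGL X * expGL Y :=
  Units.ext (Matrix.exp_add_of_commute _ _ h)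

lemma expGL_conj (g : GL (Fin n) ℂ) (X : Matrix (Fin n) (Fin n) ℂ) :
    expGL (g.1 * X * (g⁻¹ : GL (Fin n) ℂ).1) = g * expGL X * g⁻¹ :=
  Units.ext (Matrix.exp_units_conj g X)

lemma expGL_neg (X : Matrix (Fin n) (Fin n) ℂ) : expGL (-X) = (expGL X)⁻¹ :=
  Units.ext rfl

/-- The exponential series is finite, and without its constant term it is `X` times a matrix
commuting with `X`. -/
lemma isNilpotent_exp_sub_one {X : Matrix (Fin n) (Fin n) ℂ} (h : IsNilpotent X) :
    IsNilpotent ((expGL X).1 - 1) := by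
  obtain ⟨N, hN⟩ := h
  have e : (expGL X).1 = ∑ k ∈ Finset.range (N + 1), ((k.factorial : ℂ)⁻¹) • X ^ k := by
    rw [coe_expGL, NormedSpace.exp_eq_tsum ℂ]
    refine tsum_eq_sum fun k hk => ?_
    rw [pow_eq_zero_of_le (by simp at hk; omega) hN, smul_zero]
  rw [e, Finset.sum_range_succ', pow_zero, Nat.factorial_zero, Nat.cast_one, inv_one, one_smul,
    add_sub_cancel_right]
  have : ∑ k ∈ Finset.range N, (((k + 1).factorial : ℂ)⁻¹) • X ^ (k + 1) =
      X * ∑ k ∈ Finset.range N, (((k + 1).factorial : ℂ)⁻¹) • X ^ k := by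
    rw [Finset.mul_sum]
    exact Finset.sum_congr rfl fun k _ => by rw [pow_succ', mul_smul_comm]
  rw [this]
  refine Commute.isNilpotent_mul_right (Commute.sum_right _ _ _ fun k _ => ?_) ⟨N, hN⟩
  exact ((Commute.refl X).pow_right k).smul_right _

lemma eq_zero_of_expGL_smul_eq_one {X : Matrix (Fin n) (Fin n) ℂ}
    (h : ∀ t : ℂ, expGL (t • X) = 1) : X = 0 := by
  ext i j
  have h1 := hasDerivAt_expGL_entry X i j 0
  simp only [h] at h1
  simpa [Matrix.one_apply] using h1.unique (hasDerivAt_const 0 _)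

/-- In a reductive group, an abelian ideal of the Lie algebra which is stable under the group and
consists of nilpotent matrices is zero. -/
lemma eq_bot_of_isNilpotent_of_commute (hG : IsConnectedReductive G) (L : Submodule ℂ (LieAlg G))
    (hnil : ∀ x ∈ L, IsNilpotent (toMat G x))
    (hcomm : ∀ x ∈ L, ∀ y ∈ L, Commute (toMat G x) (toMat G y))
    (hconj : ∀ g, ∀ x ∈ L, differential G (conjAut g) x ∈ L) : L = ⊥ := by
  -- The exponentials of `L` form an abelian unipotent group, normalized by `G` and connected as the
  -- image of a vector space. Its Zariski closure is trivial because the unipotent radical is,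
  -- whence `exp (t x) = 1` for all `t` and `x = 0`.
  let Z : Set (GL (Fin n) ℂ) := (fun x => expGL (toMat G x)) '' (L : Set (LieAlg G))
  have hmul : ∀ a ∈ Z, ∀ b ∈ Z, a * b ∈ Z := by
    rintro _ ⟨x, hx, rfl⟩ _ ⟨y, hy, rfl⟩
    refine ⟨x + y, add_mem hx hy, ?_⟩
    change expGL (toMat G (x + y)) = _
    rw [map_add, expGL_add_of_commute (hcomm x hx y hy)]
  have hinv : ∀ a ∈ Z, a⁻¹ ∈ Z := by
    rintro _ ⟨x, hx, rfl⟩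
    refine ⟨-x, neg_mem hx, ?_⟩
    change expGL (toMat G (-x)) = _
    rw [map_neg, expGL_neg]
  have hone : 1 ∈ Z := ⟨0, zero_mem _, by
    change expGL (toMat G 0) = 1
    rw [map_zero, expGL_zero]⟩
  have huni : ∀ a ∈ Z, (a.1 - 1) ^ n = 0 := by
    rintro _ ⟨x, hx, rfl⟩
    exact pow_eq_zero_of_isNilpotent_matrix (isNilpotent_exp_sub_one (hnil x hx))
  have hZG : Z ⊆ G := by
    rintro _ ⟨x, hx, rfl⟩
    simpa using expGL_smul_mem hG.closed x 1
  have hZconj : ∀ g ∈ G, ∀ a ∈ Z, g * a * g⁻¹ ∈ Z := by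
    rintro g hg _ ⟨x, hx, rfl⟩
    refine ⟨differential G (conjAut ⟨g, hg⟩) x, hconj _ x hx, ?_⟩
    change expGL (toMat G _) = _
    rw [toMat_differential_conj, expGL_conj]
  have hpre : IsPreconnected Z := by
    have hc : IsPreconnected ((L.map (toMat G) : Submodule ℂ (Matrix (Fin n) (Fin n) ℂ)) :
        Set (Matrix (Fin n) (Fin n) ℂ)) :=
      ((L.map (toMat G)).restrictScalars ℝ).convex.isPreconnected
    have := hc.image expGL continuous_expGL.continuousOn
    rwa [Submodule.map_coe, Set.image_image] at this
  let U : Subgroup (GL (Fin n) ℂ) :=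
    { carrier := zariskiClosure Z
      mul_mem' := fun {a b} ha hb => zariskiClosure_mul hmul a ha b hb
      one_mem' := subset_zariskiClosure Z hone
      inv_mem' := fun {a} ha => zariskiClosure_inv huni hinv a ha }
  have hU : U = ⊥ := hG.unipotentRadical_trivial U (zariskiClosure_subset hG.closed hZG)
    (isZariskiClosed_zariskiClosure Z) (isZariskiConnected_zariskiClosure hpre ⟨1, hone⟩)
    (fun g hg u hu => zariskiClosure_conj g (hZconj g hg) u hu)
    fun u hu => ⟨n, zariskiClosure_unipotent huni u hu⟩
  rw [eq_bot_iff]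
  intro x hx
  rw [Submodule.mem_bot]
  apply toMat_injective
  rw [map_zero]
  refine eq_zero_of_expGL_smul_eq_one fun t => ?_
  have : expGL (t • toMat G x) ∈ U := subset_zariskiClosure Z
    ⟨t • x, Submodule.smul_mem _ t hx, by simp⟩
  rwa [hU, Subgroup.mem_bot] at this

/-- The trace form of a reductive group is nondegenerate. -/
lemma eq_zero_of_traceForm_eq_zero (hG : IsConnectedReductive G) (Q : Finset (algAut G))
    (h1 : 1 ∈ Q) {x : LieAlg G} (hx : ∀ y, traceForm Q x y = 0) : x = 0 := by
  -- The radical of the form is an ideal, stable under `G`, made of nilpotent matrices.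
  let R : Submodule ℂ (LieAlg G) := LinearMap.ker (traceForm Q)
  have hR : ∀ {x}, x ∈ R ↔ ∀ y, traceForm Q x y = 0 := fun {x} => by
    rw [LinearMap.mem_ker, LinearMap.ext_iff]; rfl
  by_contra hx0
  have hlie : ∀ x ∈ R, ∀ y ∈ R, adjoint x y ∈ R := fun x _ y hy =>
    hR.2 fun z => by rw [traceForm_adjoint, hR.1 hy, neg_zero]
  have hnil : ∀ x ∈ R, IsNilpotent (toMat G x) := fun x hx =>
    isNilpotent_of_traceForm_eq_zero Q h1 (hR.1 hx)
  have hconj : ∀ g, ∀ x ∈ R, differential G (conjAut g) x ∈ R := fun g x hx => hR.2 fun y => by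
    have h := traceForm_conj Q g x (differential G (conjAut g⁻¹) y)
    have e : differential G (conjAut g) (differential G (conjAut g⁻¹) y) = y := by
      rw [← Module.End.mul_apply, ← map_mul]
      have : conjAut g * conjAut g⁻¹ = 1 := Subtype.ext (by
        change MulAut.conj g * MulAut.conj g⁻¹ = 1
        rw [← map_mul, mul_inv_cancel, map_one])
      rw [this, map_one]
      rfl
    rw [e] at h
    rw [h, hR.1 hx]
  obtain ⟨Z, hZ, hZ0, hZc⟩ := exists_central_of_isNilpotent (R.map (toMat G))
    (by
      rintro _ ⟨x, hx, rfl⟩ _ ⟨y, hy, rfl⟩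
      exact ⟨adjoint x y, hlie x hx y hy, toMat_adjoint x y⟩)
    (by
      rintro _ ⟨x, hx, rfl⟩
      exact hnil x hx)
    ((Submodule.ne_bot_iff _).2 ⟨toMat G x, ⟨x, hR.2 hx, rfl⟩, fun h => hx0
      (toMat_injective (h.trans (map_zero _).symm))⟩)
  obtain ⟨z, hz, rfl⟩ := hZ
  -- The centre of the radical: it contains `z ≠ 0` by Engel's theorem, but it vanishes by
  -- reductivity, being abelian, nilpotent and stable under `G`.
  let L : Submodule ℂ (LieAlg G) :=
    { carrier := {x | x ∈ R ∧ ∀ y ∈ R, adjoint y x = 0}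
      zero_mem' := ⟨zero_mem _, fun y _ => map_zero _⟩
      add_mem' := fun {a b} ha hb => ⟨add_mem ha.1 hb.1, fun y hy => by
        rw [map_add, ha.2 y hy, hb.2 y hy, add_zero]⟩
      smul_mem' := fun c a ha => ⟨Submodule.smul_mem _ c ha.1, fun y hy => by
        rw [map_smul, ha.2 y hy, smul_zero]⟩ }
  have hL : L = ⊥ := by
    refine eq_bot_of_isNilpotent_of_commute hG L (fun x hx => hnil x hx.1) (fun x hx y hy => ?_)
      fun g x hx => ⟨hconj g x hx.1, fun y hy => ?_⟩
    · have := congrArg (toMat G) (hy.2 x hx.1)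
      rw [toMat_adjoint, map_zero, sub_eq_zero] at this
      exact this
    · have h := hx.2 _ (hconj g⁻¹ y hy)
      have h' := congrArg (differential G (conjAut g)) h
      rw [differential_adjoint, map_zero, ← Module.End.mul_apply (differential G (conjAut g)),
        ← map_mul] at h'
      have : conjAut g * conjAut g⁻¹ = 1 := Subtype.ext (by
        change MulAut.conj g * MulAut.conj g⁻¹ = 1
        rw [← map_mul, mul_inv_cancel, map_one])
      rwa [this, map_one] at h'
  have hzL : z ∈ L := ⟨hz, fun y hy => toMat_injective (by
    rw [toMat_adjoint, map_zero, sub_eq_zero]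
    exact hZc _ ⟨y, hy, rfl⟩)⟩
  rw [hL, Submodule.mem_bot] at hzL
  exact hZ0 (by rw [hzL, map_zero])

end Nondegenerate

/-! ## Semisimple operators -/

section Semisimple

open Polynomial Module.End

variable {V : Type*} [AddCommGroup V] [Module ℂ V] [FiniteDimensional ℂ V]

/-- The product of the `X - μ`, over the eigenvalues `μ`. -/
def eigenPoly (f : Module.End ℂ V) : ℂ[X] := ∏ μ : f.Eigenvalues, (X - C μ.1)

lemma separable_eigenPoly (f : Module.End ℂ V) : (eigenPoly f).Separable :=
  separable_prod_X_sub_C_iff'.2 fun _ _ _ _ h => Subtype.ext h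

lemma eval_eigenPoly_eq_zero {f : Module.End ℂ V} {μ : ℂ} :
    (eigenPoly f).eval μ = 0 ↔ f.HasEigenvalue μ := by
  rw [eigenPoly, eval_prod, Finset.prod_eq_zero_iff]
  constructor
  · rintro ⟨ν, -, hν⟩
    rw [eval_sub, eval_X, eval_C, sub_eq_zero] at hν
    rw [hν]
    exact ν.2
  · intro h
    exact ⟨⟨μ, h⟩, Finset.mem_univ _, by simp⟩

lemma aeval_eigenPoly_of_iSup {f : Module.End ℂ V} (h : ⨆ μ, f.eigenspace μ = ⊤) :
    aeval f (eigenPoly f) = 0 := by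
  refine LinearMap.ext fun v => ?_
  have hv : v ∈ ⨆ μ, f.eigenspace μ := h ▸ Submodule.mem_top
  refine Submodule.iSup_induction _ (motive := fun v => aeval f (eigenPoly f) v = 0) hv
    (fun μ v hv => ?_) (map_zero _) fun v w hv hw => by rw [map_add, hv, hw, add_zero]
  by_cases hv0 : v = 0
  · rw [hv0, map_zero]
  · have he : f.HasEigenvector μ v := ⟨hv, hv0⟩
    rw [aeval_apply_of_hasEigenvector he,
      eval_eigenPoly_eq_zero.2 (hasEigenvalue_of_hasEigenvector he), zero_smul]

lemma isSemisimple_of_iSup_eigenspace {f : Module.End ℂ V} (h : ⨆ μ, f.eigenspace μ = ⊤) :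
    f.IsSemisimple :=
  isSemisimple_of_squarefree_aeval_eq_zero (separable_eigenPoly f).squarefree
    (aeval_eigenPoly_of_iSup h)

lemma isSemisimple_of_mul_eq_one {f g : Module.End ℂ V} (hgf : g * f = 1) (hf : f.IsSemisimple) :
    g.IsSemisimple := by
  refine isSemisimple_of_iSup_eigenspace ?_
  rw [eq_top_iff, ← hf.iSup_eigenspace_eq_top]
  refine iSup_le fun μ v hv => ?_
  rw [mem_eigenspace_iff] at hv
  have h : g (f v) = v := LinearMap.congr_fun hgf v
  by_cases hμ : μ = 0
  · rw [hv, hμ, zero_smul, map_zero] at h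
    rw [← h]
    exact zero_mem _
  · refine Submodule.mem_iSup_of_mem μ⁻¹ ?_
    rw [mem_eigenspace_iff]
    rw [hv, map_smul] at h
    conv_rhs => rw [← h]
    rw [smul_smul, inv_mul_cancel₀ hμ, one_smul]

/-- An invertible operator is semisimple if one of its powers is. -/
lemma isSemisimple_of_pow {f : Module.End ℂ V} (hf : Function.Injective f) {m : ℕ} (hm : 0 < m)
    (h : (f ^ m).IsSemisimple) : f.IsSemisimple := by
  set p := eigenPoly (f ^ m) with hp
  have h0 : p.eval 0 ≠ 0 := by
    intro h0
    rw [hp, eval_eigenPoly_eq_zero] at h0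
    obtain ⟨v, hv⟩ := h0.exists_hasEigenvector
    have h1 := hv.apply_eq_smul
    rw [zero_smul] at h1
    have hinj : Function.Injective (f ^ m) := by
      rw [Module.End.coe_pow]
      exact hf.iterate m
    exact hv.2 (hinj (h1.trans (map_zero _).symm))
  -- The derivative of `p (X ^ m)` is `p' (X ^ m) * m * X ^ (m - 1)`. Here `p'` is coprime to `p`,
  -- `m` is a unit, and `X` does not divide `p (X ^ m)` since `p 0 ≠ 0`.
  have hsep : (expand ℂ m p).Separable := by
    rw [Polynomial.Separable, derivative_expand]
    refine IsCoprime.mul_right (IsCoprime.map (separable_eigenPoly (f ^ m)) (expand ℂ m).toRingHom)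
      (IsCoprime.mul_right ?_ (IsCoprime.pow_right ?_))
    · have : IsUnit (m : ℂ[X]) := by
        rw [← C_eq_natCast]
        exact isUnit_C.2 (Nat.cast_ne_zero.2 hm.ne').isUnit
      obtain ⟨u, hu⟩ := this
      exact ⟨0, ↑u⁻¹, by rw [← hu]; simp⟩
    · refine IsCoprime.symm ((irreducible_X.coprime_iff_not_dvd).2 fun hX => h0 ?_)
      rw [X_dvd_iff, coeff_zero_eq_eval_zero, expand_eval, zero_pow hm.ne'] at hX
      exact hX
  refine isSemisimple_of_squarefree_aeval_eq_zero hsep.squarefree ?_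
  rw [expand_aeval]
  exact aeval_eigenPoly_of_iSup h.iSup_eigenspace_eq_top

/-- If `f` is semisimple, the space is the sum of the kernel and of the image of `f - c`. -/
lemma exists_eigenvector_add_of_isSemisimple {f : Module.End ℂ V} (hf : f.IsSemisimple) (c : ℂ)
    (w : V) : ∃ u v, f u = c • u ∧ w = u + (f v - c • v) := by
  have hw : w ∈ ⨆ μ, f.eigenspace μ := hf.iSup_eigenspace_eq_top ▸ Submodule.mem_top
  refine Submodule.iSup_induction _
    (motive := fun w => ∃ u v, f u = c • u ∧ w = u + (f v - c • v)) hw (fun μ w hw => ?_)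
    ⟨0, 0, by simp, by simp⟩ ?_
  · rw [mem_eigenspace_iff] at hw
    by_cases hμ : μ = c
    · exact ⟨w, 0, hμ ▸ hw, by simp⟩
    · refine ⟨0, (μ - c)⁻¹ • w, by simp, ?_⟩
      rw [map_smul, hw, zero_add, smul_comm c, ← smul_sub, ← sub_smul, smul_smul,
        inv_mul_cancel₀ (sub_ne_zero.2 hμ), one_smul]
  · rintro w w' ⟨u, v, hu, rfl⟩ ⟨u', v', hu', rfl⟩
    refine ⟨u + u', v + v', by rw [map_add, hu, hu', smul_add], ?_⟩
    rw [map_add, smul_add]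
    abel

/-- Restriction of a semisimple operator to an invariant subspace, given by an injective
intertwiner. -/
lemma isSemisimple_of_intertwiner {U W : Type*} [AddCommGroup U] [Module ℂ U]
    [AddCommGroup W] [Module ℂ W] [FiniteDimensional ℂ W] {f : Module.End ℂ U} {g : Module.End ℂ W} (i : U →ₗ[ℂ] W)
    (hi : Function.Injective i) (h : ∀ v, i (f v) = g (i v)) (hg : g.IsSemisimple) :
    f.IsSemisimple := by
  refine isSemisimple_of_squarefree_aeval_eq_zero (p := eigenPoly g)
    (separable_eigenPoly g).squarefree (LinearMap.ext fun v => hi ?_)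
  have key : ∀ p : ℂ[X], i (aeval f p v) = aeval g p (i v) := by
    intro p
    induction p using Polynomial.induction_on' with
    | add p q hp hq => simp only [map_add, LinearMap.add_apply, hp, hq]
    | monomial k c =>
      have : ∀ k, i ((f ^ k) v) = (g ^ k) (i v) := by
        intro k
        induction k with
        | zero => rfl
        | succ k ih => rw [pow_succ', Module.End.mul_apply, h, ih, pow_succ', Module.End.mul_apply]
      simp [aeval_monomial, this, Algebra.algebraMap_eq_smul_one]
  rw [key, aeval_eigenPoly_of_iSup hg.iSup_eigenspace_eq_top]
  simp

end Semisimple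

/-! ### Semisimple elements of `GL_n` and their adjoint action. -/

section SemisimpleElements

open Polynomial

variable {n : ℕ}

lemma aeval_toLin' (A : Matrix (Fin n) (Fin n) ℂ) (p : ℂ[X]) :
    aeval (Matrix.toLin' A) p = Matrix.toLin' (aeval A p) :=
  (aeval_algHom_apply (Matrix.toLinAlgEquiv' (R := ℂ) (n := Fin n)).toAlgHom A p)

lemma exists_separable_of_isSemisimple {A : Matrix (Fin n) (Fin n) ℂ}
    (hA : Module.End.IsSemisimple (Matrix.toLin' A)) : ∃ p : ℂ[X], Squarefree p ∧ aeval A p = 0 := by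
  refine ⟨eigenPoly (Matrix.toLin' A), (separable_eigenPoly _).squarefree, ?_⟩
  have := aeval_eigenPoly_of_iSup hA.iSup_eigenspace_eq_top
  rw [aeval_toLin'] at this
  exact (Matrix.toLin' (R := ℂ)).map_eq_zero_iff.1 this

lemma isSemisimple_mulLeft {A : Matrix (Fin n) (Fin n) ℂ}
    (hA : Module.End.IsSemisimple (Matrix.toLin' A)) :
    Module.End.IsSemisimple (LinearMap.mulLeft ℂ A) := by
  obtain ⟨p, hp, h⟩ := exists_separable_of_isSemisimple hA
  refine Module.End.isSemisimple_of_squarefree_aeval_eq_zero hp ?_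
  have := aeval_algHom_apply (Algebra.lmul ℂ (Matrix (Fin n) (Fin n) ℂ)) A p
  rw [h, map_zero] at this
  exact this

lemma isSemisimple_mulRight {A : Matrix (Fin n) (Fin n) ℂ}
    (hA : Module.End.IsSemisimple (Matrix.toLin' A)) :
    Module.End.IsSemisimple (LinearMap.mulRight ℂ A) := by
  obtain ⟨p, hp, h⟩ := exists_separable_of_isSemisimple hA
  refine Module.End.isSemisimple_of_squarefree_aeval_eq_zero hp (LinearMap.ext fun X => ?_)
  have key : ∀ p : ℂ[X], aeval (LinearMap.mulRight ℂ A) p X = X * aeval A p := by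
    intro p
    induction p using Polynomial.induction_on' with
    | add p q hp hq => simp only [map_add, LinearMap.add_apply, hp, hq, mul_add]
    | monomial k c =>
      rw [aeval_monomial, aeval_monomial, LinearMap.pow_mulRight]
      simp [Algebra.algebraMap_eq_smul_one]
  rw [key, h, mul_zero]
  rfl

/-- Conjugation by a semisimple element is a semisimple operator on matrices. -/
lemma isSemisimple_conj {g : GL (Fin n) ℂ} (hg : IsSemisimpleElt g) :
    Module.End.IsSemisimple (LinearMap.mulLeft ℂ g.1 * LinearMap.mulRight ℂ (g⁻¹).1) := by
  have hinv : Module.End.IsSemisimple (Matrix.toLin' (g⁻¹).1) := by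
    refine isSemisimple_of_mul_eq_one (f := Matrix.toLin' g.1) ?_ hg
    have : (g⁻¹).1 * g.1 = 1 := g.inv_val
    change Matrix.toLin' (g⁻¹).1 ∘ₗ Matrix.toLin' g.1 = 1
    rw [← Matrix.toLin'_mul, this, Matrix.toLin'_one]
    rfl
  exact (isSemisimple_mulLeft hg).mul_of_commute (LinearMap.commute_mulLeft_right _ _)
    (isSemisimple_mulRight hinv)

variable {G : Subgroup (GL (Fin n) ℂ)}

lemma isSemisimple_differential_conj {g : G} (hg : IsSemisimpleElt g.1) :
    Module.End.IsSemisimple (differential G (conjAut g)) := by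
  refine isSemisimple_of_intertwiner (toMat G) toMat_injective (fun E => ?_) (isSemisimple_conj hg)
  rw [toMat_differential_conj, Matrix.mul_assoc]
  rfl

/-! ### Images of diagonal matrices under morphisms from `SL_2` -/

/-- The character `z ↦ z ^ k`. -/
def zpowChar (k : ℤ) : ℂˣ →* ℂ := (Units.coeHom ℂ).comp (zpowGroupHom k)

lemma zpowChar_apply (k : ℤ) (z : ℂˣ) : zpowChar k z = (z : ℂ) ^ k := by
  simp [zpowChar]

/-- Dedekind's independence of characters; the value at `2` separates the exponents. -/
lemma linearIndependent_zpowChar :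
    LinearIndependent ℂ (fun (k : ℤ) (z : ℂˣ) => zpowChar k z) := by
  refine (linearIndependent_monoidHom ℂˣ ℂ).comp zpowChar fun k l h => ?_
  have h2 := DFunLike.congr_fun h (Units.mk0 (2 : ℂ) two_ne_zero)
  rw [zpowChar_apply, zpowChar_apply, Units.val_mk0] at h2
  have h3 : ((2 : ℝ) : ℂ) ^ k = ((2 : ℝ) : ℂ) ^ l := by simpa using h2
  rw [← Complex.ofReal_zpow, ← Complex.ofReal_zpow] at h3
  exact zpow_right_injective₀ (by norm_num) (by norm_num) (Complex.ofReal_injective h3)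

/-- The diagonal torus of `SL_2`. -/
abbrev torus (z : ℂˣ) : Matrix.SpecialLinearGroup (Fin 2) ℂ := diagSL (z : ℂ) z.ne_zero

lemma torus_mul (z w : ℂˣ) : torus (z * w) = torus z * torus w := diagSL_mul _ _ _ _

lemma span_zpowChar_mul_mem {f g : ℂˣ → ℂ}
    (hf : f ∈ Submodule.span ℂ (Set.range fun (k : ℤ) (z : ℂˣ) => zpowChar k z))
    (hg : g ∈ Submodule.span ℂ (Set.range fun (k : ℤ) (z : ℂˣ) => zpowChar k z)) :
    f * g ∈ Submodule.span ℂ (Set.range fun (k : ℤ) (z : ℂˣ) => zpowChar k z) := by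
  induction hf, hg using Submodule.span_induction₂ with
  | mem_mem x y hx hy =>
    obtain ⟨k, rfl⟩ := hx
    obtain ⟨l, rfl⟩ := hy
    refine Submodule.subset_span ⟨k + l, funext fun z => ?_⟩
    simp [zpowChar_apply, zpow_add₀]
  | zero_left y hy => rw [zero_mul]; exact zero_mem _
  | zero_right x hx => rw [mul_zero]; exact zero_mem _
  | add_left x y z _ _ _ h h' => rw [add_mul]; exact add_mem h h'
  | add_right x y z _ _ _ h h' => rw [mul_add]; exact add_mem h h'
  | smul_left r x y _ _ h => rw [smul_mul_assoc]; exact Submodule.smul_mem _ _ h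
  | smul_right r x y _ _ h => rw [mul_smul_comm]; exact Submodule.smul_mem _ _ h

lemma torus_mem_span {f : Matrix.SpecialLinearGroup (Fin 2) ℂ → ℂ} (hf : f ∈ sl2CoordRing) :
    (fun z => f (torus z)) ∈
      Submodule.span ℂ (Set.range fun (k : ℤ) (z : ℂˣ) => zpowChar k z) := by
  have hk : ∀ k : ℤ, (fun z => zpowChar k z) ∈
      Submodule.span ℂ (Set.range fun (k : ℤ) (z : ℂˣ) => zpowChar k z) := fun k =>
    Submodule.subset_span ⟨k, rfl⟩
  induction hf using Algebra.adjoin_induction with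
  | mem f hf =>
    obtain ⟨⟨i, j⟩, rfl⟩ := hf
    fin_cases i <;> fin_cases j
    · convert hk 1 using 2 with z
      simp [zpowChar_apply, diagSL]
    · convert! zero_mem (Submodule.span ℂ _) using 1
    · convert! zero_mem (Submodule.span ℂ _) using 1
    · convert hk (-1) using 2 with z
      simp [zpowChar_apply, diagSL]
  | algebraMap r =>
    convert Submodule.smul_mem _ r (hk 0) using 1
    funext z
    simp [zpowChar_apply]
  | add f g _ _ hf hg => exact add_mem hf hg
  | mul f g _ _ hf hg =>
    exact span_zpowChar_mul_mem hf hg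

/-- The image of a diagonal matrix under a morphism from `SL_2` is semisimple. -/
lemma isSemisimpleElt_torus {ψ : Matrix.SpecialLinearGroup (Fin 2) ℂ →* G}
    (hψ : IsAlgebraicHom ψ) (z : ℂˣ) : IsSemisimpleElt (ψ (torus z)).1 := by
  have hc : ∀ i j, ∃ c : ℤ →₀ ℂ, ∀ z : ℂˣ,
      (ψ (torus z)).1.1 i j = c.sum fun k a => a * zpowChar k z := by
    intro i j
    obtain ⟨c, hc⟩ := Finsupp.mem_span_range_iff_exists_finsupp.1
      (torus_mem_span (hψ _ (entry_mem i j)))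
    refine ⟨c, fun z => ?_⟩
    have := congrFun hc z
    rw [Finsupp.sum_apply'] at this
    exact this.symm
  choose c hc using hc
  let K : Finset ℤ := Finset.univ.biUnion fun p : Fin n × Fin n => (c p.1 p.2).support
  have hK : ∀ (w : ℂˣ) i j, (ψ (torus w)).1.1 i j = ∑ k ∈ K, c i j k * zpowChar k w := by
    intro w i j
    rw [hc]
    refine Finsupp.sum_of_support_subset _ (fun k hk => ?_) _ fun k _ => zero_mul _
    exact Finset.mem_biUnion.2 ⟨(i, j), Finset.mem_univ _, hk⟩
  -- The image of the torus element `w` is `∑ w ^ k • A k`. Comparing the coefficients of `w ^ k` in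
  -- multiplicativity shows that the image of `z` acts on the range of `A k` by `z ^ k`; at `w = 1`
  -- one sees that these ranges span.
  let A : ℤ → Matrix (Fin n) (Fin n) ℂ := fun k => Matrix.of fun i j => c i j k
  have hρ : ∀ w : ℂˣ, (ψ (torus w)).1.1 = ∑ k ∈ K, zpowChar k w • A k := by
    intro w
    ext i j
    rw [hK, Matrix.sum_apply]
    exact Finset.sum_congr rfl fun k _ => mul_comm _ _
  have hmul : ∀ k ∈ K, (ψ (torus z)).1.1 * A k = zpowChar k z • A k := by
    intro k hk
    ext i j
    have hlin := linearIndependent_iff'.1 linearIndependent_zpowChar K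
      (fun k => ((ψ (torus z)).1.1 * A k - zpowChar k z • A k) i j) (by
        funext w
        have e : (ψ (torus z)).1.1 * (ψ (torus w)).1.1 = (ψ (torus (z * w))).1.1 := by
          rw [torus_mul, map_mul]; rfl
        rw [hρ w, hρ (z * w), Finset.mul_sum] at e
        have e' := congrFun (congrFun e i) j
        rw [Matrix.sum_apply, Matrix.sum_apply, ← sub_eq_zero, ← Finset.sum_sub_distrib] at e'
        rw [Finset.sum_apply, Pi.zero_apply, ← e']
        refine Finset.sum_congr rfl fun k _ => ?_
        rw [Pi.smul_apply, smul_eq_mul, mul_smul_comm, Matrix.smul_apply, Matrix.smul_apply,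
          Matrix.sub_apply, Matrix.smul_apply, map_mul]
        simp only [smul_eq_mul]
        ring) k hk
    exact sub_eq_zero.1 hlin
  refine isSemisimple_of_iSup_eigenspace ?_
  rw [eq_top_iff]
  rintro v -
  have hv : v = ∑ k ∈ K, Matrix.toLin' (A k) v := by
    have h1 := hρ 1
    have : torus 1 = 1 := by
      refine Subtype.ext ?_
      ext i j
      fin_cases i <;> fin_cases j <;> simp [diagSL]
    rw [this, map_one] at h1
    have h2 := congrArg (fun M => Matrix.toLin' M v) h1
    have h3 : Matrix.toLin' ((1 : G).1.1) v = v := by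
      change Matrix.toLin' 1 v = v
      simp
    refine (h3.symm.trans h2).trans ?_
    simp only [map_one, one_smul, map_sum, LinearMap.sum_apply]
  rw [hv]
  refine sum_mem fun k hk => Submodule.mem_iSup_of_mem (zpowChar k z) ?_
  rw [Module.End.mem_eigenspace_iff, ← LinearMap.comp_apply, ← Matrix.toLin'_mul, hmul k hk,
    map_smul]
  rfl

end SemisimpleElements

/-! ## The adjoint representation of the L-group -/

section NoSmallSubgroups

/-- The ball of radius `1 / 2` around `1` in a normed algebra contains no nontrivial subgroup. -/
lemma eq_one_of_norm_pow_sub_one_le {A : Type*} [NormedRing A] [NormedAlgebra ℂ A] {g : A}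
    (h : ∀ k : ℕ, ‖g ^ k - 1‖ ≤ 1 / 2) : g = 1 := by
  -- With `h = g ^ k`, use `2 (h - 1) = (h ^ 2 - 1) - (h - 1) ^ 2` and `‖h - 1‖ ≤ 1 / 2`. Squaring
  -- thus multiplies the distance to `1` by at least `3 / 2`, so a nonzero distance would become
  -- unbounded.
  have hstep : ∀ k, (3 / 2 : ℝ) * ‖g ^ k - 1‖ ≤ ‖g ^ (2 * k) - 1‖ := by
    intro k
    have e : (2 : ℂ) • (g ^ k - 1) = (g ^ (2 * k) - 1) - (g ^ k - 1) * (g ^ k - 1) := by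
      rw [two_smul, two_mul, pow_add]
      noncomm_ring
    have h1 : ‖(2 : ℂ) • (g ^ k - 1)‖ = 2 * ‖g ^ k - 1‖ := by
      rw [norm_smul]; simp
    rw [e] at h1
    have h2 := norm_sub_le (g ^ (2 * k) - 1) ((g ^ k - 1) * (g ^ k - 1))
    have h3 := norm_mul_le (g ^ k - 1) (g ^ k - 1)
    have h4 : ‖g ^ k - 1‖ * ‖g ^ k - 1‖ ≤ 1 / 2 * ‖g ^ k - 1‖ :=
      mul_le_mul_of_nonneg_right (h k) (norm_nonneg _)
    linarith
  have hpow : ∀ k : ℕ, (3 / 2 : ℝ) ^ k * ‖g - 1‖ ≤ 1 / 2 := by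
    intro k
    refine le_trans ?_ (h (2 ^ k))
    induction k with
    | zero => simp
    | succ k ih =>
      rw [pow_succ', mul_assoc, pow_succ' 2]
      exact (mul_le_mul_of_nonneg_left ih (by norm_num)).trans (hstep _)
  by_contra hne
  have hpos : 0 < ‖g - 1‖ := norm_pos_iff.2 (sub_ne_zero.2 hne)
  obtain ⟨k, hk⟩ := pow_unbounded_of_one_lt (1 / ‖g - 1‖) (by norm_num : (1 : ℝ) < 3 / 2)
  have := hpow k
  rw [div_lt_iff₀ hpos] at hk
  linarith

end NoSmallSubgroups

/-! ### Perfect pairings of subspaces. -/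

section PerfectPairing

variable {V : Type*} [AddCommGroup V] [Module ℂ V] [FiniteDimensional ℂ V]

/-- In a perfect pairing of subspaces, linear forms are represented by vectors. -/
lemma exists_forall_eq_of_perfect (B : LinearMap.BilinForm ℂ V) {p q : Submodule ℂ V}
    (hp : ∀ y ∈ p, (∀ x ∈ q, B y x = 0) → y = 0) (hq : ∀ x ∈ q, (∀ y ∈ p, B y x = 0) → x = 0)
    (f : Module.Dual ℂ V) : ∃ y ∈ p, ∀ x ∈ q, B y x = f x := by
  let P : p →ₗ[ℂ] Module.Dual ℂ q := B.domRestrict₁₂ p q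
  let P' : q →ₗ[ℂ] Module.Dual ℂ p := B.flip.domRestrict₁₂ q p
  have hP : Function.Injective P := by
    rw [← LinearMap.ker_eq_bot, LinearMap.ker_eq_bot']
    exact fun y hy => Subtype.ext (hp y.1 y.2 fun x hx => LinearMap.congr_fun hy ⟨x, hx⟩)
  have hP' : Function.Injective P' := by
    rw [← LinearMap.ker_eq_bot, LinearMap.ker_eq_bot']
    exact fun x hx => Subtype.ext (hq x.1 x.2 fun y hy => LinearMap.congr_fun hx ⟨y, hy⟩)
  -- Each of `p` and `q` embeds in the dual of the other, so the dimensions agree and `P` is onto.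
  have hdim : Module.finrank ℂ p = Module.finrank ℂ (Module.Dual ℂ q) := by
    refine le_antisymm (LinearMap.finrank_le_finrank_of_injective hP) ?_
    rw [Subspace.dual_finrank_eq]
    refine (LinearMap.finrank_le_finrank_of_injective hP').trans ?_
    rw [Subspace.dual_finrank_eq]
  obtain ⟨y, hy⟩ := (LinearMap.injective_iff_surjective_of_finrank_eq_finrank hdim).1 hP
    (f ∘ₗ q.subtype)
  exact ⟨y.1, y.2, fun x hx => LinearMap.congr_fun hy ⟨x, hx⟩⟩

end PerfectPairing

/-! ### The invariant form and the weight spaces of the Weil group. -/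

section AdjointRepresentation

variable {F : Type*} [Field F] [ValuativeRel F] [TopologicalSpace F]
  [IsNonarchimedeanLocalField F]

/-- The action of the Galois group by automorphisms of algebraic groups. -/
def actAut (D : LGroupData F) : GalF F →* algAut D.dual := D.act.codRestrict _ D.act_algebraic

lemma conjAction_eq (D : LGroupData F) (l : LGroup D) :
    conjAction D l = conjAut l.left * actAut D (weilIncl F l.right) := rfl

lemma Ad_eq (D : LGroupData F) (l : LGroup D) (x : LieAlg D.dual) :
    Ad D l x = differential D.dual (conjAut l.left)
      (differential D.dual (actAut D (weilIncl F l.right)) x) := by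
  have h : Ad D l = differential D.dual (conjAction D l) := rfl
  rw [h, conjAction_eq, map_mul, Module.End.mul_apply]

lemma Ad_inl (D : LGroupData F) (g : D.dual) :
    Ad D (SemidirectProduct.inl g) = differential D.dual (conjAut g) := by
  refine LinearMap.ext fun x => ?_
  rw [Ad_eq, SemidirectProduct.right_inl, map_one, map_one, map_one]
  rfl

lemma Ad_adjoint (D : LGroupData F) (l : LGroup D) (x y : LieAlg D.dual) :
    Ad D l (adjoint x y) = adjoint (Ad D l x) (Ad D l y) := differential_adjoint _ _ _

/-- There is a nondegenerate symmetric form on the Lie algebra of the dual group which is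
invariant under the L-group and under the adjoint action. -/
lemma exists_invariant_form [CharZero F] (D : LGroupData F) :
    ∃ B : LinearMap.BilinForm ℂ (LieAlg D.dual), (∀ x y, B x y = B y x) ∧
      (∀ x y z, B (adjoint x y) z = -B y (adjoint x z)) ∧
      (∀ l x y, B (Ad D l x) (Ad D l y) = B x y) ∧ ∀ x, (∀ y, B x y = 0) → x = 0 := by
  have hfin : Finite (GalF F ⧸ D.act.ker) := Subgroup.quotient_finite_of_isOpen _ D.act_open
  have hfin' : (Set.range (actAut D)).Finite := by
    have hsub : Set.range (actAut D) ⊆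
        Set.range fun c : GalF F ⧸ D.act.ker => actAut D c.out := by
      rintro _ ⟨γ, rfl⟩
      refine ⟨(γ : GalF F ⧸ D.act.ker), Subtype.ext ?_⟩
      change D.act _ = D.act γ
      have h : (((γ : GalF F ⧸ D.act.ker).out : GalF F) : GalF F ⧸ D.act.ker) = γ :=
        Quotient.out_eq _
      have h' := QuotientGroup.eq.1 h
      rw [MonoidHom.mem_ker, map_mul, map_inv] at h'
      exact inv_mul_eq_one.1 h'
    exact (Set.finite_range _).subset hsub
  -- The kernel of the action is open, so its image `Q` is finite; as a group, `Q` is stable under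
  -- right translation by each Galois automorphism.
  let Q : Finset (algAut D.dual) := hfin'.toFinset
  have hQ : ∀ {σ}, σ ∈ Q ↔ ∃ γ, actAut D γ = σ := fun {σ} => by
    rw [Set.Finite.mem_toFinset]; rfl
  refine ⟨traceForm Q, traceForm_comm Q, traceForm_adjoint Q, fun l x y => ?_, fun x hx =>
    eq_zero_of_traceForm_eq_zero D.reductive Q (hQ.2 ⟨1, map_one _⟩) hx⟩
  rw [Ad_eq, Ad_eq, traceForm_conj]
  refine traceForm_of_mul_mem Q _ (fun σ => ?_) x y
  rw [hQ, hQ]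
  constructor
  · rintro ⟨γ, rfl⟩
    exact ⟨γ * weilIncl F l.right, map_mul _ _ _⟩
  · rintro ⟨γ, hγ⟩
    exact ⟨γ * (weilIncl F l.right)⁻¹, by rw [map_mul, map_inv, hγ, mul_inv_cancel_right]⟩

lemma weilNorm_of_mem_inertia {w : WeilGroup F} (hw : w ∈ inertia F) : weilNorm w = 1 := by
  rw [inertia, MonoidHom.mem_ker] at hw
  simp [weilNorm, hw]

lemma weilNorm_frob {Fr : WeilGroup F} (hFr : IsGeometricFrobenius Fr) :
    weilNorm Fr = (residueCard F : ℝ)⁻¹ := by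
  rw [weilNorm, hFr, zpow_neg_one]

/-- A subgroup of the Weil group which contains the inertia group and a Frobenius element is the
whole group. -/
lemma mem_of_inertia_le {K : Subgroup (WeilGroup F)} (hI : inertia F ≤ K) {Fr : WeilGroup F}
    (hFr : IsGeometricFrobenius Fr) (hK : Fr ∈ K) (w : WeilGroup F) : w ∈ K := by
  have h : Fr ^ (Multiplicative.toAdd (weilDeg F w)) * w ∈ inertia F := by
    rw [inertia, MonoidHom.mem_ker, map_mul, map_zpow]
    apply Multiplicative.toAdd.injective
    rw [toAdd_mul, toAdd_zpow, hFr, toAdd_one]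
    simp
  exact (Subgroup.mul_mem_cancel_left K (K.zpow_mem hK _)).1 (hI h)

namespace LParameter

variable {D : LGroupData F} (φ : LParameter D)

/-- The representation `Ad ∘ λ` of the Weil group. -/
def adInf : WeilGroup F →* Module.End ℂ (LieAlg D.dual) := (Ad D).comp φ.infinitesimal

lemma adInf_apply (w : WeilGroup F) : φ.adInf w = Ad D (φ.infinitesimal w) := rfl

/-- The subspace on which the Weil group acts through `Ad ∘ λ` by `|w| ^ k`. -/
def weightSpace (k : ℤ) : Submodule ℂ (LieAlg D.dual) where
  carrier := {x | ∀ w, φ.adInf w x = (weilNorm w : ℂ) ^ k • x}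
  zero_mem' := by simp
  add_mem' := fun {x y} hx hy w => by rw [map_add, hx w, hy w, smul_add]
  smul_mem' := fun c x hx w => by rw [map_smul, hx w, smul_comm]

lemma mem_weightSpace {k : ℤ} {x : LieAlg D.dual} :
    x ∈ φ.weightSpace k ↔ ∀ w, φ.adInf w x = (weilNorm w : ℂ) ^ k • x := Iff.rfl

lemma mem_voganVariety {x : LieAlg D.dual} :
    x ∈ voganVariety φ.infinitesimal ↔ x ∈ φ.weightSpace 1 := by
  simp only [mem_weightSpace, zpow_one]
  rfl

lemma mem_weightSpace_zero {x : LieAlg D.dual} :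
    x ∈ φ.weightSpace 0 ↔ ∀ w, φ.adInf w x = x := by
  simp only [mem_weightSpace, zpow_zero, one_smul]

lemma ofReal_weilNorm_ne_zero (w : WeilGroup F) : (weilNorm w : ℂ) ≠ 0 :=
  Complex.ofReal_ne_zero.2 (weilNorm_pos w).ne'

/-- The `w` acting on `x` by `|w| ^ k` form a subgroup, and inertia and a Frobenius element generate
the Weil group. -/
lemma mem_weightSpace_of_frob {k : ℤ} {x : LieAlg D.dual} (hI : ∀ w ∈ inertia F, φ.adInf w x = x)
    {Fr : WeilGroup F} (hFr : IsGeometricFrobenius Fr)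
    (h : φ.adInf Fr x = (weilNorm Fr : ℂ) ^ k • x) : x ∈ φ.weightSpace k := by
  let K : Subgroup (WeilGroup F) :=
    { carrier := {w | φ.adInf w x = (weilNorm w : ℂ) ^ k • x}
      one_mem' := by
        change φ.adInf 1 x = _
        rw [map_one, weilNorm_one, Complex.ofReal_one, one_zpow, one_smul]
        rfl
      mul_mem' := fun {v w} hv hw => by
        change φ.adInf (v * w) x = _
        rw [map_mul, Module.End.mul_apply, hw, map_smul, hv, smul_smul, weilNorm_mul,
          Complex.ofReal_mul, mul_zpow, mul_comm]
      inv_mem' := fun {w} hw => by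
        change φ.adInf w⁻¹ x = _
        have h1 : φ.adInf w⁻¹ (φ.adInf w x) = x := by
          rw [← Module.End.mul_apply, ← map_mul, inv_mul_cancel, map_one]
          rfl
        have h2 : (weilNorm w⁻¹ : ℂ) * (weilNorm w : ℂ) = 1 := by
          rw [← Complex.ofReal_mul, ← weilNorm_mul, inv_mul_cancel, weilNorm_one,
            Complex.ofReal_one]
        rw [hw, map_smul] at h1
        conv_rhs => rw [← h1]
        rw [smul_smul, ← mul_zpow, h2, one_zpow, one_smul] }
  refine mem_of_inertia_le (K := K) (fun w hw => ?_) hFr h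
  change φ.adInf w x = _
  rw [hI w hw, weilNorm_of_mem_inertia hw, Complex.ofReal_one, one_zpow, one_smul]

lemma adInf_of_mem_weightSpace {k : ℤ} {x : LieAlg D.dual} (hx : x ∈ φ.weightSpace k)
    {w : WeilGroup F} (hw : w ∈ inertia F) : φ.adInf w x = x := by
  rw [hx w, weilNorm_of_mem_inertia hw, Complex.ofReal_one, one_zpow, one_smul]

lemma adInf_adjoint (w : WeilGroup F) (x y : LieAlg D.dual) :
    φ.adInf w (adjoint x y) = adjoint (φ.adInf w x) (φ.adInf w y) := Ad_adjoint _ _ _ _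

lemma adjoint_mem_weightSpace {k l : ℤ} {x y : LieAlg D.dual} (hx : x ∈ φ.weightSpace k)
    (hy : y ∈ φ.weightSpace l) : adjoint x y ∈ φ.weightSpace (k + l) := by
  intro w
  rw [adInf_adjoint, hx w, hy w, map_smul, adjoint_smul, smul_smul, mul_comm,
    zpow_add₀ (ofReal_weilNorm_ne_zero w)]

lemma nilp_mem : φ.nilp ∈ φ.weightSpace 1 := φ.mem_voganVariety.1 φ.point.2

/-! ### Finiteness of the action of inertia -/

lemma infinitesimal_of_mem_inertia {w : WeilGroup F} (hw : w ∈ inertia F) :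
    φ.infinitesimal w = φ.toHom (w, 1) := by
  have : diagNorm w = 1 := by
    change diagSL (sqrtNorm w) (sqrtNorm_ne_zero w) = 1
    refine Subtype.ext ?_
    change (!![sqrtNorm w, 0; 0, (sqrtNorm w)⁻¹] : Matrix (Fin 2) (Fin 2) ℂ) = 1
    have h : sqrtNorm w = 1 := by simp [sqrtNorm, weilNorm_of_mem_inertia hw]
    rw [h, inv_one, Matrix.one_fin_two]
  change φ.toHom (w, diagNorm w) = _
  rw [this]

open scoped Matrix.Norms.Operator in
/-- Some open subgroup of the inertia group acts trivially through `Ad ∘ λ`. -/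
lemma exists_open_subgroup_adInf_eq_one : ∃ H : Subgroup (GalF F), IsOpen (H : Set (GalF F)) ∧
    ∀ w ∈ inertia F, weilIncl F w ∈ H → φ.adInf w = 1 := by
  let g : WeilGroup F → Matrix (Fin D.n) (Fin D.n) ℂ := fun w => (φ.toHom (w, 1)).left.1.1
  have hcont : Continuous g := by
    have h1 : Continuous fun w : WeilGroup F => φ.toHom (w, 1) :=
      φ.continuous_toHom.comp (by fun_prop)
    have h2 : Continuous fun l : LGroup D => (l.left, l.right) := continuous_induced_dom
    exact Units.continuous_val.comp
      (continuous_subtype_val.comp (continuous_fst.comp (h2.comp h1)))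
  have hg1 : g 1 = 1 := by
    change (φ.toHom 1).left.1.1 = 1
    rw [map_one]
    rfl
  have hnhds : {w | ‖g w - 1‖ < 1 / 2} ∈ nhds (1 : WeilGroup F) := by
    refine (isOpen_lt (by fun_prop) continuous_const).mem_nhds ?_
    change ‖g 1 - 1‖ < 1 / 2
    rw [hg1, sub_self, norm_zero]
    norm_num
  -- A neighbourhood of `1` is cut out by a Galois condition and a degree condition; on inertia the
  -- latter is automatic.
  have hn : nhds (1 : WeilGroup F) =
      (nhds (weilIncl F 1)).comap (weilIncl F) ⊓
        (@nhds _ ⊥ (weilDeg F 1)).comap (weilDeg F) := by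
    rw [← nhds_induced, ← @nhds_induced _ _ ⊥, ← nhds_inf]
  rw [hn, Filter.mem_inf_iff_superset] at hnhds
  obtain ⟨s, hs, t, ht, hst⟩ := hnhds
  obtain ⟨A, hA, hAs⟩ := Filter.mem_comap.1 hs
  obtain ⟨C, hC, hCt⟩ := Filter.mem_comap.1 ht
  rw [map_one] at hA
  obtain ⟨E, hE, hEA⟩ := (krullTopology_mem_nhds_one_iff F (AlgebraicClosure F) A).1 hA
  -- Inside `D.act.ker` the component of `φ (w, 1)` in the dual group is multiplicative on powers.
  -- All its powers stay within `1 / 2` of `1`, so it is `1`.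
  refine ⟨E.fixingSubgroup ⊓ D.act.ker, (E.fixingSubgroup_isOpen).inter D.act_open,
    fun w hw hwH => ?_⟩
  have hact : D.act (weilIncl F w) = 1 := hwH.2
  have hmem : ∀ k : ℕ, ‖g (w ^ k) - 1‖ < 1 / 2 := by
    intro k
    refine hst ⟨hAs (hEA ?_), hCt ?_⟩
    · rw [map_pow]
      exact pow_mem hwH.1 k
    · have h1 : weilDeg F (w ^ k) = weilDeg F 1 := by
        rw [map_pow, map_one, (MonoidHom.mem_ker.1 hw : weilDeg F w = 1), one_pow]
      change weilDeg F (w ^ k) ∈ C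
      rw [h1]
      exact @mem_of_mem_nhds _ ⊥ _ _ hC
  have hpow : ∀ k : ℕ, g (w ^ k) = g w ^ k := by
    intro k
    induction k with
    | zero => rw [pow_zero, pow_zero, hg1]
    | succ k ih =>
      have e : φ.toHom (w ^ (k + 1), 1) = φ.toHom (w, 1) * φ.toHom (w ^ k, 1) := by
        rw [← map_mul, Prod.mk_mul_mk, one_mul, pow_succ']
      have e' : (φ.toHom (w, 1) * φ.toHom (w ^ k, 1)).left =
          (φ.toHom (w, 1)).left * (φ.toHom (w ^ k, 1)).left := by
        rw [SemidirectProduct.mul_left, φ.right_toHom]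
        change _ * (D.act (weilIncl F w)) _ = _
        rw [hact]
        rfl
      change (φ.toHom (w ^ (k + 1), 1)).left.1.1 = _
      rw [e, e', pow_succ', ← ih]
      rfl
  have hone : g w = 1 := eq_one_of_norm_pow_sub_one_le fun k => by
    rw [← hpow]
    exact (hmem k).le
  have hleft : (φ.toHom (w, 1)).left = 1 := Subtype.ext (Units.ext hone)
  rw [adInf_apply, infinitesimal_of_mem_inertia φ hw]
  refine LinearMap.ext fun x => ?_
  have hact' : actAut D (weilIncl F w) = 1 := Subtype.ext hact
  have hconj : (conjAut 1 : algAut D.dual) = 1 := Subtype.ext (map_one MulAut.conj)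
  rw [Ad_eq, φ.right_toHom, hleft, hact', hconj, map_one]
  rfl

/-- The inertia group acts through a finite quotient. -/
lemma finite_adInf_inertia [CharZero F] : (φ.adInf '' (inertia F : Set (WeilGroup F))).Finite := by
  obtain ⟨H, hH, h⟩ := φ.exists_open_subgroup_adInf_eq_one
  have hfin : Finite (GalF F ⧸ H) := Subgroup.quotient_finite_of_isOpen _ hH
  let f : inertia F → GalF F ⧸ H := fun w => (weilIncl F w.1 : GalF F ⧸ H)
  have hfac : Function.FactorsThrough (fun w : inertia F => φ.adInf w.1) f := by
    intro v w hvw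
    have h1 := h (v.1⁻¹ * w.1) (mul_mem (inv_mem v.2) w.2) (by
      rw [map_mul, map_inv]
      exact QuotientGroup.eq.1 hvw)
    change φ.adInf v.1 = φ.adInf w.1
    calc φ.adInf v.1 = φ.adInf v.1 * φ.adInf (v.1⁻¹ * w.1) := by rw [h1, mul_one]
      _ = φ.adInf w.1 := by rw [← map_mul, mul_inv_cancel_left]
  refine (Set.finite_range (Function.extend f (fun w : inertia F => φ.adInf w.1) 0)).subset ?_
  rintro _ ⟨w, hw, rfl⟩
  exact ⟨f ⟨w, hw⟩, hfac.extend_apply 0 ⟨w, hw⟩⟩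

/-! ### Semisimplicity of Frobenius -/

lemma adInf_injective (w : WeilGroup F) : Function.Injective (φ.adInf w) := by
  refine Function.LeftInverse.injective (g := φ.adInf w⁻¹) fun x => ?_
  rw [← Module.End.mul_apply, ← map_mul, inv_mul_cancel, map_one]
  rfl

/-- `λ (Fr)` is the product of the commuting elements `φ (Fr, 1)` and `φ (1, diag)`. A power of the
first acts as conjugation by a semisimple element, and the second is the image of a torus element of
`SL_2`. -/
lemma isSemisimple_adInf_frob {Fr : WeilGroup F} (hFr : IsGeometricFrobenius Fr) :
    (φ.adInf Fr).IsSemisimple := by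
  have hdec : φ.adInf Fr = Ad D (φ.toHom (Fr, 1)) * Ad D (φ.toHom (1, diagNorm Fr)) := by
    rw [← map_mul, ← map_mul, Prod.mk_mul_mk, one_mul, mul_one]
    rfl
  have hcomm : Commute (Ad D (φ.toHom (Fr, 1))) (Ad D (φ.toHom (1, diagNorm Fr))) := by
    change _ * _ = _ * _
    rw [← map_mul, ← map_mul, ← map_mul, ← map_mul, Prod.mk_mul_mk, Prod.mk_mul_mk, one_mul,
      mul_one, one_mul, mul_one]
  have h1 : Module.End.IsSemisimple (Ad D (φ.toHom (Fr, 1))) := by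
    obtain ⟨m, hm, hact, hss⟩ := φ.semisimple_frob Fr hFr
    refine isSemisimple_of_pow ?_ hm ?_
    · refine Function.LeftInverse.injective (g := Ad D (φ.toHom (Fr, 1))⁻¹) fun x => ?_
      rw [← Module.End.mul_apply, ← map_mul, inv_mul_cancel, map_one]
      rfl
    · rw [← map_pow]
      have e : Ad D (φ.toHom (Fr, 1) ^ m) =
          differential D.dual (conjAut (φ.toHom (Fr, 1) ^ m).left) := by
        refine LinearMap.ext fun x => ?_
        have : actAut D (weilIncl F (φ.toHom (Fr, 1) ^ m).right) = 1 := Subtype.ext hact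
        rw [Ad_eq, this, map_one]
        rfl
      rw [e]
      exact isSemisimple_differential_conj hss
  have h2 : Module.End.IsSemisimple (Ad D (φ.toHom (1, diagNorm Fr))) := by
    rw [← φ.inl_sl2, Ad_inl]
    exact isSemisimple_differential_conj (isSemisimpleElt_torus φ.algebraic_sl2
      (Units.mk0 (sqrtNorm Fr) (sqrtNorm_ne_zero Fr)))
  rw [hdec]
  exact h1.mul_of_commute hcomm h2

/-! ### Duality of weight spaces -/

/-- An invariant nondegenerate form induces a perfect pairing of the weight spaces for opposite
weights. -/
lemma eq_zero_of_forall_weightSpace [CharZero F] {Fr : WeilGroup F}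
    (hFr : IsGeometricFrobenius Fr) {B : LinearMap.BilinForm ℂ (LieAlg D.dual)}
    (hB : ∀ l x y, B (Ad D l x) (Ad D l y) = B x y) (hnd : ∀ x, (∀ y, B x y = 0) → x = 0) {k : ℤ}
    {y : LieAlg D.dual} (hy : y ∈ φ.weightSpace (-k)) (h : ∀ x ∈ φ.weightSpace k, B y x = 0) :
    y = 0 := by
  classical
  let W : Submodule ℂ (LieAlg D.dual) :=
    { carrier := {x | ∀ w ∈ inertia F, φ.adInf w x = x}
      zero_mem' := fun w _ => map_zero _
      add_mem' := fun {a b} ha hb w hw => by rw [map_add, ha w hw, hb w hw]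
      smul_mem' := fun c a ha w hw => by rw [map_smul, ha w hw] }
  have hT : ∀ x ∈ W, φ.adInf Fr x ∈ W := fun x hx v hv => by
    have h1 := hx _ (inertia_conj_mem Fr v hv)
    rw [← Module.End.mul_apply, ← map_mul]
    have e : v * Fr = Fr * (Fr⁻¹ * v * Fr) := by group
    rw [e, map_mul, Module.End.mul_apply, h1]
  have hTss : Module.End.IsSemisimple ((φ.adInf Fr).restrict hT) :=
    isSemisimple_of_intertwiner W.subtype Subtype.val_injective (fun _ => rfl)
      (φ.isSemisimple_adInf_frob hFr)
  set c : ℂ := (weilNorm Fr : ℂ) ^ k with hc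
  have hc0 : c ≠ 0 := zpow_ne_zero _ (ofReal_weilNorm_ne_zero Fr)
  have hTy : φ.adInf Fr y = c⁻¹ • y := by rw [hy Fr, zpow_neg]
  -- By semisimplicity, an inertia invariant is a vector of weight `k` plus a vector in the image of
  -- `Fr - c`. The form kills the latter against `y`, because `Fr` acts on `y` by `c⁻¹` and `B` is
  -- invariant.
  have hW : ∀ x ∈ W, B y x = 0 := by
    intro x hx
    obtain ⟨u, v, hu, huv⟩ := exists_eigenvector_add_of_isSemisimple hTss c ⟨x, hx⟩
    have hu' : φ.adInf Fr u.1 = c • u.1 := congrArg Subtype.val hu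
    have hx' : x = u.1 + (φ.adInf Fr v.1 - c • v.1) := congrArg Subtype.val huv
    have h1 := h u.1 (φ.mem_weightSpace_of_frob u.2 hFr hu')
    have h2 : c⁻¹ * B y (φ.adInf Fr v.1) = B y v.1 := by
      rw [← hB (φ.infinitesimal Fr) y v.1, ← adInf_apply, hTy, map_smul]
      rfl
    rw [hx', map_add, h1, map_sub, map_smul, ← h2, smul_eq_mul, mul_inv_cancel_left₀ hc0]
    simp
  refine hnd y fun x => ?_
  let S := φ.finite_adInf_inertia.toFinset
  have hS : ∀ {s}, s ∈ S ↔ ∃ w ∈ inertia F, φ.adInf w = s := fun {s} => by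
    rw [Set.Finite.mem_toFinset]; rfl
  -- Averaging over the finite image of inertia reduces to `W`: as `y` is fixed by inertia, pairing
  -- with the sum gives `|S| * B y x`.
  have hsum : ∑ s ∈ S, s x ∈ W := by
    intro w hw
    rw [map_sum]
    refine Finset.sum_bij (fun s _ => φ.adInf w * s) (fun s hs => ?_) (fun s _ s' _ hss => ?_)
      (fun s hs => ?_) fun s _ => rfl
    · obtain ⟨v, hv, rfl⟩ := hS.1 hs
      exact hS.2 ⟨w * v, mul_mem hw hv, map_mul _ _ _⟩
    · refine LinearMap.ext fun z => φ.adInf_injective w ?_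
      exact LinearMap.congr_fun hss z
    · obtain ⟨v, hv, rfl⟩ := hS.1 hs
      refine ⟨φ.adInf (w⁻¹ * v), hS.2 ⟨_, mul_mem (inv_mem hw) hv, rfl⟩, ?_⟩
      rw [← map_mul, mul_inv_cancel_left]
  have h1 := hW _ hsum
  have h2 : ∀ s ∈ S, B y (s x) = B y x := by
    intro s hs
    obtain ⟨v, hv, rfl⟩ := hS.1 hs
    conv_lhs => rw [← φ.adInf_of_mem_weightSpace hy hv]
    exact hB _ _ _
  rw [map_sum, Finset.sum_congr rfl h2, Finset.sum_const, nsmul_eq_mul] at h1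
  refine (mul_eq_zero.1 h1).resolve_left (Nat.cast_ne_zero.2 ?_)
  exact (Finset.card_pos.2 ⟨1, hS.2 ⟨1, one_mem _, map_one _⟩⟩).ne'

/-- `ad N : 𝔤_0 → 𝔤_1` is surjective if and only if `ad N : 𝔤_{-1} → 𝔤_0` is injective. -/
lemma adjoint_surjective_iff [CharZero F] {Fr : WeilGroup F} (hFr : IsGeometricFrobenius Fr) :
    (∀ v ∈ φ.weightSpace 1, ∃ x ∈ φ.weightSpace 0, adjoint φ.nilp x = v) ↔
      ∀ y ∈ φ.weightSpace (-1), adjoint φ.nilp y = 0 → y = 0 := by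
  obtain ⟨B, hsymm, had, hB, hnd⟩ := exists_invariant_form D
  constructor
  · intro h y hy hNy
    -- By skewness, a `y` killed by `ad N` is orthogonal to the image of `ad N`, hence to all of
    -- `𝔤_1`.
    refine φ.eq_zero_of_forall_weightSpace hFr hB hnd hy fun v hv => ?_
    obtain ⟨x, -, rfl⟩ := h v hv
    rw [hsymm, had, hNy, map_zero, neg_zero]
  · intro h
    let R : Submodule ℂ (LieAlg D.dual) := (φ.weightSpace 0).map (adjoint φ.nilp)
    by_contra hcon
    push Not at hcon
    obtain ⟨v, hv, hvR⟩ := hcon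
    have hvR' : v ∉ R := fun ⟨x, hx, hxv⟩ => hvR x hx hxv
    have hRle : R ≤ φ.weightSpace 1 := by
      rintro _ ⟨x, hx, rfl⟩
      rw [show (1 : ℤ) = 1 + 0 by norm_num]
      exact φ.adjoint_mem_weightSpace φ.nilp_mem hx
    -- A form vanishing on the image `R` but not at `v` is represented by some `y ∈ 𝔤_{-1}`. Then
    -- `[N, y]` is orthogonal to `𝔤_0`, so it is zero, and injectivity gives `y = 0`.
    obtain ⟨f, hfv, hfR⟩ := Submodule.exists_le_ker_of_notMem hvR'
    obtain ⟨y, hy, hyx⟩ := exists_forall_eq_of_perfect B (p := φ.weightSpace (-1))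
      (q := φ.weightSpace 1) (fun y hy h => φ.eq_zero_of_forall_weightSpace hFr hB hnd hy h)
      (fun x hx h => φ.eq_zero_of_forall_weightSpace hFr hB hnd (k := -1) (by rwa [neg_neg])
        fun y hy => by rw [hsymm]; exact h y hy) f
    have hNy : adjoint φ.nilp y = 0 := by
      refine φ.eq_zero_of_forall_weightSpace hFr hB hnd (k := 0) ?_ fun x hx => ?_
      · rw [show (-0 : ℤ) = 1 + -1 by norm_num]
        exact φ.adjoint_mem_weightSpace φ.nilp_mem hy
      · have hmem : adjoint φ.nilp x ∈ R := ⟨x, hx, rfl⟩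
        rw [had, hyx _ (hRle hmem), hfR hmem, neg_zero]
    have hy0 := h y hy hNy
    exact hfv (by rw [← hyx v hv, hy0, map_zero, LinearMap.zero_apply])

end LParameter

end AdjointRepresentation

/-! ## Polynomial functions on a vector space -/

section PolynomialFunctions

variable {V : Type*} [AddCommGroup V] [Module ℂ V]

variable (V) in
/-- The algebra of polynomial functions on a vector space. -/
abbrev polyFun : Subalgebra ℂ (V → ℂ) :=
  Algebra.adjoin ℂ (Set.range fun (l : Module.Dual ℂ V) (v : V) => l v)

lemma dual_mem_polyFun (l : Module.Dual ℂ V) : (fun v => l v) ∈ polyFun V :=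
  Algebra.subset_adjoin ⟨l, rfl⟩

/-- A polynomial function is polynomial on lines. -/
lemma exists_polynomial_on_line {f : V → ℂ} (hf : f ∈ polyFun V) (x d : V) :
    ∃ p : Polynomial ℂ, ∀ t : ℂ, f (x + t • d) = p.eval t := by
  induction hf using Algebra.adjoin_induction with
  | mem f hf =>
    obtain ⟨l, rfl⟩ := hf
    exact ⟨Polynomial.C (l x) + Polynomial.X * Polynomial.C (l d), fun t => by simp [mul_comm t]⟩
  | algebraMap r => exact ⟨Polynomial.C r, fun t => by simp⟩
  | add f g _ _ hf hg =>
    obtain ⟨p, hp⟩ := hf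
    obtain ⟨q, hq⟩ := hg
    exact ⟨p + q, fun t => by simp [hp, hq]⟩
  | mul f g _ _ hf hg =>
    obtain ⟨p, hp⟩ := hf
    obtain ⟨q, hq⟩ := hg
    exact ⟨p * q, fun t => by simp [hp, hq]⟩

lemma det_mem_polyFun [FiniteDimensional ℂ V] {W : Type*} [AddCommGroup W] [Module ℂ W]
    [FiniteDimensional ℂ W] (A : V →ₗ[ℂ] Module.End ℂ W) :
    (fun v => LinearMap.det (A v)) ∈ polyFun V := by
  let b := Module.finBasis ℂ W
  have e : (fun v => LinearMap.det (A v)) = ∑ σ : Equiv.Perm (Fin (Module.finrank ℂ W)),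
      (Equiv.Perm.sign σ : ℤ) • ∏ i, fun v => b.coord (σ i) (A v (b i)) := by
    funext v
    rw [← LinearMap.det_toMatrix b, Matrix.det_apply, Finset.sum_apply]
    refine Finset.sum_congr rfl fun σ _ => ?_
    rw [Pi.smul_apply, Finset.prod_apply]
    simp only [LinearMap.toMatrix_apply, Module.Basis.coord_apply]
    rfl
  rw [e]
  refine sum_mem fun σ _ => zsmul_mem (prod_mem fun i _ => ?_) _
  exact dual_mem_polyFun (b.coord (σ i) ∘ₗ LinearMap.applyₗ (b i) ∘ₗ A)

/-- The points of a line which lie in a Zariski open set containing two points of the line form a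
connected set. -/
lemma isPreconnected_line {S : Set (V → ℂ)} (hS : S ⊆ (polyFun V : Set (V → ℂ))) {x y : V}
    (hx : ∃ f ∈ S, f x ≠ 0) (hy : ∃ f ∈ S, f y ≠ 0) :
    IsPreconnected {t : ℂ | ∃ f ∈ S, f (x + t • (y - x)) ≠ 0} := by
  obtain ⟨f, hf, hfx⟩ := hx
  obtain ⟨g, hg, hgy⟩ := hy
  obtain ⟨p, hp⟩ := exists_polynomial_on_line (hS hf) x (y - x)
  obtain ⟨q, hq⟩ := exists_polynomial_on_line (hS hg) x (y - x)
  have hp0 : p ≠ 0 := by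
    rintro rfl
    have := hp 0
    simp [hfx] at this
  have hq0 : q ≠ 0 := by
    rintro rfl
    have := hq 1
    simp [hgy] at this
  -- The complement of the roots of `p` is connected and dense in `ℂ`, so every set containing it is
  -- connected.
  have hcount : ({t | p.IsRoot t} : Set ℂ).Countable := (p.finite_setOfPred_isRoot hp0).countable
  have hconn := (hcount.isConnected_compl_of_one_lt_rank (by
    rw [Complex.rank_real_complex]; norm_num)).isPreconnected
  refine hconn.subset_closure (fun t ht => ⟨f, hf, by rw [hp]; exact ht⟩) fun t _ => ?_
  rw [(hcount.dense_compl ℂ).closure_eq]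
  trivial

end PolynomialFunctions

/-! ## Openness of the orbit, if the tangent map is surjective -/

section MatrixOrbit

open scoped Matrix.Norms.Operator

variable {n : ℕ}

/-- If the tangent map at `M` of the orbit map is surjective, then the orbit of `M` under the
conjugation by exponentials contains a neighbourhood of `M`. -/
lemma eventually_exists_conj_exp {E V : Submodule ℂ (Matrix (Fin n) (Fin n) ℂ)}
    {M : Matrix (Fin n) (Fin n) ℂ} (hM : M ∈ V)
    (hmem : ∀ X ∈ E, (expGL X).1 * M * ((expGL X)⁻¹).1 ∈ V)
    (hsurj : ∀ Y ∈ V, ∃ X ∈ E, X * M - M * X = Y) {Y : Matrix (Fin n) (Fin n) ℂ} (hY : Y ∈ V) :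
    ∀ᶠ t : ℂ in nhds 0, ∃ X ∈ E, (expGL X).1 * M * ((expGL X)⁻¹).1 = M + t • Y := by
  -- A projection onto `V` exhibits the orbit map `Ψ : E → V` below as a composite of differentiable
  -- maps.
  obtain ⟨π, hπ⟩ := V.subtype.exists_leftInverse_of_injective V.ker_subtype
  have hπ' : ∀ x (hx : x ∈ V), π x = ⟨x, hx⟩ := fun x hx => LinearMap.congr_fun hπ ⟨x, hx⟩
  let πc : Matrix (Fin n) (Fin n) ℂ →L[ℂ] V := LinearMap.toContinuousLinearMap π
  let i : E →L[ℂ] Matrix (Fin n) (Fin n) ℂ := LinearMap.toContinuousLinearMap E.subtype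
  have h0 : HasStrictFDerivAt (NormedSpace.exp : Matrix (Fin n) (Fin n) ℂ → _)
      (1 : Matrix (Fin n) (Fin n) ℂ →L[ℂ] Matrix (Fin n) (Fin n) ℂ) (i 0) := by
    rw [map_zero]
    exact hasStrictFDerivAt_exp_zero
  have h0' : HasStrictFDerivAt (NormedSpace.exp : Matrix (Fin n) (Fin n) ℂ → _)
      (1 : Matrix (Fin n) (Fin n) ℂ →L[ℂ] Matrix (Fin n) (Fin n) ℂ) ((-i) 0) := by
    rw [map_zero]
    exact hasStrictFDerivAt_exp_zero
  let Ψ : E → V := fun X => ⟨_, hmem X.1 X.2⟩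
  have h1 : HasStrictFDerivAt (fun X : E => NormedSpace.exp (i X)) i 0 :=
    h0.comp (0 : E) i.hasStrictFDerivAt
  have h2 : HasStrictFDerivAt (fun X : E => NormedSpace.exp ((-i) X)) (-i) 0 :=
    h0'.comp (0 : E) (-i).hasStrictFDerivAt
  have h3 := πc.hasStrictFDerivAt.comp (0 : E) ((h1.mul_const' M).mul' h2)
  have hΨ : (fun X : E => πc (((fun X => NormedSpace.exp (i X) * M) *
      (fun X => NormedSpace.exp ((-i) X))) X)) = Ψ := funext fun X => hπ' _ (hmem X.1 X.2)
  rw [hΨ] at h3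
  have hΨ0 : Ψ 0 = ⟨M, hM⟩ := by
    apply Subtype.ext
    change (expGL 0).1 * M * ((expGL 0)⁻¹).1 = M
    simp [expGL_zero]
  -- The strict derivative at `0` is `X ↦ X * M - M * X`, which is onto `V`, so `Ψ` maps
  -- neighbourhoods of `0` onto neighbourhoods of `M`.
  have hsurj' := h3.map_nhds_eq_of_surj (by
    rw [LinearMap.range_eq_top]
    rintro ⟨Z, hZ⟩
    obtain ⟨X, hX, hXZ⟩ := hsurj Z hZ
    refine ⟨⟨X, hX⟩, ?_⟩
    rw [← hπ' Z hZ]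
    change π (NormedSpace.exp (i 0) * M * -X + X * M * NormedSpace.exp ((-i) 0)) = π _
    congr 1
    rw [← hXZ, map_zero, map_zero, NormedSpace.exp_zero]
    noncomm_ring)
  rw [hΨ0] at hsurj'
  have htend : Filter.Tendsto (fun t : ℂ => (⟨M + t • Y, add_mem hM (V.smul_mem t hY)⟩ : V))
      (nhds 0) (nhds ⟨M, hM⟩) := by
    have hc : Continuous fun t : ℂ => (⟨M + t • Y, add_mem hM (V.smul_mem t hY)⟩ : V) :=
      Continuous.subtype_mk (by fun_prop) _
    have := hc.tendsto 0
    simpa using this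
  filter_upwards [(htend.mono_right hsurj'.ge).eventually Filter.range_mem_map] with t ht
  obtain ⟨X, hX⟩ := ht
  exact ⟨X.1, X.2, congrArg Subtype.val hX⟩

end MatrixOrbit

/-! ### Orbits of the centralizer in the Vogan variety. -/

section Orbit

variable {F : Type*} [Field F] [ValuativeRel F] [TopologicalSpace F]
  [IsNonarchimedeanLocalField F]

lemma inl_conjAction (D : LGroupData F) (l : LGroup D) (g : D.dual) :
    (SemidirectProduct.inl ((conjAction D l).1 g) : LGroup D) =
      l * SemidirectProduct.inl g * l⁻¹ := by
  have h1 : (conjAction D l).1 g = l.left * D.act (weilIncl F l.right) g * l.left⁻¹ := rfl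
  rw [h1]
  ext1
  · simp [SemidirectProduct.mul_left, SemidirectProduct.inv_left]
  · simp

lemma mem_centralizer_iff {D : LGroupData F} {lam : WeilGroup F →* LGroup D} {g : D.dual} :
    g ∈ centralizer lam ↔ ∀ w, (conjAction D (lam w)).1 g = g := by
  refine forall_congr' fun w => ?_
  rw [← (SemidirectProduct.inl_injective (φ := D.act.comp (weilIncl F))).eq_iff, inl_conjAction,
    mul_inv_eq_iff_eq_mul, mul_inv_eq_iff_eq_mul, eq_comm]

namespace LParameter

variable {D : LGroupData F} (φ : LParameter D)

/-- Weight `0` means fixed by every `Ad (λ (w))`, and an automorphism whose differential fixes `E`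
fixes `exp E`. -/
lemma expG_mem_centralizer {E : LieAlg D.dual} (hE : E ∈ φ.weightSpace 0) :
    expG D.reductive.closed E ∈ centralizer φ.infinitesimal :=
  mem_centralizer_iff.2 fun w =>
    map_expG_of_differential_eq _ _ (φ.mem_weightSpace_zero.1 hE w)

lemma Ad_inl_mem_weightSpace {k : ℤ} {h : D.dual} (hh : h ∈ centralizer φ.infinitesimal)
    {x : LieAlg D.dual} (hx : x ∈ φ.weightSpace k) :
    Ad D (SemidirectProduct.inl h) x ∈ φ.weightSpace k := by
  intro w
  have e : φ.infinitesimal w * SemidirectProduct.inl h =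
      SemidirectProduct.inl h * φ.infinitesimal w := (mul_inv_eq_iff_eq_mul.1 (hh w)).symm
  rw [adInf_apply, ← Ad_mul, e, Ad_mul, ← adInf_apply, hx w, map_smul]

lemma Ad_inl_inv (h : D.dual) (x : LieAlg D.dual) :
    Ad D (SemidirectProduct.inl h) (Ad D (SemidirectProduct.inl h⁻¹) x) = x := by
  rw [← Ad_mul, ← map_mul, mul_inv_cancel, map_one, map_one]
  rfl

/-- If `ad z : 𝔤_0 → 𝔤_1` is surjective, then the orbit of `z` contains a neighbourhood of `z` on
every line through `z`. -/
lemma eventually_mem_orbit {z v : LieAlg D.dual} (hz : z ∈ φ.weightSpace 1)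
    (hsurj : ∀ v ∈ φ.weightSpace 1, ∃ x ∈ φ.weightSpace 0, adjoint z x = v)
    (hv : v ∈ φ.weightSpace 1) :
    ∀ᶠ t : ℂ in nhds 0, ∃ h ∈ centralizer φ.infinitesimal,
      z + t • v = Ad D (SemidirectProduct.inl h) z := by
  have hconj : ∀ E : LieAlg D.dual, (expGL (toMat D.dual E)).1 * toMat D.dual z *
      ((expGL (toMat D.dual E))⁻¹).1 =
      toMat D.dual (Ad D (SemidirectProduct.inl (expG D.reductive.closed E)) z) := fun E => by
    rw [Ad_inl, toMat_differential_conj]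
    rfl
  have := eventually_exists_conj_exp (E := (φ.weightSpace 0).map (toMat D.dual))
    (V := (φ.weightSpace 1).map (toMat D.dual)) ⟨z, hz, rfl⟩
    (by
      rintro _ ⟨E, hE, rfl⟩
      exact ⟨_, φ.Ad_inl_mem_weightSpace (φ.expG_mem_centralizer hE) hz, (hconj E).symm⟩)
    (by
      rintro _ ⟨u, hu, rfl⟩
      -- The sign appears because the derivative of the orbit map is `[x, z] = -[z, x]`.
      obtain ⟨x, hx, hxu⟩ := hsurj (-u) (neg_mem hu)
      refine ⟨_, ⟨x, hx, rfl⟩, ?_⟩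
      rw [← neg_sub, ← toMat_adjoint, hxu, map_neg, neg_neg])
    ⟨v, hv, rfl⟩
  filter_upwards [this] with t ht
  obtain ⟨_, ⟨E, hE, rfl⟩, h⟩ := ht
  refine ⟨_, φ.expG_mem_centralizer hE, toMat_injective ?_⟩
  rw [← hconj E, h, map_add, map_smul]

/-- The pairing `𝔤_1 × 𝔤_0 → 𝔤_1` given by the Lie bracket. -/
def bracketOne : φ.weightSpace 1 →ₗ[ℂ] φ.weightSpace 0 →ₗ[ℂ] φ.weightSpace 1 :=
  LinearMap.mk₂ ℂ (fun z x => ⟨adjoint z.1 x.1, φ.adjoint_mem_weightSpace z.2 x.2⟩)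
    (fun z z' x => Subtype.ext (by
      change adjoint (z.1 + z'.1) x.1 = adjoint z.1 x.1 + adjoint z'.1 x.1
      rw [adjoint_comm, map_add, neg_add, ← adjoint_comm, ← adjoint_comm]))
    (fun c z x => Subtype.ext (adjoint_smul c z.1 x.1))
    (fun z x x' => Subtype.ext (map_add _ _ _))
    (fun c z x => Subtype.ext (map_smul _ _ _))

lemma bracketOne_surjective_iff (z : φ.weightSpace 1) :
    Function.Surjective (φ.bracketOne z) ↔
      ∀ v ∈ φ.weightSpace 1, ∃ x ∈ φ.weightSpace 0, adjoint z.1 x = v :=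
  ⟨fun h v hv => (h ⟨v, hv⟩).elim fun x hx => ⟨x.1, x.2, congrArg Subtype.val hx⟩,
    fun h v => (h v.1 v.2).elim fun x hx => ⟨⟨x, hx.1⟩, Subtype.ext hx.2⟩⟩

/-- The orbit of a point `z` such that `ad z : 𝔤_0 → 𝔤_1` is surjective is Zariski open. -/
lemma isZariskiOpen_orbit_weightSpace (z : φ.weightSpace 1)
    (hz : Function.Surjective (φ.bracketOne z)) :
    IsZariskiOpen {x : φ.weightSpace 1 | ∃ h ∈ centralizer φ.infinitesimal,
      x.1 = Ad D (SemidirectProduct.inl h) z.1} := by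
  -- Surjectivity of `ad x` is a Zariski open condition: some `det (ad x ∘ j)` is nonzero, with `j`
  -- a right inverse for one direction.
  let S : Set (φ.weightSpace 1 → ℂ) := Set.range fun (j : φ.weightSpace 1 →ₗ[ℂ] φ.weightSpace 0)
    (x : φ.weightSpace 1) => LinearMap.det (φ.bracketOne x ∘ₗ j)
  have hS : S ⊆ (polyFun (φ.weightSpace 1) : Set (φ.weightSpace 1 → ℂ)) := by
    rintro _ ⟨j, rfl⟩
    exact det_mem_polyFun (LinearMap.lcomp ℂ _ j ∘ₗ φ.bracketOne)
  have hSU : ∀ x : φ.weightSpace 1,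
      (∃ f ∈ S, f x ≠ 0) ↔ Function.Surjective (φ.bracketOne x) := by
    refine fun x => ⟨?_, fun h => ?_⟩
    · rintro ⟨_, ⟨j, rfl⟩, hj⟩
      have h2 : Function.Surjective (φ.bracketOne x ∘ₗ j) :=
        ((Module.End.isUnit_iff _).1 ((LinearMap.isUnit_iff_isUnit_det _).2
          (isUnit_iff_ne_zero.2 hj))).2
      exact Function.Surjective.of_comp (f := φ.bracketOne x) (g := j) h2
    · obtain ⟨j, hj⟩ := (φ.bracketOne x).exists_rightInverse_of_surjective
        (LinearMap.range_eq_top.2 h)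
      refine ⟨_, ⟨j, rfl⟩, ?_⟩
      simp [hj]
  refine ⟨S, hS, Set.ext fun y => ⟨?_, fun hy => ?_⟩⟩
  · rintro ⟨h, hh, hy⟩
    refine (hSU y).2 ((φ.bracketOne_surjective_iff y).2 fun v hv => ?_)
    obtain ⟨x, hx, hxv⟩ := (φ.bracketOne_surjective_iff z).1 hz _
      (φ.Ad_inl_mem_weightSpace (inv_mem hh) hv)
    refine ⟨_, φ.Ad_inl_mem_weightSpace hh hx, ?_⟩
    rw [hy, ← Ad_adjoint, hxv, Ad_inl_inv]
  -- Being in the same orbit is an equivalence relation, locally constant on the connected set of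
  -- good points of the line from `z` to `y`.
  · have hconn := isPreconnected_line hS ((hSU z).2 hz) hy
    have hP := hconn.induction₂ (fun s t : ℂ => ∃ h ∈ centralizer φ.infinitesimal,
        (z + t • (y - z)).1 = Ad D (SemidirectProduct.inl h) (z + s • (y - z)).1)
      (fun s hs => ?_) (fun r s t _ _ _ => ?_) (fun s t _ _ => ?_)
      (show (0 : ℂ) ∈ _ by simpa using (hSU z).2 hz) (show (1 : ℂ) ∈ _ by simpa using hy)
    · simpa using hP
    · have := φ.eventually_mem_orbit (z + s • (y - z)).2
        ((φ.bracketOne_surjective_iff _).1 ((hSU _).1 hs)) (y - z).2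
      have h2 : Filter.Tendsto (fun t : ℂ => t - s) (nhds s) (nhds 0) := by
        have : Continuous fun t : ℂ => t - s := by fun_prop
        simpa using this.tendsto s
      refine (h2.eventually this).filter_mono nhdsWithin_le_nhds |>.mono ?_
      rintro t ⟨h, hh, ht⟩
      refine ⟨h, hh, ?_⟩
      rw [← ht, ← Submodule.coe_smul, ← Submodule.coe_add, sub_smul]
      congr 1
      abel
    · rintro ⟨h, hh, e⟩ ⟨h', hh', e'⟩
      exact ⟨h' * h, mul_mem hh' hh, by rw [e', e, map_mul, Ad_mul]⟩
    · rintro ⟨h, hh, e⟩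
      refine ⟨h⁻¹, inv_mem hh, ?_⟩
      rw [e]
      have := Ad_inl_inv h⁻¹ (z + s • (y - z)).1
      rw [inv_inv] at this
      exact this.symm

end LParameter

end Orbit

/-! ## Generic smoothness -/

section GenericSmoothness

open TensorProduct

/-- Derivations of a polynomial ring extend to finitely generated field extensions. -/
lemma exists_derivation_extension {d : ℕ} {L : Type*} [Field L] [Algebra ℂ L]
    [Algebra.EssFiniteType ℂ L] (θ : MvPolynomial (Fin d) ℂ →ₐ[ℂ] L) (hθ : Function.Injective θ)
    (k : Fin d) :
    ∃ δ : Derivation ℂ L L, ∀ i, δ (θ (MvPolynomial.X i)) = if i = k then 1 else 0 := by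
  let P := MvPolynomial (Fin d) ℂ
  let : Algebra P L := θ.toRingHom.toAlgebra
  have : IsScalarTower ℂ P L := IsScalarTower.of_algHom θ
  have : FaithfulSMul P L := (faithfulSMul_iff_algebraMap_injective P L).2 hθ
  let K := FractionRing P
  let : Algebra K L := FractionRing.liftAlgebra P L
  have : IsScalarTower P K L := FractionRing.isScalarTower_liftAlgebra P L
  have : IsScalarTower ℂ K L := by
    refine IsScalarTower.of_algebraMap_eq fun x => ?_
    rw [IsScalarTower.algebraMap_apply ℂ P L, IsScalarTower.algebraMap_apply P K L,
      ← IsScalarTower.algebraMap_apply ℂ P K]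
  have : CharZero K := charZero_of_injective_algebraMap (algebraMap ℂ K).injective
  have : Algebra.EssFiniteType K L := Algebra.EssFiniteType.of_comp ℂ K L
  -- `L` is formally smooth over `K` in characteristic zero, and `K` is a localization of `P`. Hence
  -- `L` is formally smooth over `P`, and the differentials of `P` inject into those of `L` after
  -- base change.
  have : Algebra.FormallySmooth P K :=
    Algebra.FormallySmooth.of_isLocalization (nonZeroDivisors P)
  have : Algebra.FormallySmooth P L := Algebra.FormallySmooth.comp P K L
  have hinj : Function.Injective (KaehlerDifferential.mapBaseChange ℂ P L) := by
    rw [injective_iff_map_eq_zero]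
    intro x hx
    obtain ⟨x, rfl⟩ := (Algebra.H1Cotangent.exact_δ_mapBaseChange ℂ P L x).mp hx
    rw [Subsingleton.elim x 0, map_zero]
  obtain ⟨r, hr⟩ := (KaehlerDifferential.mapBaseChange ℂ P L).exists_leftInverse_of_injective
    (LinearMap.ker_eq_bot.2 hinj)
  -- The `L`-linear extension of the partial derivative `∂ / ∂ X_k`; the retraction `r` transports
  -- it to the differentials of `L`.
  let ψ : L ⊗[P] Ω[P⁄ℂ] →ₗ[L] L := TensorProduct.AlgebraTensorModule.lift
    (LinearMap.toSpanSingleton L _ ((Algebra.linearMap P L) ∘ₗ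
      (MvPolynomial.pderiv k : Derivation ℂ P P).liftKaehlerDifferential))
  refine ⟨(ψ ∘ₗ r).compDer (KaehlerDifferential.D ℂ L), fun i => ?_⟩
  have h1 : KaehlerDifferential.D ℂ L (θ (MvPolynomial.X i)) =
      KaehlerDifferential.mapBaseChange ℂ P L
        (1 ⊗ₜ KaehlerDifferential.D ℂ P (MvPolynomial.X i)) := by
    rw [KaehlerDifferential.mapBaseChange_tmul, KaehlerDifferential.map_D, one_smul]
    rfl
  change ψ (r (KaehlerDifferential.D ℂ L (θ (MvPolynomial.X i)))) = _
  have h2 := LinearMap.congr_fun hr (1 ⊗ₜ KaehlerDifferential.D ℂ P (MvPolynomial.X i))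
  rw [h1]
  change r _ = _ at h2
  rw [h2]
  change (1 : L) • algebraMap P L ((MvPolynomial.pderiv k).liftKaehlerDifferential
    (KaehlerDifferential.D ℂ P (MvPolynomial.X i))) = _
  rw [Derivation.liftKaehlerDifferential_comp_D, MvPolynomial.pderiv_X, one_smul]
  by_cases h : i = k
  · subst h; simp
  · simp [h]

/-- A finitely generated complex domain has a point at which a given nonzero element does not
vanish. -/
lemma exists_algHom_apply_ne_zero {B : Type*} [CommRing B] [IsDomain B] [Algebra ℂ B]
    [Algebra.FiniteType ℂ B] {s : B} (hs : s ≠ 0) : ∃ χ : B →ₐ[ℂ] ℂ, χ s ≠ 0 := by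
  have : IsJacobsonRing B := isJacobsonRing_of_finiteType (A := ℂ)
  -- Nullstellensatz: some maximal ideal avoids `s`, and its residue field is finite over `ℂ`, so it
  -- maps to `ℂ`.
  have hj : (⊥ : Ideal B).jacobson = ⊥ := IsJacobsonRing.out' _ Ideal.isRadical_bot
  have hs' : s ∉ (⊥ : Ideal B).jacobson := by rwa [hj, Ideal.mem_bot]
  rw [Ideal.jacobson, Submodule.mem_sInf] at hs'
  push Not at hs'
  obtain ⟨M, ⟨-, hM⟩, hsM⟩ := hs'
  let := Ideal.Quotient.field M
  have : Module.Finite ℂ (B ⧸ M) := finite_of_finite_type_of_isJacobsonRing ℂ (B ⧸ M)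
  let e : B ⧸ M →ₐ[ℂ] ℂ := IsAlgClosed.lift
  refine ⟨e.comp (Ideal.Quotient.mkₐ ℂ M), fun h => hsM ?_⟩
  rw [← Ideal.Quotient.eq_zero_iff_mem]
  exact e.toRingHom.injective (h.trans (map_zero _).symm)

/-- Generic smoothness: if the functions `f i` on the closed subscheme defined by `I` are
algebraically independent, then at some closed point their differentials are linearly
independent. -/
lemma exists_point_of_algebraicIndependent {A : Type*} [CommRing A] [Algebra ℂ A]
    [Algebra.FiniteType ℂ A] (I : Ideal A) {d : ℕ} (f : Fin d → A)
    (hf : ∀ p : MvPolynomial (Fin d) ℂ, MvPolynomial.aeval f p ∈ I → p = 0) :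
    ∃ χ : A →ₐ[ℂ] ℂ, (∀ a ∈ I, χ a = 0) ∧ ∃ c : ℂ, c ≠ 0 ∧ ∀ k, ∃ D : A →ₗ[ℂ] ℂ,
      (∀ a b, D (a * b) = χ a * D b + χ b * D a) ∧ (∀ a ∈ I, D a = 0) ∧
      ∀ i, D (f i) = if i = k then c else 0 := by
  let θ : MvPolynomial (Fin d) ℂ →ₐ[ℂ] A := MvPolynomial.aeval f
  have hdisj : Disjoint (I : Set A) ((nonZeroDivisors (MvPolynomial (Fin d) ℂ)).map θ) := by
    rw [Set.disjoint_left]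
    rintro _ ha ⟨p, hp, rfl⟩
    exact nonZeroDivisors.ne_zero hp (hf p ha)
  -- Passing to the component defined by `𝔭` keeps the `f i` algebraically independent.
  obtain ⟨𝔭, h𝔭, hI, hd⟩ := Ideal.exists_le_prime_disjoint _ _ hdisj
  let B := A ⧸ 𝔭
  let L := FractionRing B
  let q : A →ₐ[ℂ] B := Ideal.Quotient.mkₐ ℂ 𝔭
  let j : B →ₐ[ℂ] L := IsScalarTower.toAlgHom ℂ B L
  have hj : Function.Injective j := IsFractionRing.injective B L
  have hθ : Function.Injective ((j.comp q).comp θ) := by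
    rw [injective_iff_map_eq_zero]
    intro p hp
    by_contra hp0
    have h1 : q (θ p) = 0 := hj (hp.trans (map_zero _).symm)
    exact Set.disjoint_left.1 hd (Ideal.Quotient.eq_zero_iff_mem.1 h1)
      ⟨p, mem_nonZeroDivisors_of_ne_zero hp0, rfl⟩
  have : Algebra.EssFiniteType ℂ L :=
    have : Algebra.EssFiniteType B L := .of_isLocalization L (nonZeroDivisors B)
    Algebra.EssFiniteType.comp ℂ B L
  choose δ hδ using exists_derivation_extension ((j.comp q).comp θ) hθ
  obtain ⟨T, hT⟩ := (inferInstance : Algebra.FiniteType ℂ A).out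
  classical
  -- Since `A` is finitely generated, one denominator `s` makes every `s * δ k` take values in `B`.
  -- The point `χ` is chosen with `χ s ≠ 0`, and this value is the constant `c`.
  obtain ⟨s, hs⟩ := IsLocalization.exist_integer_multiples_of_finset (nonZeroDivisors B)
    (Finset.univ.biUnion fun k => T.image fun a => δ k (j (q a)))
  have hs0 : s.1 ≠ 0 := nonZeroDivisors.ne_zero s.2
  have hint : ∀ k a, ∃ b : B, j b = j s.1 * δ k (j (q a)) := by
    intro k a
    have ha : a ∈ Algebra.adjoin ℂ (T : Set A) := hT ▸ Algebra.mem_top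
    induction ha using Algebra.adjoin_induction with
    | mem a ha =>
      obtain ⟨b, hb⟩ := hs (δ k (j (q a))) (Finset.mem_biUnion.2
        ⟨k, Finset.mem_univ _, Finset.mem_image_of_mem _ ha⟩)
      exact ⟨b, hb.trans (Algebra.smul_def _ _)⟩
    | algebraMap r =>
      refine ⟨0, ?_⟩
      rw [AlgHom.commutes, AlgHom.commutes, Derivation.map_algebraMap, map_zero, mul_zero]
    | add a b _ _ ha hb =>
      obtain ⟨x, hx⟩ := ha
      obtain ⟨y, hy⟩ := hb
      exact ⟨x + y, by simp only [map_add, hx, hy, mul_add]⟩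
    | mul a b _ _ ha hb =>
      obtain ⟨x, hx⟩ := ha
      obtain ⟨y, hy⟩ := hb
      refine ⟨q a * y + q b * x, ?_⟩
      simp only [map_mul, map_add, hx, hy, Derivation.leibniz, smul_eq_mul]
      ring
  choose β hβ using hint
  obtain ⟨χ, hχ⟩ := exists_algHom_apply_ne_zero hs0
  refine ⟨χ.comp q, fun a ha => ?_, χ s.1, hχ, fun k => ⟨
    { toFun := fun a => χ (β k a)
      map_add' := fun a b => ?_
      map_smul' := fun c a => ?_ }, fun a b => ?_, fun a ha => ?_, fun i => ?_⟩⟩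
  · have : q a = 0 := Ideal.Quotient.eq_zero_iff_mem.2 (hI ha)
    rw [AlgHom.comp_apply, this, map_zero]
  · rw [← map_add]
    congr 1
    apply hj
    simp only [map_add, hβ, mul_add]
  · rw [RingHom.id_apply, ← map_smul]
    congr 1
    apply hj
    rw [map_smul, hβ, hβ, map_smul, map_smul, Derivation.map_smul, mul_smul_comm]
  · change χ (β k (a * b)) = χ (q a) * χ (β k b) + χ (q b) * χ (β k a)
    rw [← map_mul, ← map_mul, ← map_add]
    congr 1
    apply hj
    simp only [map_mul, map_add, hβ, Derivation.leibniz, smul_eq_mul]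
    ring
  · change χ (β k a) = 0
    have : q a = 0 := Ideal.Quotient.eq_zero_iff_mem.2 (hI ha)
    have h2 : β k a = 0 := hj (by rw [hβ, this, map_zero, map_zero, mul_zero])
    rw [h2, map_zero]
  · change χ (β k (f i)) = _
    have h1 : f i = θ (MvPolynomial.X i) := (MvPolynomial.aeval_X f i).symm
    have h2 : β k (f i) = if i = k then s.1 else 0 := by
      apply hj
      rw [hβ, h1]
      have := hδ k i
      change δ k (j (q (θ (MvPolynomial.X i)))) = _ at this
      rw [this]
      split_ifs <;> simp
    rw [h2]
    split_ifs <;> simp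

end GenericSmoothness

/-! ## Points of the coordinate ring -/

section Points

variable {n : ℕ} {G : Subgroup (GL (Fin n) ℂ)}

instance : Algebra.FiniteType ℂ (coordRing G) :=
  (coordRing G).fg_iff_finiteType.1 (Subalgebra.fg_def.2
    ⟨_, (Set.finite_range _).union (Set.finite_range _), rfl⟩)

/-- The points of the coordinate ring of a Zariski closed group are the elements of the group. -/
lemma exists_eq_eval (hG : IsZariskiClosed (G : Set (GL (Fin n) ℂ))) (χ : coordRing G →ₐ[ℂ] ℂ) :
    ∃ g : G, ∀ f, χ f = f.1 g := by
  have h1 : (Matrix.of fun i j => χ (entryFun G i j)) *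
      (Matrix.of fun i j => χ (invEntryFun G i j)) = 1 := by
    ext i j
    have := congrArg χ (entry_mul_invEntry (G := G) i j)
    rw [AlgHom.commutes, map_sum] at this
    simp only [map_mul] at this
    exact this
  let g : GL (Fin n) ℂ := ⟨_, _, h1, mul_eq_one_comm.1 h1⟩
  have h2 : ∀ f, polyEval g f = χ (polyRestrict G f) := by
    intro f
    have : (MvPolynomial.aeval fun p : Fin n × Fin n => g.1 p.1 p.2) =
        χ.comp (polyRestrict G) := by
      refine MvPolynomial.algHom_ext fun p => ?_
      rw [MvPolynomial.aeval_X, AlgHom.comp_apply, polyRestrict, MvPolynomial.aeval_X]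
      rfl
    have h := DFunLike.congr_fun this f
    rw [MvPolynomial.aeval_eq_eval] at h
    exact h
  have hg : g ∈ G := mem_of_forall_polyEval_eq_zero hG fun f hf => by rw [h2, hf, map_zero]
  refine ⟨⟨g, hg⟩, fun f => ?_⟩
  induction f using coordRing_induction with
  | he i j => rfl
  | hi i j => rfl
  | hc c => rw [AlgHom.commutes]; rfl
  | hadd f g hf hg => rw [map_add, hf, hg]; rfl
  | hmul f g hf hg => rw [map_mul, hf, hg]; rfl

variable (G) in
/-- The regular function `g ↦ ℓ (g * M * g⁻¹)`. -/
def conjFun (M : Matrix (Fin n) (Fin n) ℂ) (l : Matrix (Fin n) (Fin n) ℂ →ₗ[ℂ] ℂ) : coordRing G :=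
  ∑ i, ∑ j, l (Matrix.single i j 1) •
    ∑ b, (∑ a, M a b • entryFun G i a) * invEntryFun G b j

lemma apply_eq_sum (l : Matrix (Fin n) (Fin n) ℂ →ₗ[ℂ] ℂ) (A : Matrix (Fin n) (Fin n) ℂ) :
    l A = ∑ i, ∑ j, l (Matrix.single i j 1) * A i j := by
  conv_lhs => rw [Matrix.matrix_eq_sum_single A]
  simp only [map_sum]
  refine Finset.sum_congr rfl fun i _ => Finset.sum_congr rfl fun j _ => ?_
  rw [mul_comm, ← smul_eq_mul, ← map_smul, Matrix.smul_single, smul_eq_mul, mul_one]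

lemma conjFun_apply (M : Matrix (Fin n) (Fin n) ℂ) (l : Matrix (Fin n) (Fin n) ℂ →ₗ[ℂ] ℂ) (g : G) :
    (conjFun G M l).1 g = l (g.1.1 * M * (g.1⁻¹ : GL (Fin n) ℂ).1) := by
  let ev : coordRing G →ₐ[ℂ] ℂ := (Pi.evalAlgHom ℂ _ g).comp (coordRing G).val
  change ev (conjFun G M l) = _
  rw [apply_eq_sum, conjFun, map_sum]
  refine Finset.sum_congr rfl fun i _ => ?_
  rw [map_sum]
  refine Finset.sum_congr rfl fun j _ => ?_
  rw [map_smul, smul_eq_mul, map_sum, Matrix.mul_apply]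
  congr 1
  refine Finset.sum_congr rfl fun b _ => ?_
  rw [map_mul, map_sum, Matrix.mul_apply]
  congr 1
  refine Finset.sum_congr rfl fun a _ => ?_
  rw [map_smul, smul_eq_mul, mul_comm]
  rfl

/-- The product rule for `g * M * g⁻¹` at the identity. -/
lemma LieAlg.apply_conjFun (E : LieAlg G) (M : Matrix (Fin n) (Fin n) ℂ)
    (l : Matrix (Fin n) (Fin n) ℂ →ₗ[ℂ] ℂ) :
    E.1 (conjFun G M l) = l (toMat G E * M - M * toMat G E) := by
  have hval : ∀ i b, (∑ a, M a b • entryFun G i a).1 1 = M i b := by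
    intro i b
    rw [AddSubmonoidClass.coe_finsetSum, Finset.sum_apply]
    change ∑ a, M a b * (1 : Matrix (Fin n) (Fin n) ℂ) i a = _
    simp [Matrix.one_apply]
  rw [apply_eq_sum, conjFun, map_sum]
  refine Finset.sum_congr rfl fun i _ => ?_
  rw [map_sum]
  refine Finset.sum_congr rfl fun j _ => ?_
  rw [map_smul, smul_eq_mul, map_sum]
  congr 1
  simp only [LieAlg.apply_mul, hval, invEntryFun_one, LieAlg.apply_invEntry, map_sum, map_smul,
    smul_eq_mul, Finset.sum_add_distrib, Matrix.sub_apply, Matrix.mul_apply, toMat_apply]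
  rw [add_comm, sub_eq_add_neg, ← Finset.sum_neg_distrib]
  congr 1
  · simp [Matrix.one_apply, mul_comm]
  · exact Finset.sum_congr rfl fun b _ => by ring

/-- Translation by `g` only changes the linear form, so a derivative at `g` becomes one at the
identity. -/
lemma translate_conjFun (M : Matrix (Fin n) (Fin n) ℂ) (l : Matrix (Fin n) (Fin n) ℂ →ₗ[ℂ] ℂ)
    (g : G) : translate (conjFun G M l) g = conjFun G M
      (l ∘ₗ LinearMap.mulLeftRight ℂ (g.1.1, (g.1⁻¹ : GL (Fin n) ℂ).1)) := by
  refine Subtype.ext (funext fun x => ?_)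
  rw [conjFun_apply]
  change (conjFun G M l).1 (g * x) = _
  rw [conjFun_apply]
  change _ = l (g.1.1 * (x.1.1 * M * (x.1⁻¹ : GL (Fin n) ℂ).1) * (g.1⁻¹ : GL (Fin n) ℂ).1)
  have : ((g * x).1⁻¹ : GL (Fin n) ℂ).1 =
      (x.1⁻¹ : GL (Fin n) ℂ).1 * (g.1⁻¹ : GL (Fin n) ℂ).1 := by
    rw [← Units.val_mul, ← mul_inv_rev]
    rfl
  rw [this, Subgroup.coe_mul, Units.val_mul]
  simp only [mul_assoc]

/-- A derivation at a point of the group comes from an element of the Lie algebra by translation. -/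
lemma exists_lieAlg_of_derivation {g : G} {D : coordRing G →ₗ[ℂ] ℂ}
    (hD : ∀ a b : coordRing G, D (a * b) = a.1 g * D b + b.1 g * D a) :
    ∃ E : LieAlg G, (∀ f, E.1 f = D (translate f g⁻¹)) ∧ ∀ f, D f = E.1 (translate f g) := by
  have h1 : ∀ f : coordRing G, (translate f g⁻¹).1 g = f.1 1 := fun f =>
    congrArg f.1 (inv_mul_cancel g)
  refine ⟨LieAlg.mk
    { toFun := fun f => D (translate f g⁻¹)
      map_add' := fun a b => D.map_add (translate a g⁻¹) (translate b g⁻¹)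
      map_smul' := fun c a => D.map_smul c (translate a g⁻¹) } fun a b => ?_,
    fun f => rfl, fun f => ?_⟩
  · have := hD (translate a g⁻¹) (translate b g⁻¹)
    rw [h1, h1] at this
    exact this
  · refine congrArg D (Subtype.ext (funext fun x => ?_))
    exact congrArg f.1 (mul_inv_cancel_left g x).symm

end Points

/-! ## Surjectivity of the tangent map, if the orbit is open -/

section OpenOrbit

/-- Polynomial functions are polynomials in the coordinates. -/
lemma exists_mvPolynomial_of_mem_polyFun {V : Type*} [AddCommGroup V] [Module ℂ V] {d : ℕ}
    (b : Module.Basis (Fin d) ℂ V) {f : V → ℂ} (hf : f ∈ polyFun V) :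
    ∃ p : MvPolynomial (Fin d) ℂ, ∀ x, f x = MvPolynomial.eval (b.repr x) p := by
  induction hf using Algebra.adjoin_induction with
  | mem f hf =>
    obtain ⟨l, rfl⟩ := hf
    refine ⟨∑ i, MvPolynomial.C (l (b i)) * MvPolynomial.X i, fun x => ?_⟩
    conv_lhs => rw [← b.sum_repr x]
    simp only [map_sum, map_smul, smul_eq_mul, map_mul, MvPolynomial.eval_C, MvPolynomial.eval_X,
      mul_comm]
  | algebraMap r => exact ⟨MvPolynomial.C r, fun x => by simp⟩
  | add f g _ _ hf hg =>
    obtain ⟨p, hp⟩ := hf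
    obtain ⟨q, hq⟩ := hg
    exact ⟨p + q, fun t => by simp [hp, hq]⟩
  | mul f g _ _ hf hg =>
    obtain ⟨p, hp⟩ := hf
    obtain ⟨q, hq⟩ := hg
    exact ⟨p * q, fun t => by simp [hp, hq]⟩

variable {F : Type*} [Field F] [ValuativeRel F] [TopologicalSpace F]
  [IsNonarchimedeanLocalField F]

namespace LParameter

variable {D : LGroupData F} (φ : LParameter D)

lemma adInf_eq_differential (w : WeilGroup F) :
    φ.adInf w = differential D.dual (conjAction D (φ.infinitesimal w)) := rfl

/-- If the orbit of `N` is Zariski open, then `ad N : 𝔤_0 → 𝔤_1` is surjective. -/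
lemma adjoint_surjective_of_isZariskiOpen
    (h : IsZariskiOpen {x : φ.weightSpace 1 | ∃ h ∈ centralizer φ.infinitesimal,
      x.1 = Ad D (SemidirectProduct.inl h) φ.nilp}) :
    ∀ v ∈ φ.weightSpace 1, ∃ x ∈ φ.weightSpace 0, adjoint φ.nilp x = v := by
  obtain ⟨S, hS, hSU⟩ := h
  let b := Module.finBasis ℂ (φ.weightSpace 1)
  let M := toMat D.dual φ.nilp
  obtain ⟨ρ, hρ⟩ := (toMat D.dual ∘ₗ (φ.weightSpace 1).subtype).exists_leftInverse_of_injective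
    (LinearMap.ker_eq_bot.2 (toMat_injective.comp Subtype.val_injective))
  have hρ' : ∀ x (hx : x ∈ φ.weightSpace 1), ρ (toMat D.dual x) = ⟨x, hx⟩ := fun x hx =>
    LinearMap.congr_fun hρ ⟨x, hx⟩
  -- The coordinates of the orbit map, extended from the centralizer to the whole group by means of
  -- the retraction `ρ`.
  let f := fun i => conjFun D.dual M (b.coord i ∘ₗ ρ)
  have hf : ∀ i, ∀ g ∈ centralizer φ.infinitesimal, ∀ x : φ.weightSpace 1,
      x.1 = Ad D (SemidirectProduct.inl g) φ.nilp → (f i).1 g = b.repr x i := by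
    intro i g _ x hx
    rw [conjFun_apply, ← toMat_differential_conj, ← Ad_inl, ← hx, LinearMap.comp_apply,
      hρ' x.1 x.2]
    rfl
  let I : Ideal (coordRing D.dual) :=
    { carrier := {f | ∀ g ∈ centralizer φ.infinitesimal, f.1 g = 0}
      zero_mem' := fun g _ => rfl
      add_mem' := fun {a c} ha hc g hg => by
        change a.1 g + c.1 g = 0
        rw [ha g hg, hc g hg, add_zero]
      smul_mem' := fun c a ha g hg => by
        change c.1 g * a.1 g = 0
        rw [ha g hg, mul_zero] }
  have halg : ∀ p : MvPolynomial _ ℂ, MvPolynomial.aeval f p ∈ I → p = 0 := by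
    intro p hp
    have hmem : (⟨φ.nilp, φ.nilp_mem⟩ : φ.weightSpace 1) ∈ {v | ∃ f ∈ S, f v ≠ 0} := by
      rw [← hSU]
      exact ⟨1, one_mem _, by rw [map_one, map_one]; rfl⟩
    obtain ⟨u, hu, huN⟩ := hmem
    obtain ⟨r, hr⟩ := exists_mvPolynomial_of_mem_polyFun b (hS hu)
    have hr0 : r ≠ 0 := by
      rintro rfl
      exact huN (by rw [hr, map_zero])
    refine (mul_eq_zero.1 ?_).resolve_right hr0
    -- Where `u ≠ 0` the point lies in the orbit, and there `p` vanishes because `p (f) ∈ I`. So `p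
    -- * r` vanishes everywhere.
    refine MvPolynomial.funext fun c => ?_
    obtain ⟨x, hx⟩ : ∃ x, ⇑(b.repr x) = c :=
      ⟨b.equivFun.symm c, b.equivFun.apply_symm_apply c⟩
    rw [map_zero, map_mul, ← hx, ← hr]
    by_cases hux : u x = 0
    · rw [hux, mul_zero]
    obtain ⟨g, hg, hxg⟩ : x ∈ {x : φ.weightSpace 1 | ∃ h ∈ centralizer φ.infinitesimal,
      x.1 = Ad D (SemidirectProduct.inl h) φ.nilp} := hSU ▸ ⟨u, hu, hux⟩
    have h1 := hp g hg
    let ev : coordRing D.dual →ₐ[ℂ] ℂ := (Pi.evalAlgHom ℂ _ g).comp (coordRing D.dual).val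
    change ev (MvPolynomial.aeval f p) = 0 at h1
    rw [← AlgHom.comp_apply, MvPolynomial.comp_aeval, MvPolynomial.aeval_eq_eval] at h1
    have h2 : (fun i => ev (f i)) = b.repr x := funext fun i => hf i g hg x hxg
    rw [h2] at h1
    rw [show MvPolynomial.eval (b.repr x) p = 0 from h1, zero_mul]
  obtain ⟨χ, hχ, c, hc, hD⟩ := exists_point_of_algebraicIndependent I f halg
  obtain ⟨g, hg⟩ := exists_eq_eval D.reductive.closed χ
  -- `I` contains the equations of the centralizer. Hence a point annihilating `I` lies in the
  -- centralizer, and a derivation annihilating `I` becomes an element of `𝔤_0` after translation to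
  -- the identity.
  have hpull : ∀ w (a : coordRing D.dual),
      pullback (conjAction D (φ.infinitesimal w)) a - a ∈ I := fun w a h hh => by
    change a.1 ((conjAction D (φ.infinitesimal w)).1 h) - a.1 h = 0
    rw [mem_centralizer_iff.1 hh w, sub_self]
  have hgH : g ∈ centralizer φ.infinitesimal := mem_centralizer_iff.2 fun w =>
    coordRing_separates fun a => by
      have := hχ _ (hpull w a)
      rw [hg] at this
      exact sub_eq_zero.1 this
  have hE : ∀ k, ∃ E ∈ φ.weightSpace 0,
      Ad D (SemidirectProduct.inl g) (adjoint φ.nilp E) = -(c • (b k).1) := by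
    intro k
    obtain ⟨δ, hmul, hI, hδ⟩ := hD k
    simp only [hg] at hmul
    obtain ⟨E, hE1, hE2⟩ := exists_lieAlg_of_derivation hmul
    have hE0 : E ∈ φ.weightSpace 0 := by
      refine φ.mem_weightSpace_zero.2 fun w => LieAlg.ext fun a => ?_
      rw [adInf_eq_differential, differential_apply, ← sub_eq_zero, ← map_sub, hE1]
      exact hI _ fun h hh => hpull w a _ (mul_mem (inv_mem hgH) hh)
    have hmem : Ad D (SemidirectProduct.inl g) (adjoint φ.nilp E) ∈ φ.weightSpace 1 :=
      φ.Ad_inl_mem_weightSpace hgH (φ.adjoint_mem_weightSpace φ.nilp_mem hE0)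
    refine ⟨E, hE0, ?_⟩
    suffices h : (⟨_, hmem⟩ : φ.weightSpace 1) = -(c • b k) from congrArg Subtype.val h
    refine b.repr.injective (Finsupp.ext fun i => ?_)
    have h1 := hδ i
    -- The differential of the orbit map at `g` is `E ↦ Ad (g) [E, N]`.
    rw [hE2, translate_conjFun, LieAlg.apply_conjFun] at h1
    change b.coord i (ρ (g.1.1 * (toMat D.dual E * M - M * toMat D.dual E) *
      (g.1⁻¹ : GL (Fin D.n) ℂ).1)) = _ at h1
    rw [← toMat_adjoint, ← toMat_differential_conj, ← Ad_inl, adjoint_comm, map_neg, map_neg,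
      map_neg, hρ' _ hmem, map_neg, neg_eq_iff_eq_neg] at h1
    change b.coord i _ = _
    rw [h1]
    simp [Finsupp.single_apply, eq_comm]
  choose E hE0 hE1 using hE
  intro v hv
  have hv' := φ.Ad_inl_mem_weightSpace hgH hv
  let a := b.repr ⟨_, hv'⟩
  -- The coefficients undo the factor `-c` in `hE1`, after expanding `Ad (g) v` in the basis `b`.
  refine ⟨∑ k, (-(a k) / c) • E k, sum_mem fun k _ => Submodule.smul_mem _ _ (hE0 k), ?_⟩
  have hinj : Function.Injective (Ad D (SemidirectProduct.inl g)) := by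
    refine Function.LeftInverse.injective (g := Ad D (SemidirectProduct.inl g⁻¹)) fun x => ?_
    have := Ad_inl_inv g⁻¹ x
    rwa [inv_inv] at this
  apply hinj
  have hsum := congrArg Subtype.val (b.sum_repr ⟨_, hv'⟩)
  rw [Submodule.coe_sum] at hsum
  rw [map_sum, map_sum]
  refine Eq.trans ?_ hsum
  refine Finset.sum_congr rfl fun k _ => ?_
  rw [map_smul, map_smul, hE1, smul_neg, smul_smul, div_mul_cancel₀ _ hc, neg_smul, neg_neg]
  rfl

lemma isOpenParameter_iff : φ.IsOpenParameter ↔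
    ∀ v ∈ φ.weightSpace 1, ∃ x ∈ φ.weightSpace 0, adjoint φ.nilp x = v := by
  have e : voganVariety φ.infinitesimal = φ.weightSpace 1 :=
    Submodule.ext fun x => φ.mem_voganVariety
  have h : φ.IsOpenParameter ↔ IsZariskiOpen {x : φ.weightSpace 1 |
      ∃ h ∈ centralizer φ.infinitesimal, x.1 = Ad D (SemidirectProduct.inl h) φ.nilp} := by
    rw [← e]
    rfl
  rw [h]
  refine ⟨φ.adjoint_surjective_of_isZariskiOpen, fun hs => ?_⟩
  exact φ.isZariskiOpen_orbit_weightSpace ⟨φ.nilp, φ.nilp_mem⟩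
    ((φ.bracketOne_surjective_iff _).2 hs)

end LParameter

end OpenOrbit

/-! ## The L-factor -/

section LFactor

/-- The function `s ↦ det (1 - q ^ (-s) T)⁻¹` is regular at the points where the determinant does
not vanish, and only there. -/
lemma analyticAt_inv_det_iff {W : Type*} [AddCommGroup W] [Module ℂ W] [FiniteDimensional ℂ W]
    (T : Module.End ℂ W) {q : ℕ} (hq : 1 < q) (s₀ : ℂ) :
    AnalyticAt ℂ (fun s : ℂ => (LinearMap.det ((1 : Module.End ℂ W) - ((q : ℂ) ^ (-s)) • T))⁻¹) s₀ ↔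
      LinearMap.det ((1 : Module.End ℂ W) - ((q : ℂ) ^ (-s₀)) • T) ≠ 0 := by
  have hq0 : (q : ℂ) ≠ 0 := Nat.cast_ne_zero.2 (by omega)
  obtain ⟨p, hp⟩ := exists_polynomial_on_line (det_mem_polyFun (LinearMap.id (R := ℂ)
    (M := Module.End ℂ W))) 1 (-T)
  have hdet : ∀ z : ℂ, LinearMap.det ((1 : Module.End ℂ W) - z • T) = p.eval z := fun z => by
    rw [← hp, LinearMap.id_apply, smul_neg, sub_eq_add_neg]
  simp only [hdet]
  have han : ∀ s, AnalyticAt ℂ (fun s : ℂ => p.eval ((q : ℂ) ^ (-s))) s := fun s => by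
    have : Differentiable ℂ fun s : ℂ => p.eval ((q : ℂ) ^ (-s)) :=
      p.differentiable.comp fun s => (differentiable_neg s).const_cpow (Or.inl hq0)
    exact this.analyticAt s
  refine ⟨fun h h0 => ?_, fun h => (han s₀).inv h⟩
  have hp0 : p ≠ 0 := by
    rintro rfl
    have := hdet 0
    simp at this
  -- Zeros are isolated: otherwise `p (q ^ (-s))` vanishes identically, and since every nonzero `z`
  -- is some `q ^ (-s)`, the polynomial `p * X` would be zero.
  have hne : ∀ᶠ s in nhdsWithin s₀ {s₀}ᶜ, p.eval ((q : ℂ) ^ (-s)) ≠ 0 := by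
    refine (han s₀).eventually_eq_zero_or_eventually_ne_zero.resolve_left fun hz => ?_
    have hall := AnalyticOnNhd.eq_of_eventuallyEq (f := fun s : ℂ => p.eval ((q : ℂ) ^ (-s)))
      (g := fun _ => 0) (fun s _ => han s) (fun s _ => analyticAt_const) hz
    obtain ⟨z, hz⟩ : ∃ z : ℂ, (p * Polynomial.X).eval z ≠ 0 := by
      by_contra hcon
      push Not at hcon
      exact mul_ne_zero hp0 Polynomial.X_ne_zero (Polynomial.funext fun z => by
        rw [hcon z, Polynomial.eval_zero])
    rw [Polynomial.eval_mul, Polynomial.eval_X] at hz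
    have hlog : Complex.log q ≠ 0 := by
      rw [← Complex.natCast_log, Complex.ofReal_ne_zero]
      exact (Real.log_pos (by exact_mod_cast hq)).ne'
    refine left_ne_zero_of_mul hz ?_
    have h1 := congrFun hall (-(Complex.log z / Complex.log q))
    simp only [neg_neg] at h1
    rwa [Complex.cpow_def_of_ne_zero hq0, mul_div_cancel₀ _ hlog,
      Complex.exp_log (right_ne_zero_of_mul hz)] at h1
  -- At a zero of the determinant, regularity of the inverse would make this product tend to `0`,
  -- but it equals `1` on a punctured neighbourhood. The default value `0` at the pole plays no
  -- part.
  have hlim : Filter.Tendsto (fun s : ℂ => (p.eval ((q : ℂ) ^ (-s)))⁻¹ * p.eval ((q : ℂ) ^ (-s)))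
      (nhdsWithin s₀ {s₀}ᶜ) (nhds 0) := by
    have := (h.continuousAt.mul (han s₀).continuousAt).tendsto
    rw [Pi.mul_apply, h0, mul_zero] at this
    exact this.mono_left nhdsWithin_le_nhds
  have hlim' : Filter.Tendsto (fun s : ℂ => (p.eval ((q : ℂ) ^ (-s)))⁻¹ * p.eval ((q : ℂ) ^ (-s)))
      (nhdsWithin s₀ {s₀}ᶜ) (nhds 1) :=
    tendsto_const_nhds.congr' (hne.mono fun s hs => (inv_mul_cancel₀ hs).symm)
  exact zero_ne_one (tendsto_nhds_unique hlim hlim')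

variable {F : Type*} [Field F] [ValuativeRel F] [TopologicalSpace F]
  [IsNonarchimedeanLocalField F]

namespace LParameter

variable {D : LGroupData F} (φ : LParameter D)

/-- The determinant at `s = 1` vanishes exactly when Frobenius has eigenvalue `q = |Fr|⁻¹` on
`kerInvariants`. Inertia being trivial there, such eigenvectors are the nonzero elements of weight
`-1` killed by `ad N`. -/
lemma analyticAt_adjointLFactor_iff {Fr : WeilGroup F} (hFr : IsGeometricFrobenius Fr) :
    AnalyticAt ℂ (φ.adjointLFactor Fr) 1 ↔
      ∀ y ∈ φ.weightSpace (-1), adjoint φ.nilp y = 0 → y = 0 := by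
  have hq0 : (residueCard F : ℂ) ≠ 0 := Nat.cast_ne_zero.2 (by have := one_lt_residueCard F; omega)
  have hFrq : (weilNorm Fr : ℂ) ^ (-1 : ℤ) = residueCard F := by
    rw [weilNorm_frob hFr, Complex.ofReal_inv, zpow_neg_one, inv_inv, Complex.ofReal_natCast]
  refine (analyticAt_inv_det_iff (φ.frobOperator Fr) (one_lt_residueCard F) 1).trans ?_
  rw [← isUnit_iff_ne_zero, ← LinearMap.isUnit_iff_isUnit_det, LinearMap.isUnit_iff_ker_eq_bot,
    LinearMap.ker_eq_bot', Complex.cpow_neg_one]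
  constructor
  · intro h y hy hNy
    have hmem : y ∈ φ.kerInvariants := ⟨hNy, fun w hw => φ.adInf_of_mem_weightSpace hy hw⟩
    refine congrArg Subtype.val (h ⟨y, hmem⟩ (Subtype.ext ?_))
    change y - (residueCard F : ℂ)⁻¹ • φ.adInf Fr y = 0
    rw [hy Fr, hFrq, smul_smul, inv_mul_cancel₀ hq0, one_smul, sub_self]
  · rintro h ⟨y, hNy, hI⟩ hy
    have hy' : y - (residueCard F : ℂ)⁻¹ • φ.adInf Fr y = 0 := congrArg Subtype.val hy
    refine Subtype.ext (h y (φ.mem_weightSpace_of_frob hI hFr ?_) hNy)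
    rw [hFrq]
    conv_rhs => rw [sub_eq_zero.1 hy']
    rw [smul_smul, mul_inv_cancel₀ hq0, one_smul]

end LParameter

end LFactor

end Langlands

theorem proposition3p6 {F : Type*} [Field F] [ValuativeRel F] [TopologicalSpace F]
    [IsNonarchimedeanLocalField F] [CharZero F] (D : Langlands.LGroupData F)
    (φ : Langlands.LParameter D) (Fr : Langlands.WeilGroup F)
    (hFr : Langlands.IsGeometricFrobenius Fr) :
    AnalyticAt ℂ (φ.adjointLFactor Fr) 1 ↔ φ.IsOpenParameter :=
  (φ.analyticAt_adjointLFactor_iff hFr).trans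
    ((φ.adjoint_surjective_iff hFr).symm.trans φ.isOpenParameter_iff.symm)

end
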